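/- All manifolds are real, Hausdorff, second countable and $C^\infty$, and all maps and tensor fields are $C^\infty$. Let $\kappa\colon\mathcal M\to M$ be a fibre bundle with $\dim M=m\ge 1$ and $\dim\mathcal M=m+n$, let $\eta$ be a volume form on $M$ and $\omega=\kappa^*\eta$, and let $\Omega\in\Omega^{m+1}(\mathcal M)$ be a closed form. The triple $(\mathcal M,\Omega,\omega)$ is called a multisymplectic system if $\Omega$ is $1$-nondegenerate, i.e. if $v\mapsto i(v)\Omega_x$ is injective on $T_x\mathcal M$ for every $x$, and a premultisymplectic system otherwise. For $U\subseteq\mathcal M$ open let $\ker^m(\Omega|_U)$ be the $C^\infty(U)$-module of $m$-multivector fields $\mathbf X$ (sections of $\Lambda^mT\mathcal M$) on $U$ with $i(\mathbf X)\Omega=0$ on $U$, and put $\ker^m\Omega=\ker^m(\Omega|_{\mathcal M})$. A vector field $Y$ on $\mathcal M$ is an infinitesimal symmetry if its local flows preserve $\ker^m\Omega$: for every local flow $F_t\colon U\to F_t(U)$ of $Y$ (a smooth family of diffeomorphisms between open subsets of $\mathcal M$, with $t$ in an open interval around $0$, $F_0=\mathrm{id}$, and $t\mapsto F_t(p)$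 an integral curve of $Y$ for each $p\in U$) one has $F_{t*}\big(\ker^m(\Omega|_U)\big)\subset\ker^m(\Omega|_{F_t(U)})$ for all such $t$. **Theorem.** Let $(\mathcal M,\Omega,\omega)$ be a multisymplectic system, or a premultisymplectic system for which $\ker^m\Omega$ is locally finitely generated (every point of $\mathcal M$ has an open neighbourhood $U$ such that $\ker^m(\Omega|_U)$ is a finitely generated $C^\infty(U)$-module). Let $Y$ be a vector field on $\mathcal M$. Then $Y$ is an infinitesimal symmetry if and only if $$[Y,\mathbf X]\in\ker^m\Omega\quad\text{for every }\mathbf X\in\ker^m\Omega ,$$ where $[Y,\mathbf X]$ is the Schouten–Nijenhuis bracket, in coordinates $[Y,\mathbf X]^{i_1\dots i_m}=Y^k\partial_kX^{i_1\dots i_m}-\sum_{r=1}^m X^{i_1\dots k\dots i_m}\,\partial_kY^{i_r}$ (with $k$ in the $r$-th place of the last term). -/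

import Mathlib

open scoped Manifold ContDiff

noncomputable section

namespace Multisymplectic

/-! ### Multivectors on a vector space -/

section Linear

variable {V W : Type*}
  [AddCommGroup V] [Module ℝ V] [TopologicalSpace V] [IsTopologicalAddGroup V]
  [ContinuousSMul ℝ V]
  [AddCommGroup W] [Module ℝ W] [TopologicalSpace W] [IsTopologicalAddGroup W]
  [ContinuousSMul ℝ W]

/-- The space of `m`-vectors of a finite-dimensional real vector space `V`, as contravariant
skew-symmetric tensors of order `m`: alternating `m`-linear forms on the dual space. The wedge
product `v₁ ∧ ⋯ ∧ vₘ` is the form `(α₁, …, αₘ) ↦ det (αᵢ (vⱼ))`. -/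
abbrev Multivector (V : Type*) [AddCommGroup V] [Module ℝ V] [TopologicalSpace V]
    [IsTopologicalAddGroup V] [ContinuousSMul ℝ V] (m : ℕ) : Type _ :=
  (V →L[ℝ] ℝ) [⋀^Fin m]→L[ℝ] ℝ

/-- The push-forward `Λᵐ A` of `m`-vectors along a linear map `A`; on decomposable elements
it is `v₁ ∧ ⋯ ∧ vₘ ↦ A v₁ ∧ ⋯ ∧ A vₘ`. -/
def Multivector.map {m : ℕ} (A : V →L[ℝ] W) (X : Multivector V m) : Multivector W m :=
  X.compContinuousLinearMap (ContinuousLinearMap.precomp ℝ A)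

/-- The underlying multilinear form of `Multivector.derivation`. -/
def Multivector.derivationAux {m : ℕ} (A : V →L[ℝ] V) (X : Multivector V m) :
    ContinuousMultilinearMap ℝ (fun _ : Fin m => V →L[ℝ] ℝ) ℝ :=
  ∑ r : Fin m, X.toContinuousMultilinearMap.compContinuousLinearMap
    (Function.update (fun _ => ContinuousLinearMap.id ℝ (V →L[ℝ] ℝ)) r
      (ContinuousLinearMap.precomp ℝ A))

theorem Multivector.derivationAux_apply {m : ℕ} (A : V →L[ℝ] V) (X : Multivector V m)
    (α : Fin m → (V →L[ℝ] ℝ)) :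
    Multivector.derivationAux A X α = ∑ r, X (Function.update α r ((α r).comp A)) := by
  unfold Multivector.derivationAux
  rw [sum_apply]
  refine Finset.sum_congr rfl fun r _ => ?_
  rw [ContinuousMultilinearMap.compContinuousLinearMap_apply]
  change X _ = X _
  congr 1
  funext i
  by_cases h : i = r
  · subst h; simp
  · simp [h]

/-- The extension of an endomorphism `A` of `V` to `m`-vectors as a derivation; on decomposable
elements it is `v₁ ∧ ⋯ ∧ vₘ ↦ ∑ᵣ v₁ ∧ ⋯ ∧ A vᵣ ∧ ⋯ ∧ vₘ`. In terms of covectors,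
`(α₁, …, αₘ) ↦ ∑ᵣ X (α₁, …, αᵣ ∘ A, …, αₘ)`. -/
def Multivector.derivation {m : ℕ} (A : V →L[ℝ] V) (X : Multivector V m) : Multivector V m where
  toContinuousMultilinearMap := Multivector.derivationAux A X
  map_eq_zero_of_eq' := by
    intro α a b hab hne
    change Multivector.derivationAux A X α = 0
    rw [Multivector.derivationAux_apply, Finset.sum_eq_add a b hne]
    · have : Function.update α b ((α b).comp A) =
          Function.update α a ((α a).comp A) ∘ Equiv.swap a b := by
        funext i
        rcases eq_or_ne i a with rfl | hia
        · simp [hne, hne.symm, hab]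
        rcases eq_or_ne i b with rfl | hib
        · simp [hab]
        · simp [Equiv.swap_apply_of_ne_of_ne hia hib, hia, hib]
      rw [this, ← ContinuousAlternatingMap.coe_toAlternatingMap,
        AlternatingMap.map_swap _ _ hne, add_neg_cancel]
    · intro r _ hr
      refine X.map_eq_zero_of_eq _ (i := a) (j := b) ?_ hne
      rw [Function.update_of_ne hr.1.symm, Function.update_of_ne hr.2.symm, hab]
    · intro h; exact absurd (Finset.mem_univ _) h
    · intro h; exact absurd (Finset.mem_univ _) h

end Linear

/-- The contraction `i(X)Ω` of an `m`-vector `X` on `ℝᵈ` with an `(m+1)`-form `Ω`. With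
`X = ∑_{i₁ < ⋯ < iₘ} X^{i₁ ⋯ iₘ} e_{i₁} ∧ ⋯ ∧ e_{iₘ}` it is the `1`-form
`∑_{i₁ < ⋯ < iₘ} X^{i₁ ⋯ iₘ} i(e_{i₁}) ⋯ i(e_{iₘ}) Ω`, that is,
`v ↦ ∑_{i₁ < ⋯ < iₘ} X^{i₁ ⋯ iₘ} Ω (e_{iₘ}, …, e_{i₁}, v)`. -/
def contraction {d m : ℕ} (X : Multivector (EuclideanSpace ℝ (Fin d)) m)
    (Ω : EuclideanSpace ℝ (Fin d) [⋀^Fin (m + 1)]→L[ℝ] ℝ) : EuclideanSpace ℝ (Fin d) →L[ℝ] ℝ :=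
  ∑ i : Fin m ↪o Fin d,
    X (fun j => EuclideanSpace.proj (i j)) •
      Ω.toContinuousMultilinearMap.toContinuousLinearMap
        (Fin.snoc (fun j : Fin m => EuclideanSpace.single (i j.rev) (1 : ℝ)) 0) (Fin.last m)

/-- The Schouten-Nijenhuis bracket `[Y, X]` of a vector field `Y` and an `m`-multivector field `X`
on a normed space (a Euclidean space in the applications). In coordinates,
`[Y, X]^{i₁ ⋯ iₘ} = Y^k ∂ₖ X^{i₁ ⋯ iₘ} - ∑ᵣ X^{i₁ ⋯ k ⋯ iₘ} ∂ₖ Y^{iᵣ}`. -/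
def schoutenBracketChart {E : Type*} [NormedAddCommGroup E] [NormedSpace ℝ E] {m : ℕ}
    (Y : E → E) (X : E → Multivector E m) (x : E) : Multivector E m :=
  fderiv ℝ X x (Y x) - Multivector.derivation (fderiv ℝ Y x) (X x)

/-! ### Vector fields, multivector fields and differential forms on a manifold -/

section Manifold

variable {d : ℕ} {N : Type*} [TopologicalSpace N] [ChartedSpace (EuclideanSpace ℝ (Fin d)) N]

variable (d N) in
/-- Vector fields, not necessarily smooth. -/
abbrev VField : Type _ := (p : N) → TangentSpace (𝓡 d) p

variable (d N) in
/-- `m`-multivector fields, not necessarily smooth. -/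
abbrev MultivectorField (m : ℕ) : Type _ := (p : N) → Multivector (TangentSpace (𝓡 d) p) m

variable (d N) in
/-- Differential `k`-forms, not necessarily smooth. -/
abbrev DiffForm (k : ℕ) : Type _ := (p : N) → TangentSpace (𝓡 d) p [⋀^Fin k]→L[ℝ] ℝ

/-- Smoothness of a vector field. -/
def VField.IsSmooth [IsManifold (𝓡 d) 1 N] (Y : VField d N) : Prop :=
  ContMDiff (𝓡 d) ((𝓡 d).prod 𝓘(ℝ, EuclideanSpace ℝ (Fin d))) ∞
    (fun p => (⟨p, Y p⟩ : TangentBundle (𝓡 d) N))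

/-- The expression of a vector field in the chart at `x₀`. -/
def VField.inChart (Y : VField d N) (x₀ : N) (y : EuclideanSpace ℝ (Fin d)) :
    EuclideanSpace ℝ (Fin d) :=
  mfderiv (𝓡 d) 𝓘(ℝ, EuclideanSpace ℝ (Fin d)) (extChartAt (𝓡 d) x₀)
    ((extChartAt (𝓡 d) x₀).symm y) (Y ((extChartAt (𝓡 d) x₀).symm y))

/-- The expression of a multivector field in the chart at `x₀`. -/
def MultivectorField.inChart {m : ℕ} (X : MultivectorField d N m) (x₀ : N)
    (y : EuclideanSpace ℝ (Fin d)) : Multivector (EuclideanSpace ℝ (Fin d)) m :=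
  Multivector.map
    (mfderiv (𝓡 d) 𝓘(ℝ, EuclideanSpace ℝ (Fin d)) (extChartAt (𝓡 d) x₀)
      ((extChartAt (𝓡 d) x₀).symm y))
    (X ((extChartAt (𝓡 d) x₀).symm y))

/-- The expression of a differential form in the chart at `x₀`. -/
def DiffForm.inChart {k : ℕ} (α : DiffForm d N k) (x₀ : N)
    (y : EuclideanSpace ℝ (Fin d)) : EuclideanSpace ℝ (Fin d) [⋀^Fin k]→L[ℝ] ℝ :=
  (α ((extChartAt (𝓡 d) x₀).symm y)).compContinuousLinearMap
    (mfderiv 𝓘(ℝ, EuclideanSpace ℝ (Fin d)) (𝓡 d) (extChartAt (𝓡 d) x₀).symm y)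

/-- `X` is smooth on the open set `U`. -/
def MultivectorField.IsSmoothOn {m : ℕ} (X : MultivectorField d N m) (U : Set N) : Prop :=
  ∀ x₀ : N, ContDiffOn ℝ ∞ (X.inChart x₀)
    ((extChartAt (𝓡 d) x₀).target ∩ (extChartAt (𝓡 d) x₀).symm ⁻¹' U)

/-- Smoothness of a differential form. -/
def DiffForm.IsSmooth {k : ℕ} (α : DiffForm d N k) : Prop :=
  ∀ x₀ : N, ContDiffOn ℝ ∞ (α.inChart x₀) (extChartAt (𝓡 d) x₀).target

/-- A differential form is closed if its exterior derivative vanishes in every chart. -/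
def DiffForm.IsClosed {k : ℕ} (α : DiffForm d N k) : Prop :=
  ∀ x₀ : N, ∀ y ∈ (extChartAt (𝓡 d) x₀).target, extDeriv (α.inChart x₀) y = 0

/-- The Schouten-Nijenhuis bracket `[Y, X]` of a vector field and an `m`-multivector field,
computed at each point in the preferred chart at that point. -/
def schoutenBracket {m : ℕ} (Y : VField d N) (X : MultivectorField d N m) :
    MultivectorField d N m := fun p =>
  Multivector.map
    (mfderiv 𝓘(ℝ, EuclideanSpace ℝ (Fin d)) (𝓡 d) (extChartAt (𝓡 d) p).symm
      (extChartAt (𝓡 d) p p))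
    (schoutenBracketChart (Y.inChart p) (X.inChart p) (extChartAt (𝓡 d) p p))

/-- `kerm Ω U` is `kerᵐ(Ω|_U)`: the `m`-multivector fields that are smooth on `U` and satisfy
`i(X)Ω = 0` on `U` (their values outside `U` are irrelevant). In particular `kerm Ω Set.univ`
is `kerᵐ Ω`. -/
def kerm {m : ℕ} (Ω : DiffForm d N (m + 1)) (U : Set N) : Set (MultivectorField d N m) :=
  {X | X.IsSmoothOn U ∧ ∀ p ∈ U, contraction (X p) (Ω p) = 0}

/-- An `(m+1)`-form is `1`-nondegenerate if `v ↦ i(v)Ωₚ` is injective at every point `p`. -/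
def IsNondegenerate {m : ℕ} (Ω : DiffForm d N (m + 1)) : Prop :=
  ∀ (p : N) (v : TangentSpace (𝓡 d) p),
    (∀ w : Fin m → TangentSpace (𝓡 d) p, Ω p (Fin.cons v w) = 0) → v = 0

/-- `kerᵐ Ω` is locally finitely generated over the smooth functions: every point has an open
neighbourhood `U` such that finitely many elements of `kerᵐ(Ω|_U)` span `kerᵐ(Ω|_U)` over
`C^∞(U)`. -/
def KermLocallyFinitelyGenerated {m : ℕ} (Ω : DiffForm d N (m + 1)) : Prop :=
  ∀ p : N, ∃ U : Set N, IsOpen U ∧ p ∈ U ∧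
    ∃ (r : ℕ) (Z : Fin r → MultivectorField d N m), (∀ i, Z i ∈ kerm Ω U) ∧
      ∀ X ∈ kerm Ω U, ∃ f : Fin r → N → ℝ,
        (∀ i, ContMDiffOn (𝓡 d) 𝓘(ℝ, ℝ) ∞ (f i) U) ∧ ∀ q ∈ U, X q = ∑ i, f i q • Z i q

/-! ### Local flows and symmetries -/

/-- The push-forward `Φ_* X`, on the target of `Φ`, of a multivector field on the source of the
local diffeomorphism `Φ`: `(Φ_* X)(Φ p) = Λᵐ(T_p Φ) (X p)`. -/
def pushforward {m : ℕ} (Φ : OpenPartialHomeomorph N N) (X : MultivectorField d N m) :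
    MultivectorField d N m := fun q =>
  Multivector.map (W := TangentSpace (𝓡 d) q) (mfderiv (𝓡 d) (𝓡 d) Φ (Φ.symm q)) (X (Φ.symm q))

variable (d) in
/-- `Φ` is a diffeomorphism from its (open) source onto its (open) target. -/
def IsLocalDiffeo (Φ : OpenPartialHomeomorph N N) : Prop :=
  ContMDiffOn (𝓡 d) (𝓡 d) ∞ Φ Φ.source ∧ ContMDiffOn (𝓡 d) (𝓡 d) ∞ Φ.symm Φ.target

/-- A local symmetry: a diffeomorphism `Φ` between open subsets of `N` such that
`Φ_*(kerᵐ Ω) ⊆ kerᵐ Ω` in the corresponding open sets. -/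
def IsLocalSymmetry {m : ℕ} (Ω : DiffForm d N (m + 1)) (Φ : OpenPartialHomeomorph N N) : Prop :=
  IsLocalDiffeo d Φ ∧ ∀ X ∈ kerm Ω Φ.source, pushforward Φ X ∈ kerm Ω Φ.target

/-- A local flow of the vector field `Y`: a smooth family of diffeomorphisms `F t`, for `t` in an
open interval `(a, b)` around `0`, from an open set `dom` onto open sets, such that `F 0` is the
identity and `t ↦ F t p` is an integral curve of `Y` for every `p ∈ dom`. -/
structure LocalFlow (Y : VField d N) where
  dom : Set N
  isOpen_dom : IsOpen dom
  a : ℝ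
  b : ℝ
  a_neg : a < 0
  b_pos : 0 < b
  F : ℝ → OpenPartialHomeomorph N N
  source_eq : ∀ t ∈ Set.Ioo a b, (F t).source = dom
  isLocalDiffeo : ∀ t ∈ Set.Ioo a b, IsLocalDiffeo d (F t)
  smooth : ContMDiffOn (𝓘(ℝ, ℝ).prod (𝓡 d)) (𝓡 d) ∞ (fun z : ℝ × N => F z.1 z.2)
    (Set.Ioo a b ×ˢ dom)
  map_zero : ∀ p ∈ dom, F 0 p = p
  integralCurve : ∀ p ∈ dom, IsMIntegralCurveOn (I := 𝓡 d) (fun t => F t p) Y (Set.Ioo a b)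

/-- An infinitesimal symmetry: a vector field all of whose local flows consist of local
symmetries. -/
def IsInfinitesimalSymmetry {m : ℕ} (Ω : DiffForm d N (m + 1)) (Y : VField d N) : Prop :=
  ∀ φ : LocalFlow Y, ∀ t ∈ Set.Ioo φ.a φ.b, IsLocalSymmetry Ω (φ.F t)

end Manifold

/-! ### (Pre)multisymplectic systems -/

/-- `κ : N → B` is a smooth fibre bundle with typical fibre `P`. -/
def IsSmoothFibreBundle {m n : ℕ} {B P N : Type*}
    [TopologicalSpace B] [ChartedSpace (EuclideanSpace ℝ (Fin m)) B]
    [TopologicalSpace P] [ChartedSpace (EuclideanSpace ℝ (Fin n)) P]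
    [TopologicalSpace N] [ChartedSpace (EuclideanSpace ℝ (Fin (m + n))) N] (κ : N → B) : Prop :=
  ContMDiff (𝓡 (m + n)) (𝓡 m) ∞ κ ∧
    ∀ x : B, ∃ e : Bundle.Trivialization P κ, x ∈ e.baseSet ∧
      ContMDiffOn (𝓡 (m + n)) ((𝓡 m).prod (𝓡 n)) ∞ e e.source ∧
      ContMDiffOn ((𝓡 m).prod (𝓡 n)) (𝓡 (m + n)) ∞ e.toOpenPartialHomeomorph.symm e.target

/-- A (pre)multisymplectic system `(N, Ω, ω)`: a fibre bundle `κ : N → B` with `dim B = m` and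
`dim N = m + n`, a volume form `η` on `B` (giving `ω = κ^* η`), and a closed `(m+1)`-form `Ω` on
`N`. The system is multisymplectic if `Ω` is `1`-nondegenerate, and premultisymplectic
otherwise. -/
structure PremultisymplecticSystem (m n : ℕ) (B P N : Type*)
    [TopologicalSpace B] [ChartedSpace (EuclideanSpace ℝ (Fin m)) B]
    [TopologicalSpace P] [ChartedSpace (EuclideanSpace ℝ (Fin n)) P]
    [TopologicalSpace N] [ChartedSpace (EuclideanSpace ℝ (Fin (m + n))) N] where
  κ : N → B
  isSmoothFibreBundle : IsSmoothFibreBundle (m := m) (n := n) (P := P) κ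
  η : DiffForm m B m
  smooth_η : η.IsSmooth
  η_ne_zero : ∀ x, η x ≠ 0
  Ω : DiffForm (m + n) N (m + 1)
  smooth_Ω : Ω.IsSmooth
  closed_Ω : Ω.IsClosed

/-- The form `ω = κ^* η` of a (pre)multisymplectic system. -/
def PremultisymplecticSystem.ω {m n : ℕ} {B P N : Type*}
    [TopologicalSpace B] [ChartedSpace (EuclideanSpace ℝ (Fin m)) B]
    [TopologicalSpace P] [ChartedSpace (EuclideanSpace ℝ (Fin n)) P]
    [TopologicalSpace N] [ChartedSpace (EuclideanSpace ℝ (Fin (m + n))) N]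
    (S : PremultisymplecticSystem m n B P N) : DiffForm (m + n) N m := fun p =>
  (S.η (S.κ p)).compContinuousLinearMap (mfderiv (𝓡 (m + n)) (𝓡 m) S.κ p)

end Multisymplectic

end

noncomputable section

namespace Multisymplectic

/-! ### Functoriality and product rules for multivectors -/

section MultivectorCalculus

open Topology

/-! Fix a point p and a local flow F of Y, and compare multivectors along the curve t ↦ F_t p.

Suppose the flow preserves the kernel and X lies in it. Then both the push-forward of X_p by F_t and
the value of X at F_t p are annihilated by Ω at F_t p. Differentiate the two identities at t = 0 in
a chart. Both contain the term i(X)(DΩ·Y); the other terms are i(DY·X)Ω, with DY acting as a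
derivation, and i(DX·Y)Ω. Subtracting gives i([Y, X])Ω = 0. This needs a local flow through every
point (`exists_localFlow`); it comes from the implicit function theorem applied to the integral
equation on a space of curves.

Conversely, let K_q (`kermAt`) be the space of values at q of kernel fields. It can be smaller than
the kernel of the pointwise map X ↦ i(X)Ω_q, and no constancy of rank is assumed; finite generation
takes its place. If Z_1, …, Z_r generate the kernel near F_{t₀} p, then [Y, Z_i] = ∑ f_ij Z_j. Hence
the pull-backs u_i(t) of Z_i from F_t p to p solve the linear system u_i' = ∑ f_ij(F_t p) u_j
(`LocalFlow.hasDerivAt_pullback`). A linear functional that kills all u_i at one time kills them at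
all times, by uniqueness, so the span of the u_i does not move (`span_range_eq_of_linear_ode`). The
pull-back of K_{F_t p} to p is therefore locally constant in t, hence constant on the interval, and
at t = 0 it is K_p. So F_t carries values of kernel fields to values of kernel fields, which Ω
annihilates.

Bump functions pass from kernel fields on an open set to global ones, and the bracket is local
(`schoutenBracket_mem_kerm`). In the multisymplectic case finite generation is automatic: X ↦
i(X)Ω_q maps onto the covectors (`contraction_surjective`), so the kernels near each point are
spanned by finitely many smooth sections. -/

instance finiteDimensional_continuousAlternatingMap {ι V : Type*} [Finite ι] [NormedAddCommGroup V]
    [NormedSpace ℝ V] [FiniteDimensional ℝ V] : FiniteDimensional ℝ (V [⋀^ι]→L[ℝ] ℝ) :=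
  Module.Finite.of_injective
    (⟨⟨fun f => (f : V [⋀^ι]→L[ℝ] ℝ).toAlternatingMap.toMultilinearMap, fun _ _ => rfl⟩,
      fun _ _ => rfl⟩ : (V [⋀^ι]→L[ℝ] ℝ) →ₗ[ℝ] MultilinearMap ℝ (fun _ : ι => V) ℝ)
    fun _ _ h => ContinuousAlternatingMap.ext fun v => congrArg (fun F => F v) h

section Algebra

variable {V W Z : Type*}
  [AddCommGroup V] [Module ℝ V] [TopologicalSpace V] [IsTopologicalAddGroup V]
  [ContinuousSMul ℝ V]
  [AddCommGroup W] [Module ℝ W] [TopologicalSpace W] [IsTopologicalAddGroup W]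
  [ContinuousSMul ℝ W]
  [AddCommGroup Z] [Module ℝ Z] [TopologicalSpace Z] [IsTopologicalAddGroup Z]
  [ContinuousSMul ℝ Z] {m : ℕ}

theorem Multivector.map_apply (A : V →L[ℝ] W) (X : Multivector V m) (α : Fin m → W →L[ℝ] ℝ) :
    Multivector.map A X α = X fun i => (α i).comp A := rfl

theorem Multivector.map_id (X : Multivector V m) :
    Multivector.map (ContinuousLinearMap.id ℝ V) X = X := rfl

theorem Multivector.map_map (B : W →L[ℝ] Z) (A : V →L[ℝ] W) (X : Multivector V m) :
    Multivector.map B (Multivector.map A X) = Multivector.map (B.comp A) X := rfl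

theorem Multivector.map_add (A : V →L[ℝ] W) (X X' : Multivector V m) :
    Multivector.map A (X + X') = Multivector.map A X + Multivector.map A X' := rfl

theorem Multivector.map_sub (A : V →L[ℝ] W) (X X' : Multivector V m) :
    Multivector.map A (X - X') = Multivector.map A X - Multivector.map A X' := rfl

theorem Multivector.map_zero (A : V →L[ℝ] W) :
    Multivector.map A (0 : Multivector V m) = 0 := rfl

theorem Multivector.map_smul (A : V →L[ℝ] W) (c : ℝ) (X : Multivector V m) :
    Multivector.map A (c • X) = c • Multivector.map A X := rfl

/-- `Multivector.map` as a linear map. -/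
def Multivector.mapₗ (A : V →L[ℝ] W) : Multivector V m →ₗ[ℝ] Multivector W m where
  toFun := Multivector.map A
  map_add' := Multivector.map_add A
  map_smul' := Multivector.map_smul A

theorem Multivector.mapₗ_apply (A : V →L[ℝ] W) (X : Multivector V m) :
    Multivector.mapₗ A X = Multivector.map A X := rfl

theorem Multivector.derivation_apply (A : V →L[ℝ] V) (X : Multivector V m)
    (α : Fin m → V →L[ℝ] ℝ) :
    Multivector.derivation A X α = ∑ r, X (Function.update α r ((α r).comp A)) :=
  Multivector.derivationAux_apply A X α

end Algebra

variable {E F G : Type*} [NormedAddCommGroup E] [NormedSpace ℝ E]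
  [NormedAddCommGroup F] [NormedSpace ℝ F] [NormedAddCommGroup G] [NormedSpace ℝ G] {m : ℕ}

theorem _root_.HasDerivAt.clm_comp_left (P : E →L[ℝ] F) {A : ℝ → E} {A' : E} {t : ℝ}
    (hA : HasDerivAt A A' t) : HasDerivAt (fun s => P (A s)) (P A') t :=
  P.hasFDerivAt.comp_hasDerivAt t hA

theorem contDiff_continuousMultilinearMap_comp {ι V W : Type*} [Fintype ι] [NormedAddCommGroup V]
    [NormedSpace ℝ V] [NormedAddCommGroup W] [NormedSpace ℝ W]
    (f : ContinuousMultilinearMap ℝ (fun _ : ι => V) W) {k : WithTop ℕ∞} :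
    ContDiff ℝ k fun v : V => f fun _ => v :=
  f.contDiff.comp (contDiff_pi.2 fun _ => contDiff_id)

/-- The expression is multilinear in the linear map and linear in the form. It is read in the space
of all multilinear maps, where this structure is available; `contDiff_of_injective_comp` brings the
result back to alternating ones. -/
theorem contDiff_compContinuousLinearMap {k : WithTop ℕ∞} :
    ContDiff ℝ k (fun z : (F →L[ℝ] E) × (E [⋀^Fin m]→L[ℝ] G) =>
      (z.2.compContinuousLinearMap z.1).toContinuousMultilinearMap) := by
  have h1 := contDiff_continuousMultilinearMap_comp (V := F →L[ℝ] E) (k := k)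
    (W := ContinuousMultilinearMap ℝ (fun _ : Fin m => E) G →L[ℝ]
      ContinuousMultilinearMap ℝ (fun _ : Fin m => F) G)
    (ContinuousMultilinearMap.compContinuousLinearMapContinuousMultilinear ℝ
      (fun _ : Fin m => F) (fun _ : Fin m => E) G)
  have h2 : ContDiff ℝ k fun X : E [⋀^Fin m]→L[ℝ] G => X.toContinuousMultilinearMap :=
    (ContinuousAlternatingMap.toContinuousMultilinearMapLI
      (𝕜 := ℝ) (E := E) (F := G) (ι := Fin m)).contDiff
  exact (h1.comp contDiff_fst).clm_apply (h2.comp contDiff_snd)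

theorem exists_precomp (E F R : Type*) [NormedAddCommGroup E] [NormedSpace ℝ E]
    [NormedAddCommGroup F] [NormedSpace ℝ F] [NormedAddCommGroup R] [NormedSpace ℝ R] :
    ∃ P : (E →L[ℝ] F) →L[ℝ] (F →L[ℝ] R) →L[ℝ] E →L[ℝ] R,
      ∀ A, P A = ContinuousLinearMap.precomp R A :=
  ⟨(ContinuousLinearMap.compL ℝ E F R).flip, fun _ => rfl⟩

theorem contDiff_compContinuousLinearMap_precomp {R : Type*} [NormedAddCommGroup R]
    [NormedSpace ℝ R] {k : WithTop ℕ∞} :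
    ContDiff ℝ k (fun z : (E →L[ℝ] F) × ((E →L[ℝ] R) [⋀^Fin m]→L[ℝ] R) =>
      (z.2.compContinuousLinearMap
        (ContinuousLinearMap.precomp R z.1)).toContinuousMultilinearMap) := by
  obtain ⟨P, hP⟩ := exists_precomp E F R
  have h0 : ContDiff ℝ k fun z : (E →L[ℝ] F) × ((E →L[ℝ] R) [⋀^Fin m]→L[ℝ] R) =>
      (P z.1, z.2) := by fun_prop
  have h1 := contDiff_compContinuousLinearMap (E := E →L[ℝ] R) (F := F →L[ℝ] R) (G := R) (m := m)
    (k := k)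
  have h3 := h1.comp h0
  simp only [← hP]
  exact h3

/-- Leibniz rule. The part in which `A` is differentiated is an arbitrary form `w` known by its
values, so that a caller can insert a derivation in the shape it needs. -/
theorem hasDerivAt_compContinuousLinearMap {A : ℝ → F →L[ℝ] E} {A' : F →L[ℝ] E}
    {X : ℝ → E [⋀^Fin m]→L[ℝ] G} {X' : E [⋀^Fin m]→L[ℝ] G} {t : ℝ}
    (hA : HasDerivAt A A' t) (hX : HasDerivAt X X' t) {w : F [⋀^Fin m]→L[ℝ] G}
    (hw : ∀ v : Fin m → F,
      w v = ∑ r, X t (Function.update (fun i => A t (v i)) r (A' (v r)))) :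
    HasDerivAt (fun s => (X s).compContinuousLinearMap (A s))
      (X'.compContinuousLinearMap (A t) + w) t := by
  have h := (hX.hasFDerivAt.continuousAlternatingMapCompContinuousLinearMap
    hA.hasFDerivAt).hasDerivAt
  refine h.congr_deriv ?_
  ext α
  rw [ContinuousAlternatingMap.add_apply, hw]
  simp only [_root_.add_apply, ContinuousLinearMap.comp_apply,
    ContinuousAlternatingMap.add_apply, ContinuousAlternatingMap.fderivCompContinuousLinearMap_apply]
  congr 1
  · simp
  · refine Finset.sum_congr rfl fun r _ => congrArg _ (funext fun i => ?_)
    rcases eq_or_ne i r with rfl | h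
    · simp
    · simp [h]

theorem hasDerivAt_compContinuousLinearMap_precomp {R : Type*} [NormedAddCommGroup R]
    [NormedSpace ℝ R] {A : ℝ → E →L[ℝ] F} {A' : E →L[ℝ] F}
    {X : ℝ → (E →L[ℝ] R) [⋀^Fin m]→L[ℝ] R} {X' : (E →L[ℝ] R) [⋀^Fin m]→L[ℝ] R} {t : ℝ}
    (hA : HasDerivAt A A' t) (hX : HasDerivAt X X' t) {w : (F →L[ℝ] R) [⋀^Fin m]→L[ℝ] R}
    (hw : ∀ α : Fin m → F →L[ℝ] R,
      w α = ∑ r, X t (Function.update (fun i => (α i).comp (A t)) r ((α r).comp A'))) :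
    HasDerivAt (fun s => (X s).compContinuousLinearMap (ContinuousLinearMap.precomp R (A s)))
      (X'.compContinuousLinearMap (ContinuousLinearMap.precomp R (A t)) + w) t := by
  obtain ⟨P, hP⟩ := exists_precomp E F R
  have h1 : HasDerivAt (fun s => P (A s)) (P A') t :=
    HasDerivAt.clm_comp_left (E := E →L[ℝ] F) (F := (F →L[ℝ] R) →L[ℝ] E →L[ℝ] R) P hA
  simp only [← hP]
  refine hasDerivAt_compContinuousLinearMap (E := E →L[ℝ] R) (F := F →L[ℝ] R) (G := R) h1 hX ?_
  intro v
  simp only [hP]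
  exact hw v

/-- An injective linear map has a linear left inverse, and this one is continuous because its source
`F` is finite-dimensional. -/
theorem contDiff_of_injective_comp {Z : Type*} [NormedAddCommGroup Z] [NormedSpace ℝ Z]
    [FiniteDimensional ℝ F] (f : E →ₗ[ℝ] F) (hf : Function.Injective f)
    {g : Z → E} {k : WithTop ℕ∞} (hg : ContDiff ℝ k fun z => f (g z)) : ContDiff ℝ k g := by
  obtain ⟨h, hh⟩ := f.exists_leftInverse_of_injective (LinearMap.ker_eq_bot.2 hf)
  have := (LinearMap.toContinuousLinearMap h).contDiff.comp hg
  have h2 : ∀ x, h (f x) = x := fun x => congrArg (fun f => f x) hh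
  simpa only [Function.comp_def, LinearMap.coe_toContinuousLinearMap', h2] using this

theorem contDiff_map [FiniteDimensional ℝ E] [FiniteDimensional ℝ F] {k : WithTop ℕ∞} :
    ContDiff ℝ k (fun z : (E →L[ℝ] F) × Multivector E m => Multivector.map z.1 z.2) := by
  have : FiniteDimensional ℝ (ContinuousMultilinearMap ℝ (fun _ : Fin m => F →L[ℝ] ℝ) ℝ) :=
    Module.Finite.of_injective
      (⟨⟨fun f => f.toMultilinearMap, fun _ _ => rfl⟩, fun _ _ => rfl⟩ :
        ContinuousMultilinearMap ℝ (fun _ : Fin m => F →L[ℝ] ℝ) ℝ →ₗ[ℝ]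
          MultilinearMap ℝ (fun _ : Fin m => F →L[ℝ] ℝ) ℝ)
      fun _ _ h => ContinuousMultilinearMap.ext fun v => congrArg (fun F => F v) h
  exact contDiff_of_injective_comp (E := Multivector F m)
    (F := ContinuousMultilinearMap ℝ (fun _ : Fin m => F →L[ℝ] ℝ) ℝ)
    (Z := (E →L[ℝ] F) × Multivector E m)
    ⟨⟨fun f => f.toContinuousMultilinearMap, fun _ _ => rfl⟩, fun _ _ => rfl⟩
    ContinuousAlternatingMap.toContinuousMultilinearMap_injective
    (contDiff_compContinuousLinearMap_precomp (E := E) (F := F) (R := ℝ) (m := m) (k := k))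

theorem _root_.HasDerivAt.multivectorMap {A : ℝ → E →L[ℝ] F} {A' : E →L[ℝ] F}
    {X : ℝ → Multivector E m} {X' : Multivector E m} {t : ℝ}
    (hA : HasDerivAt A A' t) (hX : HasDerivAt X X' t) {w : Multivector F m}
    (hw : ∀ α : Fin m → F →L[ℝ] ℝ,
      w α = ∑ r, X t (Function.update (fun i => (α i).comp (A t)) r ((α r).comp A'))) :
    HasDerivAt (fun s => Multivector.map (A s) (X s)) (Multivector.map (A t) X' + w) t :=
  hasDerivAt_compContinuousLinearMap_precomp (E := E) (F := F) (R := ℝ) (m := m) hA hX hw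

/-- The case A' = D A, met by the derivative of a flow: differentiating the push-forward inserts a
derivation after it. The next lemma treats A' = A D, met by the inverse of that derivative, where
the derivation acts before the push-forward. -/
theorem _root_.HasDerivAt.multivectorMap_comp_left {A : ℝ → E →L[ℝ] F} {D : F →L[ℝ] F}
    {X : ℝ → Multivector E m} {X' : Multivector E m} {t : ℝ}
    (hA : HasDerivAt A (D.comp (A t)) t) (hX : HasDerivAt X X' t) :
    HasDerivAt (fun s => Multivector.map (A s) (X s))
      (Multivector.map (A t) X' + Multivector.derivation D (Multivector.map (A t) (X t))) t := by
  refine hA.multivectorMap hX fun α => ?_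
  rw [Multivector.derivation_apply]
  refine Finset.sum_congr rfl fun r _ => ?_
  rw [Multivector.map_apply]
  refine congrArg _ (funext fun i => ?_)
  rcases eq_or_ne i r with rfl | h
  · simp [ContinuousLinearMap.comp_assoc]
  · simp [h]

theorem _root_.HasDerivAt.multivectorMap_comp_right {A : ℝ → E →L[ℝ] F} {D : E →L[ℝ] E}
    {X : ℝ → Multivector E m} {X' : Multivector E m} {t : ℝ}
    (hA : HasDerivAt A ((A t).comp D) t) (hX : HasDerivAt X X' t) :
    HasDerivAt (fun s => Multivector.map (A s) (X s))
      (Multivector.map (A t) (X' + Multivector.derivation D (X t))) t := by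
  rw [Multivector.map_add]
  refine hA.multivectorMap hX fun α => ?_
  rw [Multivector.map_apply, Multivector.derivation_apply]
  refine Finset.sum_congr rfl fun r _ => ?_
  refine congrArg _ (funext fun i => ?_)
  rcases eq_or_ne i r with rfl | h
  · simp [ContinuousLinearMap.comp_assoc]
  · simp [h]

theorem Multivector.derivation_add (D D' : E →L[ℝ] E) (X : Multivector E m) :
    Multivector.derivation (D + D') X =
      Multivector.derivation D X + Multivector.derivation D' X := by
  ext α
  simp only [Multivector.derivation_apply, ContinuousAlternatingMap.add_apply,
    ← Finset.sum_add_distrib, ContinuousLinearMap.comp_add]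
  exact Finset.sum_congr rfl fun r _ => X.toAlternatingMap.map_update_add α r _ _

theorem Multivector.derivation_neg (D : E →L[ℝ] E) (X : Multivector E m) :
    Multivector.derivation (-D) X = -Multivector.derivation D X := by
  refine eq_neg_of_add_eq_zero_left (G := Multivector E m) ?_
  rw [← Multivector.derivation_add, neg_add_cancel]
  ext α
  rw [Multivector.derivation_apply]
  exact Finset.sum_eq_zero fun r _ =>
    X.toAlternatingMap.map_coord_zero r (by simp)

end MultivectorCalculus

/-! ### The contraction of an m-vector with an (m+1)-form, and its kernel -/

section Contraction

variable {d m : ℕ}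

/-- A sum over all tuples of indices of a symmetric summand that vanishes on tuples with
repetitions is `m!` times the sum over increasing tuples. -/
theorem sum_eq_factorial_mul_sum_orderEmbedding (g : (Fin m → Fin d) → ℝ)
    (h0 : ∀ f, ¬ Function.Injective f → g f = 0)
    (hσ : ∀ f (σ : Equiv.Perm (Fin m)), g (f ∘ σ) = g f) :
    ∑ f, g f = (m.factorial : ℝ) * ∑ i : Fin m ↪o Fin d, g i := by
  classical
  have h1 : ∑ p : (Fin m ↪o Fin d) × Equiv.Perm (Fin m), g (p.1 ∘ p.2) =
      ∑ f with Function.Injective f, g f := by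
    refine Finset.sum_bij (fun p _ => p.1 ∘ p.2) ?_ ?_ ?_ ?_
    · intro p _
      simpa using p.1.injective.comp p.2.injective
    · rintro ⟨i, σ⟩ - ⟨j, τ⟩ - h
      have hr : Set.range i = Set.range j := by
        have := congrArg Set.range h
        simpa only [Set.range_comp, Set.image_univ, EquivLike.range_eq_univ] using this
      have hij : i = j := by
        ext1 x
        have := (StrictMono.range_inj i.strictMono j.strictMono).1 hr
        exact congrFun this x
      subst hij
      refine Prod.ext rfl (Equiv.ext fun x => i.injective (congrFun h x))
    · intro f hf
      have hf : Function.Injective f := by simpa using hf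
      have hs : StrictMono (f ∘ Tuple.sort f) :=
        (Tuple.monotone_sort f).strictMono_of_injective (hf.comp (Tuple.sort f).injective)
      refine ⟨(OrderEmbedding.ofStrictMono _ hs, (Tuple.sort f)⁻¹), Finset.mem_univ _, ?_⟩
      funext x
      simp
    · intro _ _; rfl
  have h2 : ∑ f with Function.Injective f, g f = ∑ f, g f :=
    Finset.sum_subset (Finset.filter_subset _ _) fun f _ hf => h0 f (by simpa using hf)
  rw [← h2, ← h1, Fintype.sum_prod_type]
  simp only [hσ, Finset.sum_const, Finset.card_univ, Fintype.card_perm, Fintype.card_fin,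
    nsmul_eq_mul, Finset.mul_sum]

/-- The alternating form `u ↦ Ω (u_m, …, u_1, v)`. -/
def reversedInterior (Ω : EuclideanSpace ℝ (Fin d) [⋀^Fin (m + 1)]→L[ℝ] ℝ)
    (v : EuclideanSpace ℝ (Fin d)) : EuclideanSpace ℝ (Fin d) [⋀^Fin m]→ₗ[ℝ] ℝ where
  toMultilinearMap := ((LinearMap.applyₗ v).compMultilinearMap
    Ω.toMultilinearMap.curryRight).domDomCongr Fin.revPerm
  map_eq_zero_of_eq' u a b hab hne := by
    change Ω (Fin.snoc (fun j => u (Fin.revPerm j)) v) = 0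
    refine Ω.map_eq_zero_of_eq _ (i := (Fin.rev a).castSucc) (j := (Fin.rev b).castSucc) ?_ ?_
    · simp [hab]
    · simpa using hne

theorem reversedInterior_apply (Ω : EuclideanSpace ℝ (Fin d) [⋀^Fin (m + 1)]→L[ℝ] ℝ)
    (v : EuclideanSpace ℝ (Fin d)) (u : Fin m → EuclideanSpace ℝ (Fin d)) :
    reversedInterior Ω v u = Ω (Fin.snoc (fun j => u j.rev) v) := rfl

theorem contraction_apply (X : Multivector (EuclideanSpace ℝ (Fin d)) m)
    (Ω : EuclideanSpace ℝ (Fin d) [⋀^Fin (m + 1)]→L[ℝ] ℝ) (v : EuclideanSpace ℝ (Fin d)) :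
    contraction X Ω v = ∑ i : Fin m ↪o Fin d, X (fun j => EuclideanSpace.proj (i j)) *
      reversedInterior Ω v (fun j => EuclideanSpace.single (i j) 1) := by
  unfold contraction
  rw [sum_apply]
  refine Finset.sum_congr rfl fun i _ => ?_
  rw [reversedInterior_apply]
  change _ * Ω (Function.update _ _ _) = _
  rw [Fin.update_snoc_last]

/-- Both factors are alternating in the indices, so their product is symmetric and vanishes on
repeated indices. The sum over all tuples, unlike the one over increasing tuples, can be expanded
slot by slot. -/
theorem factorial_mul_contraction_apply (X : Multivector (EuclideanSpace ℝ (Fin d)) m)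
    (Ω : EuclideanSpace ℝ (Fin d) [⋀^Fin (m + 1)]→L[ℝ] ℝ) (v : EuclideanSpace ℝ (Fin d)) :
    (m.factorial : ℝ) * contraction X Ω v =
      ∑ f : Fin m → Fin d, X (fun j => EuclideanSpace.proj (f j)) *
        reversedInterior Ω v (fun j => EuclideanSpace.single (f j) 1) := by
  rw [contraction_apply]
  refine (sum_eq_factorial_mul_sum_orderEmbedding (fun f : Fin m → Fin d =>
    X (fun j => EuclideanSpace.proj (f j)) *
        reversedInterior Ω v (fun j => EuclideanSpace.single (f j) 1)) ?_ ?_).symm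
  · intro f hf
    simp only [Function.Injective, not_forall] at hf
    obtain ⟨a, b, hab, hne⟩ := hf
    rw [X.map_eq_zero_of_eq _ (i := a) (j := b) (by simp [hab]) hne, zero_mul]
  · intro f σ
    have h1 := X.toAlternatingMap.map_perm (fun j => EuclideanSpace.proj (f j)) σ
    have h2 := (reversedInterior Ω v).map_perm (fun j => EuclideanSpace.single (f j) 1) σ
    simp only [Function.comp_def] at h1 h2 ⊢
    change X _ = _ • X _ at h1
    rw [h1, h2]
    rcases Int.units_eq_one_or (Equiv.Perm.sign σ) with h | h <;> simp [h]

/-- Expanding in the standard bases turns both sides into the same double sum, weighted by products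
of matrix entries of `A`. -/
theorem sum_multilinear_transpose
    (X : MultilinearMap ℝ (fun _ : Fin m => EuclideanSpace ℝ (Fin d) →L[ℝ] ℝ) ℝ)
    (T : MultilinearMap ℝ (fun _ : Fin m => EuclideanSpace ℝ (Fin d)) ℝ)
    (A : EuclideanSpace ℝ (Fin d) →L[ℝ] EuclideanSpace ℝ (Fin d)) :
    ∑ f : Fin m → Fin d, X (fun j => (EuclideanSpace.proj (f j)).comp A) *
        T (fun j => EuclideanSpace.single (f j) 1) =
      ∑ k : Fin m → Fin d, X (fun j => EuclideanSpace.proj (k j)) *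
        T (fun j => A (EuclideanSpace.single (k j) 1)) := by
  classical
  have hA : ∀ i, (EuclideanSpace.proj i : EuclideanSpace ℝ (Fin d) →L[ℝ] ℝ).comp A =
      ∑ k, A (EuclideanSpace.single k 1) i • (EuclideanSpace.proj k : _ →L[ℝ] ℝ) := by
    intro i
    refine ContinuousLinearMap.coe_injective
      ((EuclideanSpace.basisFun (Fin d) ℝ).toBasis.ext fun j => ?_)
    simp
  have hA' : ∀ k, A (EuclideanSpace.single k 1) =
      ∑ i, A (EuclideanSpace.single k 1) i • EuclideanSpace.single i (1 : ℝ) := by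
    intro k
    ext i
    simp [Pi.single_apply]
  have e1 : ∀ f : Fin m → Fin d, X (fun j => (EuclideanSpace.proj (f j)).comp A) =
      ∑ k : Fin m → Fin d, (∏ j, A (EuclideanSpace.single (k j) 1) (f j)) *
        X (fun j => EuclideanSpace.proj (k j)) := by
    intro f
    simp only [hA]
    rw [X.map_sum]
    refine Finset.sum_congr rfl fun k _ => ?_
    exact X.map_smul_univ _ _
  have e2 : ∀ k : Fin m → Fin d, T (fun j => A (EuclideanSpace.single (k j) 1)) =
      ∑ f : Fin m → Fin d, (∏ j, A (EuclideanSpace.single (k j) 1) (f j)) *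
        T (fun j => EuclideanSpace.single (f j) 1) := by
    intro k
    have : (fun j => A (EuclideanSpace.single (k j) 1)) = fun j =>
      ∑ i, A (EuclideanSpace.single (k j) 1) i • EuclideanSpace.single i (1 : ℝ) :=
      funext fun j => hA' (k j)
    rw [this, T.map_sum]
    refine Finset.sum_congr rfl fun f _ => ?_
    exact T.map_smul_univ _ _
  simp only [e1, e2, Finset.sum_mul, Finset.mul_sum]
  rw [Finset.sum_comm]
  refine Finset.sum_congr rfl fun k _ => Finset.sum_congr rfl fun f _ => ?_
  ring

/-- Naturality A^*(i(A_*X)Ω) = i(X)(A^*Ω). Only transposition of `A` enters, so `A` need not be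
invertible. -/
theorem contraction_map_comp (A : EuclideanSpace ℝ (Fin d) →L[ℝ] EuclideanSpace ℝ (Fin d))
    (X : Multivector (EuclideanSpace ℝ (Fin d)) m)
    (Ω : EuclideanSpace ℝ (Fin d) [⋀^Fin (m + 1)]→L[ℝ] ℝ) :
    (contraction (Multivector.map A X) Ω).comp A =
      contraction X (Ω.compContinuousLinearMap A) := by
  ext1 v
  have hm : (m.factorial : ℝ) ≠ 0 := by exact_mod_cast m.factorial_ne_zero
  refine mul_left_cancel₀ hm ?_
  rw [ContinuousLinearMap.comp_apply, factorial_mul_contraction_apply,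
    factorial_mul_contraction_apply]
  refine (sum_multilinear_transpose X.toMultilinearMap
    (reversedInterior Ω (A v)).toMultilinearMap A).trans ?_
  refine Finset.sum_congr rfl fun k _ => ?_
  congr 1
  change Ω _ = Ω _
  congr 1
  funext j
  refine Fin.lastCases ?_ (fun j => ?_) j <;> simp

theorem contraction_add_left (X X' : Multivector (EuclideanSpace ℝ (Fin d)) m)
    (Ω : EuclideanSpace ℝ (Fin d) [⋀^Fin (m + 1)]→L[ℝ] ℝ) :
    contraction (X + X') Ω = contraction X Ω + contraction X' Ω := by
  simp only [contraction, ContinuousAlternatingMap.add_apply, add_smul, Finset.sum_add_distrib]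

theorem contraction_smul_left (c : ℝ) (X : Multivector (EuclideanSpace ℝ (Fin d)) m)
    (Ω : EuclideanSpace ℝ (Fin d) [⋀^Fin (m + 1)]→L[ℝ] ℝ) :
    contraction (c • X) Ω = c • contraction X Ω := by
  simp only [contraction, ContinuousAlternatingMap.smul_apply, Finset.smul_sum, smul_assoc]

theorem contraction_add_right (X : Multivector (EuclideanSpace ℝ (Fin d)) m)
    (Ω Ω' : EuclideanSpace ℝ (Fin d) [⋀^Fin (m + 1)]→L[ℝ] ℝ) :
    contraction X (Ω + Ω') = contraction X Ω + contraction X Ω' := by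
  ext1 v
  rw [_root_.add_apply]
  simp only [contraction_apply, reversedInterior_apply, ContinuousAlternatingMap.add_apply,
    mul_add, Finset.sum_add_distrib]

theorem contraction_smul_right (c : ℝ) (X : Multivector (EuclideanSpace ℝ (Fin d)) m)
    (Ω : EuclideanSpace ℝ (Fin d) [⋀^Fin (m + 1)]→L[ℝ] ℝ) :
    contraction X (c • Ω) = c • contraction X Ω := by
  ext1 v
  rw [_root_.smul_apply]
  simp only [contraction_apply, reversedInterior_apply, ContinuousAlternatingMap.smul_apply,
    smul_eq_mul, Finset.mul_sum]
  exact Finset.sum_congr rfl fun i _ => by ring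

attribute [local irreducible] contraction

/-- In finite dimension bilinearity implies continuity. The pairing is passed as a bare function
with its four identities, so the sum defining `contraction` never has to be unfolded. -/
theorem exists_clm_of_bilinear {V W Z : Type*} [NormedAddCommGroup V] [NormedSpace ℝ V]
    [NormedAddCommGroup W] [NormedSpace ℝ W] [NormedAddCommGroup Z] [NormedSpace ℝ Z]
    [FiniteDimensional ℝ V] [FiniteDimensional ℝ W] (b : V → W → Z)
    (h1 : ∀ v v' w, b (v + v') w = b v w + b v' w) (h2 : ∀ (c : ℝ) v w, b (c • v) w = c • b v w)
    (h3 : ∀ v w w', b v (w + w') = b v w + b v w') (h4 : ∀ (c : ℝ) v w, b v (c • w) = c • b v w) :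
    ∃ B : V →L[ℝ] W →L[ℝ] Z, ∀ v w, B v w = b v w :=
  ⟨LinearMap.toContinuousLinearMap (LinearMap.toContinuousLinearMap.toLinearMap ∘ₗ
    LinearMap.mk₂ ℝ b h1 h2 h3 h4), fun _ _ => rfl⟩

theorem hasDerivAt_bilinear {V W Z : Type*} [NormedAddCommGroup V] [NormedSpace ℝ V]
    [NormedAddCommGroup W] [NormedSpace ℝ W] [NormedAddCommGroup Z] [NormedSpace ℝ Z]
    [FiniteDimensional ℝ V] [FiniteDimensional ℝ W] (b : V → W → Z)
    (h1 : ∀ v v' w, b (v + v') w = b v w + b v' w) (h2 : ∀ (c : ℝ) v w, b (c • v) w = c • b v w)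
    (h3 : ∀ v w w', b v (w + w') = b v w + b v w') (h4 : ∀ (c : ℝ) v w, b v (c • w) = c • b v w)
    {v : ℝ → V} {w : ℝ → W} {v' : V} {w' : W} {t : ℝ}
    (hv : HasDerivAt v v' t) (hw : HasDerivAt w w' t) :
    HasDerivAt (fun s => b (v s) (w s)) (b v' (w t) + b (v t) w') t := by
  obtain ⟨B, hB⟩ := exists_clm_of_bilinear b h1 h2 h3 h4
  simpa only [hB] using (HasDerivAt.clm_comp_left B hv).clm_apply hw

theorem hasDerivAt_contraction {X : ℝ → Multivector (EuclideanSpace ℝ (Fin d)) m}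
    {Ω : ℝ → EuclideanSpace ℝ (Fin d) [⋀^Fin (m + 1)]→L[ℝ] ℝ} {X' Ω'} {t : ℝ}
    (hX : HasDerivAt X X' t) (hΩ : HasDerivAt Ω Ω' t) :
    HasDerivAt (fun s => contraction (X s) (Ω s))
      (contraction (X t) Ω' + contraction X' (Ω t)) t :=
  hasDerivAt_bilinear (V := EuclideanSpace ℝ (Fin d) [⋀^Fin (m + 1)]→L[ℝ] ℝ)
    (W := Multivector (EuclideanSpace ℝ (Fin d)) m) (Z := EuclideanSpace ℝ (Fin d) →L[ℝ] ℝ)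
    (fun Ω X => contraction X Ω) (fun Ω Ω' X => contraction_add_right X Ω Ω')
    (fun c Ω X => contraction_smul_right c X Ω) (fun Ω X X' => contraction_add_left X X' Ω)
    (fun c Ω X => contraction_smul_left c X Ω) hΩ hX

/-- Test with the m-vector X whose components are those of Ω(…, v) itself: up to the factor m!,
i(X)Ω evaluated at v is the sum of their squares, so all of them vanish. -/
theorem eq_zero_of_contraction_apply_eq_zero
    {Ω : EuclideanSpace ℝ (Fin d) [⋀^Fin (m + 1)]→L[ℝ] ℝ} {v : EuclideanSpace ℝ (Fin d)}
    (hv : ∀ X, contraction X Ω v = 0) (w : Fin m → EuclideanSpace ℝ (Fin d)) :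
    Ω (Fin.cons v w) = 0 := by
  -- The identification of covectors with vectors by the standard inner product; it turns the form
  -- Ω(…, v) into an m-vector.
  let R : (EuclideanSpace ℝ (Fin d) →L[ℝ] ℝ) →ₗ[ℝ] EuclideanSpace ℝ (Fin d) :=
    ∑ k, LinearMap.smulRight
      ((LinearMap.applyₗ (EuclideanSpace.single k (1 : ℝ))).comp (ContinuousLinearMap.coeLM ℝ))
      (EuclideanSpace.single k (1 : ℝ))
  have hR : ∀ k, R (EuclideanSpace.proj k) = EuclideanSpace.single k 1 := by
    intro k
    ext i
    simp [R]
  let X0 : (EuclideanSpace ℝ (Fin d) →L[ℝ] ℝ) [⋀^Fin m]→ₗ[ℝ] ℝ :=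
    (reversedInterior Ω v).compLinearMap R
  let X : Multivector (EuclideanSpace ℝ (Fin d)) m :=
    { toContinuousMultilinearMap := ⟨X0.toMultilinearMap, by
        have hc : Continuous R := R.continuous_of_finiteDimensional
        change Continuous fun α : Fin m → (EuclideanSpace ℝ (Fin d) →L[ℝ] ℝ) =>
          Ω (Fin.snoc (fun j => R (α j.rev)) v)
        refine Ω.cont.comp (Continuous.finSnoc ?_ continuous_const)
        fun_prop⟩
      map_eq_zero_of_eq' := X0.map_eq_zero_of_eq' }
  have hX : ∀ f : Fin m → Fin d, X (fun j => EuclideanSpace.proj (f j)) =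
      reversedInterior Ω v (fun j => EuclideanSpace.single (f j) 1) := by
    intro f
    change reversedInterior Ω v (fun j => R (EuclideanSpace.proj (f j))) = _
    simp only [hR]
  have h := factorial_mul_contraction_apply X Ω v
  rw [hv X, mul_zero] at h
  simp only [hX] at h
  have h0 := (Finset.sum_eq_zero_iff_of_nonneg fun f _ => mul_self_nonneg _).1 h.symm
  have hT : (reversedInterior Ω v) = 0 := by
    refine AlternatingMap.coe_multilinearMap_injective ?_
    refine Module.Basis.ext_multilinear
      (fun _ => (EuclideanSpace.basisFun (Fin d) ℝ).toBasis) fun f => ?_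
    simpa using h0 f (Finset.mem_univ _)
  have h1 : Ω (Fin.snoc w v) = 0 := by
    have := congrArg (fun T => T fun j => w j.rev) hT
    simpa [reversedInterior_apply] using this
  -- `v` is moved from the last slot to the first by a cyclic permutation, which costs only a sign.
  have h2 : (Fin.snoc w v : Fin (m + 1) → EuclideanSpace ℝ (Fin d)) =
      Fin.cons v w ∘ (finRotate (m + 1)) := by
    funext j
    refine Fin.lastCases ?_ (fun j => ?_) j <;> simp
  have h3 := Ω.toAlternatingMap.map_perm (Fin.cons v w) (finRotate (m + 1))
  rw [← h2] at h3
  change Ω _ = _ • Ω _ at h3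
  rw [h1] at h3
  exact (smul_eq_zero_iff_eq _).1 h3.symm

/-- By duality: a functional on covectors that vanishes on the range is evaluation at some vector v.
Every i(X)Ω then kills v, so i(v)Ω = 0 and v = 0. -/
theorem contraction_surjective {Ω : EuclideanSpace ℝ (Fin d) [⋀^Fin (m + 1)]→L[ℝ] ℝ}
    (hΩ : ∀ v, (∀ w, Ω (Fin.cons v w) = 0) → v = 0) :
    Function.Surjective fun X => contraction X Ω := by
  let C : Multivector (EuclideanSpace ℝ (Fin d)) m →ₗ[ℝ] (EuclideanSpace ℝ (Fin d) →L[ℝ] ℝ) :=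
    ⟨⟨fun X => contraction X Ω, fun _ _ => contraction_add_left _ _ _⟩,
      fun _ _ => contraction_smul_left _ _ _⟩
  suffices LinearMap.range C = ⊤ from LinearMap.range_eq_top.1 this
  by_contra hne
  obtain ⟨φ, hφ, hker⟩ := Submodule.exists_le_ker_of_lt_top _ (lt_top_iff_ne_top.2 hne)
  let v : EuclideanSpace ℝ (Fin d) := ∑ i, φ (EuclideanSpace.proj i) • EuclideanSpace.single i 1
  have hφv : ∀ α, φ α = α v := by
    intro α
    have : α = ∑ i, α (EuclideanSpace.single i 1) • (EuclideanSpace.proj i : _ →L[ℝ] ℝ) := by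
      refine ContinuousLinearMap.coe_injective
        ((EuclideanSpace.basisFun (Fin d) ℝ).toBasis.ext fun j => ?_)
      simp
    conv_lhs => rw [this]
    simp [v, mul_comm]
  have hv : v = 0 := hΩ v fun w => eq_zero_of_contraction_apply_eq_zero
    (fun X => by rw [← hφv]; exact hker ⟨X, rfl⟩) w
  exact hφ (LinearMap.ext fun α => by rw [hφv, hv, map_zero]; rfl)

/-- Near a point where a smooth family of linear maps is surjective, the kernels are spanned by
finitely many smooth sections. -/
theorem exists_kernel_frame {V W Z : Type*} [NormedAddCommGroup V] [NormedSpace ℝ V]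
    [NormedAddCommGroup W] [NormedSpace ℝ W] [NormedAddCommGroup Z] [NormedSpace ℝ Z]
    [FiniteDimensional ℝ V] [FiniteDimensional ℝ W] [FiniteDimensional ℝ Z] (b : V → W → Z)
    (h1 : ∀ v v' w, b (v + v') w = b v w + b v' w) (h2 : ∀ (c : ℝ) v w, b (c • v) w = c • b v w)
    (h3 : ∀ v w w', b v (w + w') = b v w + b v w') (h4 : ∀ (c : ℝ) v w, b v (c • w) = c • b v w)
    {v₀ : V} (hs : Function.Surjective (b v₀)) :
    ∃ O : Set V, IsOpen O ∧ v₀ ∈ O ∧ ∃ (r : ℕ) (z : Fin r → V → W) (c : Fin r → W →ₗ[ℝ] ℝ),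
      (∀ i, ContDiffOn ℝ ∞ (z i) O) ∧ (∀ i, ∀ v ∈ O, b v (z i v) = 0) ∧
      ∀ v ∈ O, ∀ w, b v w = 0 → w = ∑ i, c i w • z i v := by
  obtain ⟨B, hB⟩ := exists_clm_of_bilinear b h1 h2 h3 h4
  have hs' : Function.Surjective (B v₀ : W →ₗ[ℝ] Z) := fun y => by
    obtain ⟨w, hw⟩ := hs y
    exact ⟨w, by simpa [hB] using hw⟩
  obtain ⟨R₀, hR₀⟩ := (B v₀ : W →ₗ[ℝ] Z).exists_rightInverse_of_surjective
    (LinearMap.range_eq_top.2 hs')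
  let R : Z →L[ℝ] W := LinearMap.toContinuousLinearMap R₀
  have hR : (B v₀).comp R = 1 := by
    ext y
    exact congrArg (fun f => f y) hR₀
  have hcomplete : CompleteSpace Z := FiniteDimensional.complete ℝ Z
  -- `R` is a right inverse of `B v₀`, so `M` is the identity at `v₀` and stays invertible nearby;
  -- then R M(v)⁻¹ is a right inverse of `B v`.
  let M : V → Z →L[ℝ] Z := fun v => (B v).comp R
  have hM : ContDiff ℝ ∞ M := by
    have : ContDiff ℝ ∞ fun v => B v := B.contDiff
    exact this.clm_comp contDiff_const
  refine ⟨M ⁻¹' {x | IsUnit x}, Units.isOpen.preimage hM.continuous, ?_, ?_⟩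
  · change IsUnit ((B v₀).comp R)
    rw [hR]; exact isUnit_one
  let e := Module.finBasis ℝ W
  -- The sections are the projections of the basis vectors to ker `B v` along the range of `R`; the
  -- coefficients are the fixed coordinates on `W`, because the projection leaves kernel vectors
  -- unchanged.
  refine ⟨Module.finrank ℝ W, fun i v => e i - R (Ring.inverse (M v) (B v (e i))),
    fun i => e.coord i, fun i v hv => ?_, fun i v hv => ?_, fun v hv w hw => ?_⟩
  · obtain ⟨u, hu⟩ := hv
    have hinv : ContDiffAt ℝ ∞ (fun v => Ring.inverse (M v)) v := by
      have := contDiffAt_ringInverse ℝ (n := ∞) u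
      rw [hu] at this
      exact this.comp v hM.contDiffAt
    have hBi : ContDiffAt ℝ ∞ (fun v => B v (e i)) v :=
      (B.contDiff.clm_apply contDiff_const).contDiffAt
    exact (contDiffAt_const.sub
      (R.contDiff.contDiffAt.comp v (hinv.clm_apply hBi))).contDiffWithinAt
  · have hmul : M v * Ring.inverse (M v) = 1 := Ring.mul_inverse_cancel _ hv
    have := congrArg (fun f : Z →L[ℝ] Z => f (B v (e i))) hmul
    have this : B v (R (Ring.inverse (M v) (B v (e i)))) = B v (e i) := this
    rw [← hB, map_sub, this, sub_self]
  · have : w = ∑ i, e.coord i w • e i := (e.sum_repr w).symm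
    have hsum : ∑ i, e.coord i w • R (Ring.inverse (M v) (B v (e i))) = 0 := by
      have h := congrArg (fun x => R (Ring.inverse (M v) (B v x))) this
      simp only [map_sum, map_smul] at h
      rw [← h, hB, hw, map_zero, map_zero]
    simp only [smul_sub, Finset.sum_sub_distrib]
    rw [hsum, sub_zero]
    exact this

theorem exists_contraction_kernel_frame {Ω₀ : EuclideanSpace ℝ (Fin d) [⋀^Fin (m + 1)]→L[ℝ] ℝ}
    (hΩ : ∀ v, (∀ w, Ω₀ (Fin.cons v w) = 0) → v = 0) :
    ∃ O : Set (EuclideanSpace ℝ (Fin d) [⋀^Fin (m + 1)]→L[ℝ] ℝ), IsOpen O ∧ Ω₀ ∈ O ∧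
      ∃ (r : ℕ) (z : Fin r → (EuclideanSpace ℝ (Fin d) [⋀^Fin (m + 1)]→L[ℝ] ℝ) →
          Multivector (EuclideanSpace ℝ (Fin d)) m)
        (c : Fin r → Multivector (EuclideanSpace ℝ (Fin d)) m →ₗ[ℝ] ℝ),
      (∀ i, ContDiffOn ℝ ∞ (z i) O) ∧ (∀ i, ∀ Ω ∈ O, contraction (z i Ω) Ω = 0) ∧
      ∀ Ω ∈ O, ∀ X, contraction X Ω = 0 → X = ∑ i, c i X • z i Ω :=
  exists_kernel_frame (V := EuclideanSpace ℝ (Fin d) [⋀^Fin (m + 1)]→L[ℝ] ℝ)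
    (W := Multivector (EuclideanSpace ℝ (Fin d)) m) (Z := EuclideanSpace ℝ (Fin d) →L[ℝ] ℝ)
    (fun Ω X => contraction X Ω) (fun Ω Ω' X => contraction_add_right X Ω Ω')
    (fun c Ω X => contraction_smul_right c X Ω) (fun Ω X X' => contraction_add_left X X' Ω)
    (fun c Ω X => contraction_smul_left c X Ω) (contraction_surjective hΩ)

end Contraction

/-! ### Smoothness of composition operators on continuous functions -/

section Nemytskii

open Set Topology

universe u v

variable {K : Type v} [TopologicalSpace K] [CompactSpace K]
  {E F : Type u} [NormedAddCommGroup E] [NormedSpace ℝ E] [NormedAddCommGroup F] [NormedSpace ℝ F]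

/-- Pointwise application of a continuous family of operators to a continuous function. -/
def pointwiseApply : C(K, E →L[ℝ] F) →L[ℝ] C(K, E) →L[ℝ] C(K, F) :=
  LinearMap.mkContinuous₂
    (LinearMap.mk₂ ℝ (fun (A : C(K, E →L[ℝ] F)) (h : C(K, E)) =>
      (⟨fun x => A x (h x), by fun_prop⟩ : C(K, F)))
      (fun _ _ _ => rfl) (fun _ _ _ => rfl) (fun _ _ _ => by ext; simp)
      (fun _ _ _ => by ext; simp)) 1 (fun A h => by
        rw [one_mul, ContinuousMap.norm_le _ (by positivity)]
        exact fun x => ((A x).le_opNorm _).trans (mul_le_mul (A.norm_coe_le_norm x)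
          (h.norm_coe_le_norm x) (norm_nonneg _) (by positivity)))

/-- The range of `u` is compact, so f' is uniformly continuous about it; the mean value inequality
then bounds the remainder by ε‖h‖ uniformly in the point of `K`. -/
theorem hasFDerivAt_comp_continuousMap {f : E → F} (hf : Differentiable ℝ f)
    (hf' : Continuous (fderiv ℝ f)) (u : C(K, E)) :
    HasFDerivAt (fun u : C(K, E) => (⟨fun x => f (u x), hf.continuous.comp u.continuous⟩ : C(K, F)))
      (pointwiseApply ⟨fun x => fderiv ℝ f (u x), hf'.comp u.continuous⟩) u := by
  rw [hasFDerivAt_iff_isLittleO_nhds_zero, Asymptotics.isLittleO_iff]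
  intro ε hε
  have hU := (isCompact_range u.continuous).uniformContinuousAt_of_continuousAt (fderiv ℝ f)
    (fun a _ => hf'.continuousAt) (Metric.dist_mem_uniformity hε)
  obtain ⟨δ, hδ, hball⟩ := Metric.mem_uniformity_dist.1 hU
  filter_upwards [Metric.ball_mem_nhds (0 : C(K, E)) hδ] with h hh
  rw [ContinuousMap.norm_le _ (by positivity)]
  intro x
  have hhx : ‖h x‖ < δ := (h.norm_coe_le_norm x).trans_lt (by simpa using hh)
  have key := (convex_ball (u x) δ).norm_image_sub_le_of_norm_fderiv_le' (f := f) (𝕜 := ℝ)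
    (φ := fderiv ℝ f (u x)) (C := ε) (x := u x) (y := u x + h x)
    (fun y _ => hf y) (fun y hy => ?_) (Metric.mem_ball_self hδ) (by simpa using hhx)
  · rw [add_sub_cancel_left] at key
    exact key.trans (mul_le_mul_of_nonneg_left (h.norm_coe_le_norm x) hε.le)
  · rw [← dist_eq_norm, dist_comm]
    exact (hball (a := u x) (b := y) (by rwa [dist_comm]) (mem_range_self x)).le

/-- The derivative is pointwise application of the composition operator of f', so each order follows
from the previous one for f'. The induction must let `F` vary, since f' takes values in `E →L[ℝ] F`;
the common universe of `E` and `F` makes this possible. -/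
theorem contDiff_nat_comp_continuousMap (n : ℕ) : ∀ {F : Type u} [NormedAddCommGroup F]
    [NormedSpace ℝ F] {f : E → F} (hf : ContDiff ℝ ∞ f),
    ContDiff ℝ n (fun u : C(K, E) =>
      (⟨fun x => f (u x), hf.continuous.comp u.continuous⟩ : C(K, F))) := by
  induction n with
  | zero =>
    intro F _ _ f hf
    have h := contDiff_infty_iff_fderiv.1 hf
    refine contDiff_zero.2 (continuous_iff_continuousAt.2 fun u => ?_)
    exact (hasFDerivAt_comp_continuousMap h.1 h.2.continuous u).continuousAt
  | succ n ih =>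
    intro F _ _ f hf
    have h := contDiff_infty_iff_fderiv.1 hf
    push_cast
    rw [contDiff_succ_iff_hasFDerivAt]
    refine ⟨_, ?_, fun u => hasFDerivAt_comp_continuousMap h.1 h.2.continuous u⟩
    exact pointwiseApply.contDiff.comp (ih h.2)

/-- The composition operator `u ↦ f ∘ u` of a smooth function is smooth. -/
theorem contDiff_comp_continuousMap {f : E → F} (hf : ContDiff ℝ ∞ f) :
    ContDiff ℝ ∞ (fun u : C(K, E) =>
      (⟨fun x => f (u x), hf.continuous.comp u.continuous⟩ : C(K, F))) :=
  contDiff_infty.2 fun n => contDiff_nat_comp_continuousMap n hf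

end Nemytskii

/-! ### An implicit function that is smooth on a whole neighbourhood -/

section ImplicitFunction

open Set Topology

variable {X Y Z : Type*} [NormedAddCommGroup X] [NormedSpace ℝ X] [CompleteSpace X]
  [NormedAddCommGroup Y] [NormedSpace ℝ Y] [CompleteSpace Y]
  [NormedAddCommGroup Z] [NormedSpace ℝ Z] [CompleteSpace Z]

/-- A form of the implicit function theorem with a smooth implicit function on an open set. -/
theorem exists_contDiffOn_implicitFunction {f : X × Y → Z} (hf : ContDiff ℝ ∞ f) {p : X × Y}
    (hp : (fderiv ℝ f p ∘L .inr ℝ X Y).IsInvertible) :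
    ∃ (O : Set X) (ψ : X → Y), IsOpen O ∧ p.1 ∈ O ∧ ContDiffOn ℝ ∞ ψ O ∧ ψ p.1 = p.2 ∧
      ∀ x ∈ O, f (x, ψ x) = f p := by
  have h0 : (∞ : WithTop ℕ∞) ≠ 0 := by simp
  set ψ := hf.contDiffAt.implicitFunction h0 hp with hψ
  have hψp : ψ p.1 = p.2 := hf.contDiffAt.implicitFunction_apply_self h0 hp
  have hψc : ContDiffAt ℝ ∞ ψ p.1 := hf.contDiffAt.contDiffAt_implicitFunction h0 hp
  -- `C^∞` at one point gives a neighbourhood for each finite order only. Invertibility persists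
  -- nearby, so the implicit function theorem can be applied afresh at each nearby point; local
  -- uniqueness identifies the function found there with `ψ`.
  have hinv : ∀ᶠ x in 𝓝 p.1, (fderiv ℝ f (x, ψ x) ∘L .inr ℝ X Y).IsInvertible := by
    have hc : ContinuousAt (fun x => fderiv ℝ f (x, ψ x) ∘L .inr ℝ X Y) p.1 := by
      have h1 : ContinuousAt (fun x => fderiv ℝ f (x, ψ x)) p.1 :=
        (hf.continuous_fderiv (by simp)).continuousAt.comp
          (continuousAt_id.prodMk hψc.continuousAt)
      exact h1.clm_comp continuousAt_const
    have hopen : IsOpen {A : Y →L[ℝ] Z | A.IsInvertible} := ContinuousLinearEquiv.isOpen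
    refine hc.eventually_mem (hopen.mem_nhds ?_)
    simpa [hψp] using hp
  have hcont : ∀ᶠ x in 𝓝 p.1, ContinuousAt ψ x := by
    have := (hψc.of_le (m := 1) (by simp)).eventually (by simp)
    exact this.mono fun x hx => hx.continuousAt
  have heq := hf.contDiffAt.eventually_apply_implicitFunction h0 hp
  have hall := ((hinv.and hcont).and heq).eventually_nhds
  obtain ⟨O, hO, hOo, hpO⟩ := eventually_nhds_iff.1 hall
  refine ⟨O, ψ, hOo, hpO, fun x hx => ?_, hψp, fun x hx => (hO x hx).self_of_nhds.2⟩
  have hx1 := (hO x hx).self_of_nhds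
  have hψ' := hf.contDiffAt.contDiffAt_implicitFunction (u := (x, ψ x)) h0 hx1.1.1
  refine (hψ'.congr_of_eventuallyEq ?_).contDiffWithinAt
  have h1 := hf.contDiffAt.eventually_apply_eq_iff_implicitFunction (u := (x, ψ x)) h0 hx1.1.1
  have hct : ContinuousAt (fun x' => (x', ψ x')) x := continuousAt_id.prodMk hx1.1.2
  filter_upwards [hct.eventually h1, hO x hx] with x' h2 h3
  exact (h2.1 (h3.2.trans hx1.2.symm)).symm

end ImplicitFunction

/-! ### Smooth local flows on a Banach space -/

section Flow

open Set Topology MeasureTheory intervalIntegral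

variable {E : Type*} [NormedAddCommGroup E]

/-- The constant extension to the real line of a continuous function on `[-1, 1]`. -/
def extendIcc (w : C(Icc (-1 : ℝ) 1, E)) : ℝ → E :=
  IccExtend (by norm_num : (-1 : ℝ) ≤ 1) w

theorem continuous_extendIcc (w : C(Icc (-1 : ℝ) 1, E)) : Continuous (extendIcc w) :=
  w.continuous.Icc_extend'

theorem extendIcc_of_mem (w : C(Icc (-1 : ℝ) 1, E)) {t : ℝ} (ht : t ∈ Icc (-1 : ℝ) 1) :
    extendIcc w t = w ⟨t, ht⟩ := IccExtend_of_mem _ _ ht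

variable [NormedSpace ℝ E]

theorem hasDerivAt_integral_extendIcc [CompleteSpace E] (w : C(Icc (-1 : ℝ) 1, E)) (t : ℝ) :
    HasDerivAt (fun τ => ∫ s in (0 : ℝ)..τ, extendIcc w s) (extendIcc w t) t :=
  integral_hasDerivAt_right ((continuous_extendIcc w).intervalIntegrable _ _)
    (continuous_extendIcc w).stronglyMeasurable.stronglyMeasurableAtFilter
    (continuous_extendIcc w).continuousAt

/-- The inverse of the time `t` map of a flow is the time `-t` map. -/
theorem flow_neg_flow {V : E → E} {K : NNReal} (hK : LipschitzWith K V) {T : ℝ} {B : Set E}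
    {Φ : ℝ → E → E} (h0 : ∀ y ∈ B, Φ 0 y = y)
    (hd : ∀ y ∈ B, ∀ t ∈ Ioo (-T) T, HasDerivAt (fun s => Φ s y) (V (Φ t y)) t)
    {y : E} {t : ℝ} (hy : y ∈ B) (ht : t ∈ Ioo (-T) T) (hty : Φ t y ∈ B) :
    Φ (-t) (Φ t y) = y := by
  have hT : 0 < T := by linarith [ht.1, ht.2]
  -- The interval consists of the s for which both s and t + s lie in (-T, T); there the two curves
  -- solve the same equation and agree at s = 0. It contains -t.
  have h := ODE_solution_unique_of_mem_Ioo (v := fun _ => V) (s := fun _ => univ) (K := K)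
    (f := fun s => Φ s (Φ t y)) (g := fun s => Φ (t + s) y) (a := max (-T) (-T - t))
    (b := min T (T - t)) (t₀ := 0) (fun _ _ => hK.lipschitzOnWith)
    ⟨max_lt (by linarith) (by linarith [ht.1]), lt_min hT (by linarith [ht.2])⟩
    (fun s hs => ⟨hd _ hty s ⟨(le_max_left _ _).trans_lt hs.1, hs.2.trans_le (min_le_left _ _)⟩,
      mem_univ _⟩)
    (fun s hs => ⟨?_, mem_univ _⟩) (by simp only [add_zero]; exact h0 _ hty)
  · have := h (x := -t) ⟨max_lt (by linarith [ht.2]) (by linarith), lt_min (by linarith [ht.1])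
      (by linarith)⟩
    simp only [add_neg_cancel] at this
    rw [this, h0 y hy]
  · have h1 := (le_max_right (-T) (-T - t)).trans_lt hs.1
    have h2 := hs.2.trans_le (min_le_right T (T - t))
    exact (hd y hy (t + s) ⟨by linarith, by linarith⟩).comp_const_add t s

variable [CompleteSpace E]

/-- Integration from `0` as an operator on continuous functions on `[-1, 1]`. -/
def integralOperator : C(Icc (-1 : ℝ) 1, E) →L[ℝ] C(Icc (-1 : ℝ) 1, E) :=
  LinearMap.mkContinuous
    { toFun := fun w => ⟨fun τ => ∫ s in (0 : ℝ)..τ, extendIcc w s,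
        (continuous_iff_continuousAt.2 fun t =>
          (hasDerivAt_integral_extendIcc w t).continuousAt).comp continuous_subtype_val⟩
      map_add' := fun v w => by
        ext τ
        exact integral_add ((continuous_extendIcc v).intervalIntegrable _ _)
          ((continuous_extendIcc w).intervalIntegrable _ _)
      map_smul' := fun c w => by
        ext τ
        exact integral_smul c _ } 1 fun w => by
    rw [one_mul, ContinuousMap.norm_le _ (norm_nonneg _)]
    intro τ
    have h := norm_integral_le_of_norm_le_const (a := 0) (b := (τ : ℝ)) (f := extendIcc w)
      (C := ‖w‖) fun x _ => w.norm_coe_le_norm _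
    refine h.trans (mul_le_of_le_one_right (norm_nonneg _) ?_)
    rw [sub_zero, abs_le]
    exact τ.2

theorem integralOperator_apply (w : C(Icc (-1 : ℝ) 1, E)) (τ : Icc (-1 : ℝ) 1) :
    integralOperator w τ = ∫ s in (0 : ℝ)..τ, extendIcc w s := rfl

/-- Solutions of `x' = t V(x)`, `x(0) = y` on `[-1, 1]`, depending smoothly on `(t, y)`. -/
theorem exists_smooth_rescaled_solutions {V : E → E} (hV : ContDiff ℝ ∞ V) (y₀ : E) :
    ∃ (O : Set (ℝ × E)) (ψ : ℝ × E → C(Icc (-1 : ℝ) 1, E)) (γ : ℝ × E → ℝ → E),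
      IsOpen O ∧ (0, y₀) ∈ O ∧ ContDiffOn ℝ ∞ ψ O ∧
      ∀ p ∈ O, (∀ τ (hτ : τ ∈ Icc (-1 : ℝ) 1), γ p τ = ψ p ⟨τ, hτ⟩) ∧ γ p 0 = p.2 ∧
        ∀ τ ∈ Icc (-1 : ℝ) 1, HasDerivAt (γ p) (p.1 • V (γ p τ)) τ := by
  let N : C(Icc (-1 : ℝ) 1, E) → C(Icc (-1 : ℝ) 1, E) :=
    fun u => ⟨fun x => V (u x), hV.continuous.comp u.continuous⟩
  have hN : ContDiff ℝ ∞ N := contDiff_comp_continuousMap hV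
  let κ : E →L[ℝ] C(Icc (-1 : ℝ) 1, E) := LinearMap.mkContinuous
    { toFun := fun y => ContinuousMap.const _ y
      map_add' := fun _ _ => rfl
      map_smul' := fun _ _ => rfl } 1 fun y => by
    rw [one_mul, ContinuousMap.norm_le _ (norm_nonneg _)]
    exact fun _ => le_rfl
  -- Zeros of `f` are the solutions of u(τ) = y + t ∫₀^τ V(u). At t = 0 the integral drops out and
  -- the derivative in u is the identity. Putting time into the parameter fixes the interval [-1,
  -- 1], and so the space of curves.
  let f : (ℝ × E) × C(Icc (-1 : ℝ) 1, E) → C(Icc (-1 : ℝ) 1, E) :=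
    fun z => z.2 - κ z.1.2 - z.1.1 • integralOperator (N z.2)
  have hf : ContDiff ℝ ∞ f := by
    have h1 : ContDiff ℝ ∞ fun z : (ℝ × E) × C(Icc (-1 : ℝ) 1, E) => integralOperator (N z.2) :=
      integralOperator.contDiff.comp (hN.comp contDiff_snd)
    exact (contDiff_snd.sub (κ.contDiff.comp (contDiff_snd.comp contDiff_fst))).sub
      ((contDiff_fst.comp contDiff_fst).smul h1)
  let p : (ℝ × E) × C(Icc (-1 : ℝ) 1, E) := ((0, y₀), κ y₀)
  have hfp : f p = 0 := by simp [f, p]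
  have hp : (fderiv ℝ f p ∘L .inr ℝ (ℝ × E) C(Icc (-1 : ℝ) 1, E)).IsInvertible := by
    have h1 : HasFDerivAt (fun u => f ((0, y₀), u))
        (fderiv ℝ f p ∘L .inr ℝ (ℝ × E) C(Icc (-1 : ℝ) 1, E)) (κ y₀) :=
      ((hf.differentiable (by simp)) p).hasFDerivAt.comp (κ y₀)
        (hasFDerivAt_prodMk_right (0, y₀) (κ y₀))
    have h2 : HasFDerivAt (fun u => f ((0, y₀), u))
        (ContinuousLinearMap.id ℝ C(Icc (-1 : ℝ) 1, E)) (κ y₀) := by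
      have : (fun u => f ((0, y₀), u)) = fun u => u - κ y₀ := by
        funext u; simp [f]
      rw [this]
      exact (hasFDerivAt_id _).sub_const _
    rw [h1.unique h2]
    exact ⟨ContinuousLinearEquiv.refl ℝ _, rfl⟩
  obtain ⟨O, ψ, hO, hpO, hψ, -, hsol⟩ := exists_contDiffOn_implicitFunction hf hp
  -- The right side of the integral equation makes sense for every real τ, so `γ` has two-sided
  -- derivatives even at ±1.
  refine ⟨O, ψ, fun q τ => q.2 + q.1 • ∫ s in (0 : ℝ)..τ, extendIcc (N (ψ q)) s,
    hO, hpO, hψ, fun q hq => ?_⟩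
  have h1 : ∀ τ : Icc (-1 : ℝ) 1,
      q.2 + q.1 • ∫ s in (0 : ℝ)..τ, extendIcc (N (ψ q)) s = ψ q τ := by
    intro τ
    have h := congrArg (fun w : C(Icc (-1 : ℝ) 1, E) => w τ) ((hsol q hq).trans hfp)
    have h : ψ q τ - q.2 - q.1 • integralOperator (N (ψ q)) τ = 0 := h
    rw [sub_sub, sub_eq_zero, integralOperator_apply] at h
    exact h.symm
  refine ⟨fun τ hτ => h1 ⟨τ, hτ⟩, by simp, fun τ hτ => ?_⟩
  have h2 := ((hasDerivAt_integral_extendIcc (N (ψ q)) τ).const_smul q.1).const_add q.2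
  rw [extendIcc_of_mem _ hτ] at h2
  have h3 : N (ψ q) ⟨τ, hτ⟩ = V (q.2 + q.1 • ∫ s in (0 : ℝ)..τ, extendIcc (N (ψ q)) s) := by
    rw [h1 ⟨τ, hτ⟩]; rfl
  rw [h3] at h2
  exact h2

/-- A smooth, globally Lipschitz vector field has a smooth local flow near every point. -/
theorem exists_smooth_flow {V : E → E} (hV : ContDiff ℝ ∞ V) {K : NNReal} (hK : LipschitzWith K V)
    (y₀ : E) : ∃ T > 0, ∃ r > 0, ∃ Φ : ℝ → E → E,
      ContDiffOn ℝ ∞ (fun z : ℝ × E => Φ z.1 z.2) (Ioo (-T) T ×ˢ Metric.ball y₀ r) ∧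
      (∀ y ∈ Metric.ball y₀ r, Φ 0 y = y) ∧
      ∀ y ∈ Metric.ball y₀ r, ∀ t ∈ Ioo (-T) T, HasDerivAt (fun s => Φ s y) (V (Φ t y)) t := by
  obtain ⟨O, ψ, γ, hO, h0O, hψ, hγ⟩ := exists_smooth_rescaled_solutions hV y₀
  obtain ⟨ε, hε, hball⟩ := Metric.isOpen_iff.1 hO _ h0O
  have hmem : ∀ t y, |t| < ε → y ∈ Metric.ball y₀ ε → (t, y) ∈ O := fun t y ht hy =>
    hball (by rw [← ball_prod_same]; exact ⟨by simpa using ht, hy⟩)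
  have one_mem : (1 : ℝ) ∈ Icc (-1 : ℝ) 1 := by norm_num
  let T := ε / 2
  have hT : 0 < T := half_pos hε
  have hTε : T < ε := half_lt_self hε
  have hsub : ∀ t y, t ∈ Ioo (-T) T → y ∈ Metric.ball y₀ ε → (t, y) ∈ O := fun t y ht hy =>
    hmem t y ((abs_lt.2 ht).trans hTε) hy
  -- Both τ ↦ γ(t, y)(τ) and τ ↦ γ(T, y)(tτ/T) solve x' = t V(x) from y. The left side of the
  -- equality is smooth in (t, y) jointly; the right side visibly satisfies the differential
  -- equation in t.
  have hscale : ∀ t ∈ Ioo (-T) T, ∀ y ∈ Metric.ball y₀ ε, ψ (t, y) ⟨1, one_mem⟩ =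
      γ (T, y) (t / T) := by
    intro t ht y hy
    have h1 := hγ _ (hsub t y ht hy)
    have h2 := hγ _ (hmem T y (by rwa [abs_of_pos hT]) hy)
    have hle : |t / T| ≤ 1 := by
      rw [abs_div, abs_of_pos hT, div_le_one hT]; exact (abs_lt.2 ht).le
    have hmaps : ∀ τ ∈ Icc (0 : ℝ) 1, t / T * τ ∈ Icc (-1 : ℝ) 1 := fun τ hτ => by
      rw [mem_Icc, ← abs_le, abs_mul, abs_of_nonneg hτ.1]
      exact mul_le_one₀ hle hτ.1 hτ.2
    have hsubI : ∀ τ ∈ Icc (0 : ℝ) 1, τ ∈ Icc (-1 : ℝ) 1 := fun τ hτ =>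
      ⟨by linarith [hτ.1], hτ.2⟩
    have hd1 : ∀ τ ∈ Icc (0 : ℝ) 1, HasDerivAt (γ (t, y)) (t • V (γ (t, y) τ)) τ :=
      fun τ hτ => h1.2.2 τ (hsubI τ hτ)
    have hd2 : ∀ τ ∈ Icc (0 : ℝ) 1,
        HasDerivAt (fun τ => γ (T, y) (t / T * τ)) (t • V (γ (T, y) (t / T * τ))) τ := by
      intro τ hτ
      have h3 := h2.2.2 _ (hmaps τ hτ)
      have h4 := h3.scomp τ ((hasDerivAt_id τ).const_mul (t / T))
      refine h4.congr_deriv ?_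
      simp only [mul_one, smul_smul]
      rw [div_mul_cancel₀ _ hT.ne']
    have hu := ODE_solution_unique (v := fun _ x => t • V x) (a := 0) (b := 1)
      (K := ‖t‖₊ * K) (fun _ => (lipschitzWith_smul t).comp hK)
      (fun τ hτ => (hd1 τ hτ).continuousAt.continuousWithinAt)
      (fun τ hτ => (hd1 τ (Ico_subset_Icc_self hτ)).hasDerivWithinAt)
      (fun τ hτ => (hd2 τ hτ).continuousAt.continuousWithinAt)
      (fun τ hτ => (hd2 τ (Ico_subset_Icc_self hτ)).hasDerivWithinAt)
      (by simp only [mul_zero]; rw [h1.2.1, h2.2.1])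
    have := hu (right_mem_Icc.2 zero_le_one)
    simp only [mul_one] at this
    rw [← this, h1.1 1 one_mem]
  refine ⟨T, hT, ε, hε, fun t y => ψ (t, y) ⟨1, one_mem⟩, ?_, ?_, ?_⟩
  · have h1 : ContDiffOn ℝ ∞ ψ (Ioo (-T) T ×ˢ Metric.ball y₀ ε) :=
      hψ.mono fun z hz => hsub z.1 z.2 hz.1 hz.2
    exact (ContinuousMap.evalCLM ℝ (⟨1, one_mem⟩ : Icc (-1 : ℝ) 1)).contDiff.comp_contDiffOn h1
  · intro y hy
    change ψ (0, y) ⟨1, one_mem⟩ = y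
    rw [hscale 0 (by simp [hT]) y hy, zero_div]
    exact (hγ _ (hmem T y (by rwa [abs_of_pos hT]) hy)).2.1
  · intro y hy t ht
    have h2 := (hγ _ (hmem T y (by rwa [abs_of_pos hT]) hy)).2.2 (t / T) (by
      rw [mem_Icc, ← abs_le, abs_div, abs_of_pos hT, div_le_one hT]; exact (abs_lt.2 ht).le)
    have h3 : HasDerivAt (fun s => γ (T, y) (s / T)) (V (γ (T, y) (t / T))) t := by
      have h4 := h2.scomp t ((hasDerivAt_id t).div_const T)
      refine h4.congr_deriv ?_
      simp only [smul_smul]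
      rw [one_div_mul_cancel hT.ne', one_smul]
    change HasDerivAt (fun s => ψ (s, y) ⟨1, one_mem⟩) (V (ψ (t, y) ⟨1, one_mem⟩)) t
    rw [hscale t ht y hy]
    refine h3.congr_of_eventuallyEq ?_
    filter_upwards [isOpen_Ioo.mem_nhds ht] with s hs using hscale s hs y hy

end Flow

/-! ### Naturality of the bracket under coordinate changes -/

section BracketChart

open Set Topology

variable {E F : Type*} [NormedAddCommGroup E] [NormedSpace ℝ E] [NormedAddCommGroup F]
  [NormedSpace ℝ F] {m : ℕ}

theorem fderiv_comp_hasDerivAt {f : E → F} {c : ℝ → E} {c' : E} {t : ℝ}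
    (hf : DifferentiableAt ℝ f (c t)) (hc : HasDerivAt c c' t) :
    HasDerivAt (fun s => f (c s)) (fderiv ℝ f (c t) c') t :=
  hf.hasFDerivAt.comp_hasDerivAt t hc

/-- D A - A D' is the rate of change of A = Dφ along a vector field, when D and D' are the
derivatives of two fields related by φ. -/
theorem _root_.HasDerivAt.multivectorMap_comp_sub {A : ℝ → E →L[ℝ] F} {D : F →L[ℝ] F}
    {D' : E →L[ℝ] E} {X : ℝ → Multivector E m} {X' : Multivector E m} {t : ℝ}
    (hA : HasDerivAt A (D.comp (A t) - (A t).comp D') t) (hX : HasDerivAt X X' t) :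
    HasDerivAt (fun s => Multivector.map (A s) (X s))
      (Multivector.map (A t) X' + (Multivector.derivation D (Multivector.map (A t) (X t)) -
        Multivector.map (A t) (Multivector.derivation D' (X t)))) t := by
  refine hA.multivectorMap hX fun α => ?_
  rw [ContinuousAlternatingMap.sub_apply, Multivector.map_apply, Multivector.derivation_apply,
    Multivector.derivation_apply, ← Finset.sum_sub_distrib]
  refine Finset.sum_congr rfl fun r _ => ?_
  rw [ContinuousLinearMap.comp_sub]
  refine Eq.trans ?_ ((X t).toAlternatingMap.map_update_sub _ r _ _).symm
  change X t _ - X t _ = X t _ - X t _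
  congr 2
  · funext i
    rcases eq_or_ne i r with rfl | h
    · simp [ContinuousLinearMap.comp_assoc]
    · simp [h]

/-- Naturality of the Schouten-Nijenhuis bracket under coordinate changes. -/
theorem schoutenBracketChart_map {φ : E → F} {z : E} (hφ : ContDiffAt ℝ 2 φ z)
    {Y₁ : E → E} {Y₂ : F → F} {X₁ : E → Multivector E m} {X₂ : F → Multivector F m}
    (hY₁ : DifferentiableAt ℝ Y₁ z) (hY₂ : DifferentiableAt ℝ Y₂ (φ z))
    (hX₁ : DifferentiableAt ℝ X₁ z) (hX₂ : DifferentiableAt ℝ X₂ (φ z))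
    (hY : ∀ᶠ y in 𝓝 z, Y₂ (φ y) = fderiv ℝ φ y (Y₁ y))
    (hX : ∀ᶠ y in 𝓝 z, X₂ (φ y) = Multivector.map (fderiv ℝ φ y) (X₁ y)) :
    schoutenBracketChart Y₂ X₂ (φ z) =
      Multivector.map (fderiv ℝ φ z) (schoutenBracketChart Y₁ X₁ z) := by
  have hφ1 : DifferentiableAt ℝ φ z := hφ.differentiableAt (by simp)
  have hφ2 : DifferentiableAt ℝ (fderiv ℝ φ) z :=
    (hφ.fderiv_right (m := 1) (by norm_num)).differentiableAt (by simp)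
  -- Only the derivative in the direction `Y₁ z` is needed, so the relation between `X₁` and `X₂` is
  -- differentiated along a straight line instead of an integral curve.
  let c : ℝ → E := fun s => z + s • Y₁ z
  have hc0 : c 0 = z := by simp [c]
  have hc : HasDerivAt c (Y₁ z) 0 := by
    simpa [c] using ((hasDerivAt_id (0 : ℝ)).smul_const (Y₁ z)).const_add z
  have hct : Filter.Tendsto c (𝓝 0) (𝓝 z) := by
    have := hc.continuousAt.tendsto
    rwa [hc0] at this
  -- Differentiating Y₂ ∘ φ = Dφ·Y₁ yields D²φ(v, Y₁); symmetry of the second derivative turns it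
  -- into the derivative of Dφ along Y₁.
  have hA' : fderiv ℝ (fderiv ℝ φ) z (Y₁ z) =
      (fderiv ℝ Y₂ (φ z)).comp (fderiv ℝ φ z) - (fderiv ℝ φ z).comp (fderiv ℝ Y₁ z) := by
    have h1 : HasFDerivAt (fun y => Y₂ (φ y)) ((fderiv ℝ Y₂ (φ z)).comp (fderiv ℝ φ z)) z :=
      hY₂.hasFDerivAt.comp z hφ1.hasFDerivAt
    have h2 : HasFDerivAt (fun y => fderiv ℝ φ y (Y₁ y)) _ z :=
      hφ2.hasFDerivAt.clm_apply hY₁.hasFDerivAt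
    have h3 := h1.unique (h2.congr_of_eventuallyEq hY)
    rw [h3]
    ext v
    have hs : fderiv ℝ (fderiv ℝ φ) z (Y₁ z) v = fderiv ℝ (fderiv ℝ φ) z v (Y₁ z) :=
      (hφ.isSymmSndFDerivAt (by simp)).eq _ _
    simp [hs]
  have hA : HasDerivAt (fun s => fderiv ℝ φ (c s))
      ((fderiv ℝ Y₂ (φ z)).comp (fderiv ℝ φ (c 0)) -
        (fderiv ℝ φ (c 0)).comp (fderiv ℝ Y₁ z)) 0 := by
    have := fderiv_comp_hasDerivAt (c := c) (t := 0) (by rwa [hc0]) hc (f := fderiv ℝ φ)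
    rw [hc0] at this ⊢
    rwa [hA'] at this
  have hX1 : HasDerivAt (fun s => X₁ (c s)) (fderiv ℝ X₁ (c 0) (Y₁ z)) 0 :=
    fderiv_comp_hasDerivAt (F := Multivector E m) (c := c) (t := 0) (by rwa [hc0]) hc (f := X₁)
  have h4 := hA.multivectorMap_comp_sub hX1
  have hφc : HasDerivAt (fun s => φ (c s)) (fderiv ℝ φ (c 0) (Y₁ z)) 0 :=
    fderiv_comp_hasDerivAt (c := c) (t := 0) (by rwa [hc0]) hc
  have h5 : HasDerivAt (fun s => X₂ (φ (c s)))
      (fderiv ℝ X₂ (φ (c 0)) (fderiv ℝ φ (c 0) (Y₁ z))) 0 :=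
    fderiv_comp_hasDerivAt (F := Multivector F m) (c := fun s => φ (c s)) (t := 0)
      (by rwa [hc0]) hφc (f := X₂)
  have h7 : (fun s => X₂ (φ (c s))) =ᶠ[𝓝 0]
      fun s => Multivector.map (fderiv ℝ φ (c s)) (X₁ (c s)) := hct.eventually hX
  have h6 := h5.unique (h4.congr_of_eventuallyEq h7)
  rw [hc0] at h6
  unfold schoutenBracketChart
  rw [hY.self_of_nhds, hX.self_of_nhds, h6, Multivector.map_sub]
  abel

end BracketChart

/-! ### Fields, forms and maps in charts -/

section Charts

open Set Topology

variable {d : ℕ} {N : Type*} [TopologicalSpace N] [ChartedSpace (EuclideanSpace ℝ (Fin d)) N]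

variable (d) in
/-- The derivative of the chart at `x₀`, as an endomorphism of the model space. -/
def chartD (x₀ p : N) : EuclideanSpace ℝ (Fin d) →L[ℝ] EuclideanSpace ℝ (Fin d) :=
  mfderiv (𝓡 d) 𝓘(ℝ, EuclideanSpace ℝ (Fin d)) (extChartAt (𝓡 d) x₀) p

/-- The derivative of the inverse of the chart at `x₀`, as an endomorphism of the model space. -/
def chartDSymm (x₀ : N) (y : EuclideanSpace ℝ (Fin d)) :
    EuclideanSpace ℝ (Fin d) →L[ℝ] EuclideanSpace ℝ (Fin d) :=
  mfderiv 𝓘(ℝ, EuclideanSpace ℝ (Fin d)) (𝓡 d) (extChartAt (𝓡 d) x₀).symm y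

variable (d) in
/-- The derivative of a self-map of a manifold, as an endomorphism of the model space. -/
def mapD (Φ : N → N) (p : N) : EuclideanSpace ℝ (Fin d) →L[ℝ] EuclideanSpace ℝ (Fin d) :=
  mfderiv (𝓡 d) (𝓡 d) Φ p

variable (d) in
/-- The expression of a self-map in the charts at `x₁` and `x₀`. -/
def mapInChart (x₀ x₁ : N) (Φ : N → N) (y : EuclideanSpace ℝ (Fin d)) :
    EuclideanSpace ℝ (Fin d) :=
  extChartAt (𝓡 d) x₀ (Φ ((extChartAt (𝓡 d) x₁).symm y))

theorem mapD_id (p : N) : mapD d id p = ContinuousLinearMap.id ℝ _ := mfderiv_id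

variable [IsManifold (𝓡 d) ∞ N]

theorem isManifold_one : IsManifold (𝓡 d) 1 N := IsManifold.of_le (n := ∞) (by simp)

theorem hasMFDerivAt_chart {x₀ p : N} (hp : p ∈ (extChartAt (𝓡 d) x₀).source) :
    HasMFDerivAt (𝓡 d) 𝓘(ℝ, EuclideanSpace ℝ (Fin d)) (extChartAt (𝓡 d) x₀) p (chartD d x₀ p) := by
  have := isManifold_one (d := d) (N := N)
  exact (mdifferentiableAt_extChartAt (by rwa [← extChartAt_source (𝓡 d)])).hasMFDerivAt

theorem hasMFDerivAt_chart_symm {x₀ : N} {y : EuclideanSpace ℝ (Fin d)}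
    (hy : y ∈ (extChartAt (𝓡 d) x₀).target) :
    HasMFDerivAt 𝓘(ℝ, EuclideanSpace ℝ (Fin d)) (𝓡 d) (extChartAt (𝓡 d) x₀).symm y
      (chartDSymm x₀ y) := by
  have := isManifold_one (d := d) (N := N)
  have h := mdifferentiableWithinAt_extChartAt_symm hy
  rw [ModelWithCorners.Boundaryless.range_eq_univ, mdifferentiableWithinAt_univ] at h
  exact h.hasMFDerivAt

theorem chartD_comp_chartDSymm {x₀ : N} {y : EuclideanSpace ℝ (Fin d)}
    (hy : y ∈ (extChartAt (𝓡 d) x₀).target) :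
    (chartD d x₀ ((extChartAt (𝓡 d) x₀).symm y)).comp (chartDSymm x₀ y) =
      ContinuousLinearMap.id ℝ _ := by
  have := isManifold_one (d := d) (N := N)
  have h := mfderiv_extChartAt_comp_mfderivWithin_extChartAt_symm hy
  rwa [ModelWithCorners.Boundaryless.range_eq_univ, mfderivWithin_univ] at h

theorem chartDSymm_comp_chartD {x₀ : N} {y : EuclideanSpace ℝ (Fin d)}
    (hy : y ∈ (extChartAt (𝓡 d) x₀).target) :
    (chartDSymm x₀ y).comp (chartD d x₀ ((extChartAt (𝓡 d) x₀).symm y)) =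
      ContinuousLinearMap.id ℝ _ := by
  have := isManifold_one (d := d) (N := N)
  have h := mfderivWithin_extChartAt_symm_comp_mfderiv_extChartAt hy
  rwa [ModelWithCorners.Boundaryless.range_eq_univ, mfderivWithin_univ] at h

theorem chartD_comp_chartDSymm' {x₀ p : N} (hp : p ∈ (extChartAt (𝓡 d) x₀).source) :
    (chartD d x₀ p).comp (chartDSymm x₀ (extChartAt (𝓡 d) x₀ p)) =
      ContinuousLinearMap.id ℝ _ := by
  have := chartD_comp_chartDSymm ((extChartAt (𝓡 d) x₀).map_source hp)
  rwa [(extChartAt (𝓡 d) x₀).left_inv hp] at this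

theorem chartDSymm_comp_chartD' {x₀ p : N} (hp : p ∈ (extChartAt (𝓡 d) x₀).source) :
    (chartDSymm x₀ (extChartAt (𝓡 d) x₀ p)).comp (chartD d x₀ p) =
      ContinuousLinearMap.id ℝ _ := by
  have := chartDSymm_comp_chartD ((extChartAt (𝓡 d) x₀).map_source hp)
  rwa [(extChartAt (𝓡 d) x₀).left_inv hp] at this

theorem hasFDerivAt_mapInChart {x₀ x₁ p : N} {Φ : N → N}
    (hp : p ∈ (extChartAt (𝓡 d) x₁).source) (hΦp : Φ p ∈ (extChartAt (𝓡 d) x₀).source)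
    (hΦ : MDifferentiableAt (𝓡 d) (𝓡 d) Φ p) :
    HasFDerivAt (mapInChart d x₀ x₁ Φ)
      ((chartD d x₀ (Φ p)).comp ((mapD d Φ p).comp (chartDSymm x₁ (extChartAt (𝓡 d) x₁ p))))
      (extChartAt (𝓡 d) x₁ p) := by
  have h1 := hasMFDerivAt_chart_symm ((extChartAt (𝓡 d) x₁).map_source hp)
  have hl := (extChartAt (𝓡 d) x₁).left_inv hp
  have h2 : HasMFDerivAt (𝓡 d) (𝓡 d) Φ
      ((extChartAt (𝓡 d) x₁).symm (extChartAt (𝓡 d) x₁ p)) (mapD d Φ p) := by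
    rw [hl]; exact hΦ.hasMFDerivAt
  have h3 : HasMFDerivAt (𝓡 d) 𝓘(ℝ, EuclideanSpace ℝ (Fin d)) (extChartAt (𝓡 d) x₀)
      (Φ ((extChartAt (𝓡 d) x₁).symm (extChartAt (𝓡 d) x₁ p))) (chartD d x₀ (Φ p)) := by
    rw [hl]; exact hasMFDerivAt_chart hΦp
  have h4 := h2.comp _ h1
  have h5 := h3.comp (f := Φ ∘ (extChartAt (𝓡 d) x₁).symm) (extChartAt (𝓡 d) x₁ p) h4
  exact hasMFDerivAt_iff_hasFDerivAt.1 h5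

theorem contDiffAt_mapInChart {x₀ x₁ p : N} {Φ : N → N}
    (hp : p ∈ (extChartAt (𝓡 d) x₁).source) (hΦp : Φ p ∈ (extChartAt (𝓡 d) x₀).source)
    (hΦ : ContMDiffAt (𝓡 d) (𝓡 d) ∞ Φ p) :
    ContDiffAt ℝ ∞ (mapInChart d x₀ x₁ Φ) (extChartAt (𝓡 d) x₁ p) := by
  have hl := (extChartAt (𝓡 d) x₁).left_inv hp
  have h1 : ContMDiffAt 𝓘(ℝ, EuclideanSpace ℝ (Fin d)) (𝓡 d) ∞ (extChartAt (𝓡 d) x₁).symm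
      (extChartAt (𝓡 d) x₁ p) :=
    (contMDiffOn_extChartAt_symm x₁).contMDiffAt
      (extChartAt_target_mem_nhds' ((extChartAt (𝓡 d) x₁).map_source hp))
  have h2 : ContMDiffAt (𝓡 d) (𝓡 d) ∞ Φ
      ((extChartAt (𝓡 d) x₁).symm (extChartAt (𝓡 d) x₁ p)) := by rwa [hl]
  have h3 : ContMDiffAt (𝓡 d) 𝓘(ℝ, EuclideanSpace ℝ (Fin d)) ∞ (extChartAt (𝓡 d) x₀)
      (Φ ((extChartAt (𝓡 d) x₁).symm (extChartAt (𝓡 d) x₁ p))) := by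
    rw [hl]
    exact contMDiffAt_extChartAt' (by rwa [← extChartAt_source (𝓡 d)])
  have h4 := h2.comp _ h1
  have h5 := h3.comp (f := Φ ∘ (extChartAt (𝓡 d) x₁).symm) (extChartAt (𝓡 d) x₁ p) h4
  exact contMDiffAt_iff_contDiffAt.1 h5

variable {m : ℕ}

section Values

omit [IsManifold (𝓡 d) ∞ N]

/-- The value of a vector field, as a vector of the model space. -/
def VField.val (Y : VField d N) (p : N) : EuclideanSpace ℝ (Fin d) := Y p

/-- The value of a multivector field, as a multivector on the model space. -/
def MultivectorField.val (X : MultivectorField d N m) (p : N) :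
    Multivector (EuclideanSpace ℝ (Fin d)) m := X p

/-- The value of a differential form, as a form on the model space. -/
def DiffForm.val (α : DiffForm d N m) (p : N) : EuclideanSpace ℝ (Fin d) [⋀^Fin m]→L[ℝ] ℝ := α p

theorem inChart_eq_val (X : MultivectorField d N m) (x₀ : N) (y : EuclideanSpace ℝ (Fin d)) :
    X.inChart x₀ y = Multivector.map (chartD d x₀ ((extChartAt (𝓡 d) x₀).symm y))
      (X.val ((extChartAt (𝓡 d) x₀).symm y)) := rfl

theorem vfield_inChart_eq_val (Y : VField d N) (x₀ : N) (y : EuclideanSpace ℝ (Fin d)) :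
    Y.inChart x₀ y = chartD d x₀ ((extChartAt (𝓡 d) x₀).symm y)
      (Y.val ((extChartAt (𝓡 d) x₀).symm y)) := rfl

theorem diffForm_inChart_eq_val (α : DiffForm d N m) (x₀ : N) (y : EuclideanSpace ℝ (Fin d)) :
    α.inChart x₀ y = (α.val ((extChartAt (𝓡 d) x₀).symm y)).compContinuousLinearMap
      (chartDSymm x₀ y) := rfl

theorem inChart_extChartAt (X : MultivectorField d N m) {x₀ p : N}
    (hp : p ∈ (extChartAt (𝓡 d) x₀).source) :
    X.inChart x₀ (extChartAt (𝓡 d) x₀ p) = Multivector.map (chartD d x₀ p) (X.val p) := by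
  rw [inChart_eq_val, (extChartAt (𝓡 d) x₀).left_inv hp]

theorem vfield_inChart_extChartAt (Y : VField d N) {x₀ p : N}
    (hp : p ∈ (extChartAt (𝓡 d) x₀).source) :
    Y.inChart x₀ (extChartAt (𝓡 d) x₀ p) = chartD d x₀ p (Y.val p) := by
  rw [vfield_inChart_eq_val, (extChartAt (𝓡 d) x₀).left_inv hp]

theorem pushforward_val (Φ : OpenPartialHomeomorph N N) (X : MultivectorField d N m) (q : N) :
    (pushforward Φ X).val q = Multivector.map (mapD d Φ (Φ.symm q)) (X.val (Φ.symm q)) := rfl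

theorem pushforward_apply (Φ : OpenPartialHomeomorph N N) (X : MultivectorField d N m) {p : N}
    (hp : p ∈ Φ.source) :
    (pushforward Φ X).val (Φ p) = Multivector.map (mapD d Φ p) (X.val p) := by
  rw [pushforward_val, Φ.left_inv hp]

theorem IsLocalDiffeo.contMDiffAt {Φ : OpenPartialHomeomorph N N}
    (hΦ : IsLocalDiffeo d Φ) {p : N} (hp : p ∈ Φ.source) :
    ContMDiffAt (𝓡 d) (𝓡 d) ∞ Φ p := hΦ.1.contMDiffAt (Φ.open_source.mem_nhds hp)

theorem IsLocalDiffeo.symm {Φ : OpenPartialHomeomorph N N} (hΦ : IsLocalDiffeo d Φ) :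
    IsLocalDiffeo d Φ.symm := ⟨hΦ.2, hΦ.1⟩

theorem isLocalDiffeo_refl : IsLocalDiffeo d (OpenPartialHomeomorph.refl N) :=
  ⟨contMDiffOn_id, contMDiffOn_id⟩

theorem pushforward_refl (X : MultivectorField d N m) :
    pushforward (OpenPartialHomeomorph.refl N) X = X := by
  funext q
  have h := pushforward_val (OpenPartialHomeomorph.refl N) X q
  rw [OpenPartialHomeomorph.refl_symm, OpenPartialHomeomorph.refl_apply,
    mapD_id] at h
  exact h

end Values

theorem vfield_inChart_eq (Y : VField d N) {x₀ x₁ p : N}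
    (hp : p ∈ (extChartAt (𝓡 d) x₁).source) (hp₀ : p ∈ (extChartAt (𝓡 d) x₀).source) :
    Y.inChart x₀ (extChartAt (𝓡 d) x₀ p) =
      fderiv ℝ (mapInChart d x₀ x₁ id) (extChartAt (𝓡 d) x₁ p)
        (Y.inChart x₁ (extChartAt (𝓡 d) x₁ p)) := by
  rw [(hasFDerivAt_mapInChart (Φ := id) hp hp₀ mdifferentiableAt_id).fderiv,
    vfield_inChart_extChartAt Y hp₀, vfield_inChart_extChartAt Y hp, mapD_id,
    ← ContinuousLinearMap.comp_apply, ContinuousLinearMap.comp_assoc,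
    ContinuousLinearMap.comp_assoc, chartDSymm_comp_chartD' hp]
  rfl

theorem pushforward_inChart_eq_map {Φ : OpenPartialHomeomorph N N} (hΦ : IsLocalDiffeo d Φ)
    (X : MultivectorField d N m) {x₀ x₁ p : N} (hpΦ : p ∈ Φ.source)
    (hp : p ∈ (extChartAt (𝓡 d) x₁).source) (hp₀ : Φ p ∈ (extChartAt (𝓡 d) x₀).source) :
    (pushforward Φ X).inChart x₀ (extChartAt (𝓡 d) x₀ (Φ p)) =
      Multivector.map (fderiv ℝ (mapInChart d x₀ x₁ Φ) (extChartAt (𝓡 d) x₁ p))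
        (X.inChart x₁ (extChartAt (𝓡 d) x₁ p)) := by
  rw [(hasFDerivAt_mapInChart (Φ := Φ) hp hp₀
    ((hΦ.contMDiffAt hpΦ).mdifferentiableAt (by simp))).fderiv,
    inChart_extChartAt _ hp₀, inChart_extChartAt X hp, Multivector.map_map,
    pushforward_apply Φ X hpΦ, Multivector.map_map]
  rw [ContinuousLinearMap.comp_assoc, ContinuousLinearMap.comp_assoc, chartDSymm_comp_chartD' hp]
  rfl

/-- A change of chart is the push-forward along the identity map, read in two charts. -/
theorem inChart_eq_map (X : MultivectorField d N m) {x₀ x₁ p : N}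
    (hp : p ∈ (extChartAt (𝓡 d) x₁).source) (hp₀ : p ∈ (extChartAt (𝓡 d) x₀).source) :
    X.inChart x₀ (extChartAt (𝓡 d) x₀ p) =
      Multivector.map (fderiv ℝ (mapInChart d x₀ x₁ id) (extChartAt (𝓡 d) x₁ p))
        (X.inChart x₁ (extChartAt (𝓡 d) x₁ p)) := by
  have h := pushforward_inChart_eq_map isLocalDiffeo_refl X (mem_univ p) hp hp₀
  rwa [pushforward_refl] at h

theorem contDiffAt_multivectorMap {Z E F : Type*} [NormedAddCommGroup Z] [NormedSpace ℝ Z]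
    [NormedAddCommGroup E] [NormedSpace ℝ E] [FiniteDimensional ℝ E]
    [NormedAddCommGroup F] [NormedSpace ℝ F] [FiniteDimensional ℝ F]
    {A : Z → E →L[ℝ] F} {X : Z → Multivector E m} {z : Z} {k : WithTop ℕ∞}
    (hA : ContDiffAt ℝ k A z) (hX : ContDiffAt ℝ k X z) :
    ContDiffAt ℝ k (fun z => Multivector.map (A z) (X z)) z := by
  have h1 : ContDiffAt ℝ k (fun z => (A z, X z)) z := hA.prodMk hX
  have h2 : ContDiffAt ℝ k (fun z : (E →L[ℝ] F) × Multivector E m => Multivector.map z.1 z.2)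
    (A z, X z) := contDiff_map.contDiffAt
  exact h2.comp z h1

/-- With g the chart expression of `Φ`, the push-forward is y ↦ Λᵐ(Dg)(X) evaluated at g⁻¹(y).
Smoothness of the inverse enters here. -/
theorem contDiffAt_pushforward_inChart {Φ : OpenPartialHomeomorph N N} (hΦ : IsLocalDiffeo d Φ)
    (X : MultivectorField d N m) {x₀ x₁ p : N} (hpΦ : p ∈ Φ.source)
    (hp : p ∈ (extChartAt (𝓡 d) x₁).source) (hp₀ : Φ p ∈ (extChartAt (𝓡 d) x₀).source)
    (hX : ContDiffAt ℝ ∞ (X.inChart x₁) (extChartAt (𝓡 d) x₁ p)) :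
    ContDiffAt ℝ ∞ ((pushforward Φ X).inChart x₀) (extChartAt (𝓡 d) x₀ (Φ p)) := by
  have hΦp : Φ p ∈ Φ.target := Φ.map_source hpΦ
  have hl : Φ.symm (Φ p) = p := Φ.left_inv hpΦ
  have hg : ContDiffAt ℝ ∞ (mapInChart d x₁ x₀ Φ.symm) (extChartAt (𝓡 d) x₀ (Φ p)) :=
    contDiffAt_mapInChart hp₀ (by rwa [hl]) (hΦ.symm.contMDiffAt hΦp)
  have hgp : mapInChart d x₁ x₀ Φ.symm (extChartAt (𝓡 d) x₀ (Φ p)) = extChartAt (𝓡 d) x₁ p := by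
    unfold mapInChart
    rw [(extChartAt (𝓡 d) x₀).left_inv hp₀, hl]
  have hD : ContDiffAt ℝ ∞ (fderiv ℝ (mapInChart d x₀ x₁ Φ)) (extChartAt (𝓡 d) x₁ p) :=
    (contDiffAt_mapInChart hp hp₀ (hΦ.contMDiffAt hpΦ)).fderiv_right (by simp)
  have hD' : ContDiffAt ℝ ∞ (fun y => fderiv ℝ (mapInChart d x₀ x₁ Φ)
      (mapInChart d x₁ x₀ Φ.symm y)) (extChartAt (𝓡 d) x₀ (Φ p)) := by
    rw [← hgp] at hD
    exact hD.comp _ hg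
  have hX' : ContDiffAt ℝ ∞ (fun y => X.inChart x₁ (mapInChart d x₁ x₀ Φ.symm y))
      (extChartAt (𝓡 d) x₀ (Φ p)) := by
    rw [← hgp] at hX
    exact hX.comp _ hg
  refine (contDiffAt_multivectorMap hD' hX').congr_of_eventuallyEq ?_
  have hcs : ContinuousAt (extChartAt (𝓡 d) x₀).symm (extChartAt (𝓡 d) x₀ (Φ p)) :=
    continuousAt_extChartAt_symm' hp₀
  have hl₀ := (extChartAt (𝓡 d) x₀).left_inv hp₀
  have e1 : ∀ᶠ y in 𝓝 (extChartAt (𝓡 d) x₀ (Φ p)), (extChartAt (𝓡 d) x₀).symm y ∈ Φ.target :=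
    hcs.eventually_mem (by rw [hl₀]; exact Φ.open_target.mem_nhds hΦp)
  have e2 : ∀ᶠ y in 𝓝 (extChartAt (𝓡 d) x₀ (Φ p)),
      Φ.symm ((extChartAt (𝓡 d) x₀).symm y) ∈ (extChartAt (𝓡 d) x₁).source := by
    have : ContinuousAt (fun y => Φ.symm ((extChartAt (𝓡 d) x₀).symm y))
        (extChartAt (𝓡 d) x₀ (Φ p)) :=
      ContinuousAt.comp (by rw [hl₀]; exact Φ.continuousAt_symm hΦp) hcs
    refine this.eventually_mem ?_
    rw [hl₀, hl]
    exact (isOpen_extChartAt_source x₁).mem_nhds hp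
  have e3 : ∀ᶠ y in 𝓝 (extChartAt (𝓡 d) x₀ (Φ p)), y ∈ (extChartAt (𝓡 d) x₀).target :=
    extChartAt_target_mem_nhds' ((extChartAt (𝓡 d) x₀).map_source hp₀)
  filter_upwards [e1, e2, e3] with y h1 h2 h3
  have hr : Φ (Φ.symm ((extChartAt (𝓡 d) x₀).symm y)) = (extChartAt (𝓡 d) x₀).symm y :=
    Φ.right_inv h1
  have h := pushforward_inChart_eq_map hΦ X (x₀ := x₀) (Φ.map_target h1) h2
    (by rw [hr]; exact (extChartAt (𝓡 d) x₀).map_target h3)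
  rw [hr, (extChartAt (𝓡 d) x₀).right_inv h3] at h
  exact h

omit [IsManifold (𝓡 d) ∞ N] in
theorem MultivectorField.IsSmoothOn.contDiffAt {X : MultivectorField d N m} {U : Set N}
    (hU : IsOpen U) (hX : X.IsSmoothOn U) {x₀ p : N} (hp : p ∈ (extChartAt (𝓡 d) x₀).source)
    (hpU : p ∈ U) : ContDiffAt ℝ ∞ (X.inChart x₀) (extChartAt (𝓡 d) x₀ p) := by
  refine (hX x₀).contDiffAt (Filter.inter_mem
    (extChartAt_target_mem_nhds' ((extChartAt (𝓡 d) x₀).map_source hp)) ?_)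
  refine (continuousAt_extChartAt_symm' hp).preimage_mem_nhds ?_
  rw [(extChartAt (𝓡 d) x₀).left_inv hp]
  exact hU.mem_nhds hpU

omit [IsManifold (𝓡 d) ∞ N] in
theorem isSmoothOn_of_forall_chart {X : MultivectorField d N m} {U : Set N}
    (h : ∀ p ∈ U, ∀ x₀, p ∈ (extChartAt (𝓡 d) x₀).source →
      ContDiffAt ℝ ∞ (X.inChart x₀) (extChartAt (𝓡 d) x₀ p)) : X.IsSmoothOn U := by
  intro x₀ y hy
  have := h _ hy.2 x₀ ((extChartAt (𝓡 d) x₀).map_target hy.1)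
  rw [(extChartAt (𝓡 d) x₀).right_inv hy.1] at this
  exact this.contDiffWithinAt

/-- Smoothness may be checked in one chart around each point. -/
theorem isSmoothOn_of_exists_chart {X : MultivectorField d N m} {U : Set N}
    (h : ∀ p ∈ U, ∃ x₁, p ∈ (extChartAt (𝓡 d) x₁).source ∧
      ContDiffAt ℝ ∞ (X.inChart x₁) (extChartAt (𝓡 d) x₁ p)) : X.IsSmoothOn U := by
  refine isSmoothOn_of_forall_chart fun p hpU x₀ hp₀ => ?_
  obtain ⟨x₁, hp₁, hX⟩ := h p hpU
  have := contDiffAt_pushforward_inChart (x₀ := x₀) isLocalDiffeo_refl X (mem_univ p) hp₁ hp₀ hX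
  rwa [pushforward_refl] at this

theorem isSmoothOn_pushforward {Φ : OpenPartialHomeomorph N N} (hΦ : IsLocalDiffeo d Φ)
    {X : MultivectorField d N m} (hX : X.IsSmoothOn Φ.source) :
    (pushforward Φ X).IsSmoothOn Φ.target := by
  refine isSmoothOn_of_forall_chart fun q hq x₀ hq₀ => ?_
  have hp := Φ.map_target hq
  have hr := Φ.right_inv hq
  have hc := mem_extChartAt_source (I := 𝓡 d) (Φ.symm q)
  have := contDiffAt_pushforward_inChart (x₀ := x₀) hΦ X hp hc (by rwa [hr])
    (hX.contDiffAt Φ.open_source hc hp)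
  rwa [hr] at this

end Charts

/-! ### The bracket on a manifold, and its locality on the kernel -/

section Bracket

open Set Topology

section Derivation

variable {Z E : Type*} [NormedAddCommGroup Z] [NormedSpace ℝ Z]
  [NormedAddCommGroup E] [NormedSpace ℝ E] [FiniteDimensional ℝ E] {m : ℕ}

theorem contDiffAt_fderiv_apply {V W : Type*} [NormedAddCommGroup V] [NormedSpace ℝ V]
    [NormedAddCommGroup W] [NormedSpace ℝ W] {f : V → W} (hf : ContDiff ℝ ∞ f) {a b : Z → V} {z : Z}
    (ha : ContDiffAt ℝ ∞ a z) (hb : ContDiffAt ℝ ∞ b z) :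
    ContDiffAt ℝ ∞ (fun z => fderiv ℝ f (a z) (b z)) z := by
  have h : ContDiff ℝ ∞ (fderiv ℝ f) := hf.fderiv_right (by simp)
  exact (h.contDiffAt.comp z ha).clm_apply hb

theorem contDiffAt_smul_abstract {W : Type*} [NormedAddCommGroup W] [NormedSpace ℝ W] {f : Z → ℝ}
    {g : Z → W} {z : Z} (hf : ContDiffAt ℝ ∞ f z) (hg : ContDiffAt ℝ ∞ g z) :
    ContDiffAt ℝ ∞ (fun z => f z • g z) z := hf.smul hg

theorem eq_fderiv_of_hasDerivAt_prod {V V' W : Type*} [NormedAddCommGroup V] [NormedSpace ℝ V]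
    [NormedAddCommGroup V'] [NormedSpace ℝ V'] [NormedAddCommGroup W] [NormedSpace ℝ W]
    {f : V × V' → W} (hf : ContDiff ℝ ∞ f) {c : ℝ → V} {v : V} {x' : V'} {w : W}
    (hc : HasDerivAt c v 0) (hw : HasDerivAt (fun t => f (c t, x')) w 0) :
    w = fderiv ℝ f (c 0, x') (v, 0) :=
  hw.unique (fderiv_comp_hasDerivAt ((hf.differentiable (by simp)) _)
    (hc.prodMk (hasDerivAt_const (0 : ℝ) x')))

/-- The derivation is the derivative of A ↦ Λᵐ A at the identity; its joint smoothness in `D` and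
`X` is thus inherited from `contDiff_map`. -/
theorem derivation_eq_fderiv_map (D : E →L[ℝ] E) (X : Multivector E m) :
    Multivector.derivation D X =
      fderiv ℝ (fun z : (E →L[ℝ] E) × Multivector E m => Multivector.map z.1 z.2)
        (ContinuousLinearMap.id ℝ E, X) (D, 0) := by
  have hA : HasDerivAt (fun t : ℝ => ContinuousLinearMap.id ℝ E + t • D) D 0 := by
    simpa using ((hasDerivAt_id (0 : ℝ)).smul_const D).const_add (ContinuousLinearMap.id ℝ E)
  have h0 : ContinuousLinearMap.id ℝ E + (0 : ℝ) • D = ContinuousLinearMap.id ℝ E := by simp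
  have hX : HasDerivAt (fun _ : ℝ => X) 0 0 := hasDerivAt_const (0 : ℝ) X
  have h1 := HasDerivAt.multivectorMap_comp_left
    (A := fun t : ℝ => ContinuousLinearMap.id ℝ E + t • D) (D := D) (t := 0)
    (by simpa only [h0, ContinuousLinearMap.comp_id] using hA) hX
  have h4 := eq_fderiv_of_hasDerivAt_prod (V' := Multivector E m) (W := Multivector E m)
    (f := fun z : (E →L[ℝ] E) × Multivector E m => Multivector.map z.1 z.2) contDiff_map hA h1
  simp only [h0] at h4
  rw [← h4, Multivector.map_id, Multivector.map_id, zero_add]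

theorem contDiffAt_derivation {A : Z → E →L[ℝ] E} {X : Z → Multivector E m} {z : Z}
    (hA : ContDiffAt ℝ ∞ A z) (hX : ContDiffAt ℝ ∞ X z) :
    ContDiffAt ℝ ∞ (fun z => Multivector.derivation (A z) (X z)) z := by
  simp only [derivation_eq_fderiv_map]
  have h1 : ContDiffAt ℝ ∞ (fun z => (ContinuousLinearMap.id ℝ E, X z)) z :=
    contDiffAt_const.prodMk hX
  have h2 : ContDiffAt ℝ ∞ (fun z => (A z, (0 : Multivector E m))) z :=
    hA.prodMk contDiffAt_const
  exact contDiffAt_fderiv_apply (V := (E →L[ℝ] E) × Multivector E m) (W := Multivector E m)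
    contDiff_map h1 h2

omit [FiniteDimensional ℝ E] in
theorem contDiffAt_fderiv_self_apply {W : Type*} [NormedAddCommGroup W] [NormedSpace ℝ W]
    {f : E → W} {b : E → E} {y : E} (hf : ContDiffAt ℝ ∞ f y) (hb : ContDiffAt ℝ ∞ b y) :
    ContDiffAt ℝ ∞ (fun y => fderiv ℝ f y (b y)) y :=
  (hf.fderiv_right (m := ∞) (by simp)).clm_apply hb

theorem contDiffAt_schoutenBracketChart {Y : E → E} {X : E → Multivector E m} {y : E}
    (hY : ContDiffAt ℝ ∞ Y y) (hX : ContDiffAt ℝ ∞ X y) :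
    ContDiffAt ℝ ∞ (schoutenBracketChart Y X) y :=
  (contDiffAt_fderiv_self_apply (W := Multivector E m) hX hY).sub
    (contDiffAt_derivation (hY.fderiv_right (m := ∞) (by simp)) hX)

end Derivation

variable {d m : ℕ} {N : Type*} [TopologicalSpace N] [ChartedSpace (EuclideanSpace ℝ (Fin d)) N]
  [IsManifold (𝓡 d) ∞ N]

/-- On the domain of the chart at `x₀`, the trivialization of the tangent bundle at `x₀` is the
derivative of that chart, so the chart expression is the fibre component of the section. -/
theorem VField.IsSmooth.contDiffAt_inChart [IsManifold (𝓡 d) 1 N] {Y : VField d N}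
    (hY : Y.IsSmooth) {x₀ p : N}
    (hp : p ∈ (extChartAt (𝓡 d) x₀).source) :
    ContDiffAt ℝ ∞ (Y.inChart x₀) (extChartAt (𝓡 d) x₀ p) := by
  have hs := extChartAt_source (𝓡 d) x₀
  have h1 := (Bundle.Trivialization.contMDiffAt_section_iff (IB := 𝓡 d) (n := ∞)
    (F := EuclideanSpace ℝ (Fin d)) (E := fun q : N => TangentSpace (𝓡 d) q) (s := Y) (x₀ := p)
    (trivializationAt (EuclideanSpace ℝ (Fin d)) (TangentSpace (𝓡 d)) x₀)
    (by rw [TangentBundle.trivializationAt_baseSet, ← hs]; exact hp)).1 (hY p)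
  have h2 : ContMDiffAt (𝓡 d) 𝓘(ℝ, EuclideanSpace ℝ (Fin d)) ∞
      (fun q => chartD d x₀ q (Y.val q)) p := by
    refine h1.congr_of_eventuallyEq ?_
    filter_upwards [(isOpen_extChartAt_source (I := 𝓡 d) x₀).mem_nhds hp] with q hq
    rw [hs] at hq
    have h3 := TangentBundle.continuousLinearMapAt_trivializationAt (I := 𝓡 d) hq
    have h4 := congrArg (fun A => A (Y q)) h3
    refine Eq.trans h4.symm ?_
    exact Bundle.Trivialization.continuousLinearMapAt_apply_of_mem (R := ℝ) _ hq _
  have hl := (extChartAt (𝓡 d) x₀).left_inv hp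
  have h5 : ContMDiffAt 𝓘(ℝ, EuclideanSpace ℝ (Fin d)) (𝓡 d) ∞ (extChartAt (𝓡 d) x₀).symm
      (extChartAt (𝓡 d) x₀ p) :=
    (contMDiffOn_extChartAt_symm x₀).contMDiffAt
      (extChartAt_target_mem_nhds' ((extChartAt (𝓡 d) x₀).map_source hp))
  rw [← hl] at h2
  exact contMDiffAt_iff_contDiffAt.1 (h2.comp _ h5)

omit [IsManifold (𝓡 d) ∞ N] in
theorem schoutenBracket_val (Y : VField d N) (X : MultivectorField d N m) (p : N) :
    (schoutenBracket Y X).val p = Multivector.map (chartDSymm p (extChartAt (𝓡 d) p p))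
      (schoutenBracketChart (Y.inChart p) (X.inChart p) (extChartAt (𝓡 d) p p)) := rfl

theorem val_eq_map_inChart (X : MultivectorField d N m) {x₀ p : N}
    (hp : p ∈ (extChartAt (𝓡 d) x₀).source) :
    X.val p = Multivector.map (chartDSymm x₀ (extChartAt (𝓡 d) x₀ p))
      (X.inChart x₀ (extChartAt (𝓡 d) x₀ p)) := by
  rw [inChart_extChartAt X hp, Multivector.map_map, chartDSymm_comp_chartD' hp,
    Multivector.map_id]

/-- The Schouten-Nijenhuis bracket may be computed in any chart. -/
theorem schoutenBracket_inChart [IsManifold (𝓡 d) 1 N] {Y : VField d N} (hY : Y.IsSmooth)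
    {X : MultivectorField d N m} {U : Set N} (hU : IsOpen U) (hX : X.IsSmoothOn U) {x₀ p : N}
    (hp : p ∈ (extChartAt (𝓡 d) x₀).source) (hpU : p ∈ U) :
    (schoutenBracket Y X).inChart x₀ (extChartAt (𝓡 d) x₀ p) =
      schoutenBracketChart (Y.inChart x₀) (X.inChart x₀) (extChartAt (𝓡 d) x₀ p) := by
  have hpp := mem_extChartAt_source (I := 𝓡 d) p
  have hτ : mapInChart d x₀ p id (extChartAt (𝓡 d) p p) = extChartAt (𝓡 d) x₀ p := by
    simp [mapInChart]
  have hτs : ContDiffAt ℝ ∞ (mapInChart d x₀ p id) (extChartAt (𝓡 d) p p) :=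
    contDiffAt_mapInChart (Φ := id) hpp hp contMDiffAt_id
  have he : ∀ᶠ y in 𝓝 (extChartAt (𝓡 d) p p), y ∈ (extChartAt (𝓡 d) p).target ∧
      (extChartAt (𝓡 d) p).symm y ∈ (extChartAt (𝓡 d) x₀).source := by
    refine (extChartAt_target_mem_nhds (I := 𝓡 d) p |> Filter.Eventually.and <| ?_)
    refine (continuousAt_extChartAt_symm (I := 𝓡 d) p).eventually_mem ?_
    rw [extChartAt_to_inv]
    exact (isOpen_extChartAt_source x₀).mem_nhds hp
  have key := schoutenBracketChart_map (m := m) (φ := mapInChart d x₀ p id)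
    (z := extChartAt (𝓡 d) p p)
    (Y₁ := Y.inChart p) (Y₂ := Y.inChart x₀) (X₁ := X.inChart p) (X₂ := X.inChart x₀)
    (hτs.of_le (WithTop.coe_le_coe.2 le_top))
    ((hY.contDiffAt_inChart hpp).differentiableAt (by simp))
    (by rw [hτ]; exact (hY.contDiffAt_inChart hp).differentiableAt (by simp))
    ((hX.contDiffAt hU hpp hpU).differentiableAt (by simp))
    (by rw [hτ]; exact (hX.contDiffAt hU hp hpU).differentiableAt (by simp))
    (by
      filter_upwards [he] with y hy
      have := vfield_inChart_eq Y ((extChartAt (𝓡 d) p).map_target hy.1) hy.2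
      rwa [(extChartAt (𝓡 d) p).right_inv hy.1] at this)
    (by
      filter_upwards [he] with y hy
      have := inChart_eq_map X ((extChartAt (𝓡 d) p).map_target hy.1) hy.2
      rwa [(extChartAt (𝓡 d) p).right_inv hy.1] at this)
  rw [hτ] at key
  rw [key, (hasFDerivAt_mapInChart (Φ := id) hpp hp mdifferentiableAt_id).fderiv,
    inChart_extChartAt _ hp, schoutenBracket_val, Multivector.map_map, mapD_id]
  rfl

theorem isSmoothOn_schoutenBracket [IsManifold (𝓡 d) 1 N] {Y : VField d N} (hY : Y.IsSmooth)
    {X : MultivectorField d N m} {U : Set N} (hU : IsOpen U) (hX : X.IsSmoothOn U) :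
    (schoutenBracket Y X).IsSmoothOn U := by
  refine isSmoothOn_of_forall_chart fun p hpU x₀ hp => ?_
  refine (contDiffAt_schoutenBracketChart (hY.contDiffAt_inChart hp)
    (hX.contDiffAt hU hp hpU)).congr_of_eventuallyEq ?_
  have e1 : ∀ᶠ y in 𝓝 (extChartAt (𝓡 d) x₀ p), (extChartAt (𝓡 d) x₀).symm y ∈ U :=
    (continuousAt_extChartAt_symm' hp).eventually_mem
      (by rw [(extChartAt (𝓡 d) x₀).left_inv hp]; exact hU.mem_nhds hpU)
  filter_upwards [extChartAt_target_mem_nhds' ((extChartAt (𝓡 d) x₀).map_source hp), e1]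
    with y hy hyU
  have := schoutenBracket_inChart hY hU hX ((extChartAt (𝓡 d) x₀).map_target hy) hyU
  rwa [(extChartAt (𝓡 d) x₀).right_inv hy] at this

/-- Vanishing of the contraction may be checked in a chart. -/
theorem contraction_inChart_eq_zero_iff (X : MultivectorField d N m) (Ω : DiffForm d N (m + 1))
    {x₀ p : N} (hp : p ∈ (extChartAt (𝓡 d) x₀).source) :
    contraction (X.inChart x₀ (extChartAt (𝓡 d) x₀ p)) (Ω.inChart x₀ (extChartAt (𝓡 d) x₀ p)) = 0 ↔
      contraction (X.val p) (Ω.val p) = 0 := by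
  have h := contraction_map_comp (chartDSymm x₀ (extChartAt (𝓡 d) x₀ p))
    (X.inChart x₀ (extChartAt (𝓡 d) x₀ p)) (Ω.val p)
  rw [← val_eq_map_inChart X hp] at h
  rw [diffForm_inChart_eq_val, (extChartAt (𝓡 d) x₀).left_inv hp, ← h]
  refine ⟨fun h0 => ?_, fun h0 => by rw [h0, ContinuousLinearMap.zero_comp]⟩
  have h1 := congrArg (fun A => A.comp (chartD d x₀ p)) h0
  simp only [ContinuousLinearMap.comp_assoc, chartDSymm_comp_chartD' hp,
    ContinuousLinearMap.comp_id, ContinuousLinearMap.zero_comp] at h1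
  exact h1

omit [IsManifold (𝓡 d) ∞ N] in
theorem mem_kerm_iff {X : MultivectorField d N m} {Ω : DiffForm d N (m + 1)} {U : Set N} :
    X ∈ kerm Ω U ↔ X.IsSmoothOn U ∧ ∀ p ∈ U, contraction (X.val p) (Ω.val p) = 0 := Iff.rfl

omit [IsManifold (𝓡 d) ∞ N] in
theorem kerm_mono {Ω : DiffForm d N (m + 1)} {U V : Set N} (h : V ⊆ U)
    {X : MultivectorField d N m} (hX : X ∈ kerm Ω U) : X ∈ kerm Ω V :=
  ⟨fun x₀ => (hX.1 x₀).mono fun _ hy => ⟨hy.1, h hy.2⟩, fun p hp => hX.2 p (h hp)⟩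

omit [IsManifold (𝓡 d) ∞ N] in
theorem inChart_congr {X X' : MultivectorField d N m} {x₀ p : N}
    (hp : p ∈ (extChartAt (𝓡 d) x₀).source) (h : ∀ᶠ q in 𝓝 p, X'.val q = X.val q) :
    X'.inChart x₀ =ᶠ[𝓝 (extChartAt (𝓡 d) x₀ p)] X.inChart x₀ := by
  have hc : ContinuousAt (extChartAt (𝓡 d) x₀).symm (extChartAt (𝓡 d) x₀ p) :=
    continuousAt_extChartAt_symm' hp
  have h' : ∀ᶠ q in 𝓝 ((extChartAt (𝓡 d) x₀).symm (extChartAt (𝓡 d) x₀ p)),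
      X'.val q = X.val q := by rwa [(extChartAt (𝓡 d) x₀).left_inv hp]
  filter_upwards [hc.eventually h'] with y hy
  rw [inChart_eq_val, inChart_eq_val, hy]

/-- An element of `kerᵐ(Ω|_U)` agrees near each point of `U` with an element of `kerᵐ Ω`. -/
theorem exists_mem_kerm_univ_eventuallyEq [T2Space N] {Ω : DiffForm d N (m + 1)} {U : Set N}
    (hU : IsOpen U) {X : MultivectorField d N m} (hX : X ∈ kerm Ω U) {q : N} (hq : q ∈ U) :
    ∃ X' ∈ kerm Ω univ, ∀ᶠ p in 𝓝 q, X'.val p = X.val p := by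
  obtain ⟨f, -, hf⟩ := ((SmoothBumpFunction.nhds_basis_tsupport (I := 𝓡 d) q).mem_iff).1
    (hU.mem_nhds hq)
  -- A bump function supported in `U` and equal to 1 near `q`; being a kernel field survives
  -- multiplication by functions.
  let X' : MultivectorField d N m := fun p => f p • X p
  have hv : ∀ p, X'.val p = f p • X.val p := fun p => rfl
  refine ⟨X', mem_kerm_iff.2 ⟨isSmoothOn_of_forall_chart fun p _ x₀ hp => ?_, fun p _ => ?_⟩, ?_⟩
  · by_cases hpf : p ∈ tsupport f
    · have h1 := hX.1.contDiffAt hU hp (hf hpf)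
      have h5 : ContMDiffAt 𝓘(ℝ, EuclideanSpace ℝ (Fin d)) (𝓡 d) ∞ (extChartAt (𝓡 d) x₀).symm
          (extChartAt (𝓡 d) x₀ p) :=
        (contMDiffOn_extChartAt_symm x₀).contMDiffAt
          (extChartAt_target_mem_nhds' ((extChartAt (𝓡 d) x₀).map_source hp))
      have h6 : ContDiffAt ℝ ∞ (fun y => f ((extChartAt (𝓡 d) x₀).symm y))
          (extChartAt (𝓡 d) x₀ p) :=
        contMDiffAt_iff_contDiffAt.1 (f.contMDiff.contMDiffAt.comp _ h5)
      refine (contDiffAt_smul_abstract (W := Multivector (EuclideanSpace ℝ (Fin d)) m) h6 h1).congr_of_eventuallyEq (Filter.Eventually.of_forall fun y => ?_)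
      change X'.inChart x₀ y = f ((extChartAt (𝓡 d) x₀).symm y) • X.inChart x₀ y
      rw [inChart_eq_val, inChart_eq_val, hv, Multivector.map_smul]
    · have h0 : X'.inChart x₀ =ᶠ[𝓝 (extChartAt (𝓡 d) x₀ p)]
          (fun _ => (0 : Multivector (EuclideanSpace ℝ (Fin d)) m)) := by
        have := inChart_congr (X := fun p => (0 : Multivector (TangentSpace (𝓡 d) p) m))
          (X' := X') hp (by
            filter_upwards [(isClosed_tsupport f).isOpen_compl.mem_nhds hpf] with s hs
            rw [hv, image_eq_zero_of_notMem_tsupport hs, zero_smul]; rfl)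
        refine this.trans (Filter.Eventually.of_forall fun y => ?_)
        exact Multivector.map_zero _
      exact contDiffAt_const.congr_of_eventuallyEq h0
  · rw [hv, contraction_smul_left]
    by_cases hpf : p ∈ tsupport f
    · rw [(mem_kerm_iff.1 hX).2 p (hf hpf), smul_zero]
    · rw [image_eq_zero_of_notMem_tsupport hpf, zero_smul]
  · filter_upwards [f.eventuallyEq_one] with p hp
    rw [hv, hp]
    exact one_smul _ _

/-- The bracket with `Y` preserves `kerᵐ(Ω|_U)` if it preserves `kerᵐ Ω`. -/
theorem schoutenBracket_mem_kerm [T2Space N] [IsManifold (𝓡 d) 1 N] {Y : VField d N}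
    (hY : Y.IsSmooth) {Ω : DiffForm d N (m + 1)}
    (h : ∀ X ∈ kerm Ω univ, schoutenBracket Y X ∈ kerm Ω univ)
    {U : Set N} (hU : IsOpen U) {X : MultivectorField d N m} (hX : X ∈ kerm Ω U) :
    schoutenBracket Y X ∈ kerm Ω U := by
  refine mem_kerm_iff.2 ⟨isSmoothOn_schoutenBracket hY hU hX.1, fun p hp => ?_⟩
  obtain ⟨X', hX', he⟩ := exists_mem_kerm_univ_eventuallyEq hU hX hp
  have h1 := (mem_kerm_iff.1 (h X' hX')).2 p (mem_univ p)
  have hc := inChart_congr (mem_extChartAt_source (I := 𝓡 d) p) he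
  -- The bracket at `p` sees only the first jet of the multivector field at `p`, so fields that
  -- agree near `p` have the same bracket there.
  have h2 : (schoutenBracket Y X').val p = (schoutenBracket Y X).val p := by
    rw [schoutenBracket_val, schoutenBracket_val]
    congr 1
    unfold schoutenBracketChart
    rw [hc.fderiv_eq, hc.eq_of_nhds]
  rwa [h2] at h1

end Bracket

/-! ### Nondegenerate forms have a locally finitely generated kernel -/

section Nondegenerate

open Set Topology

theorem contDiffAt_linearMap_comp {Z W : Type*} [NormedAddCommGroup Z] [NormedSpace ℝ Z]
    [NormedAddCommGroup W] [NormedSpace ℝ W] [FiniteDimensional ℝ W] (c : W →ₗ[ℝ] ℝ)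
    {f : Z → W} {z : Z} (hf : ContDiffAt ℝ ∞ f z) : ContDiffAt ℝ ∞ (fun z => c (f z)) z :=
  (LinearMap.toContinuousLinearMap c).contDiff.contDiffAt.comp z hf

variable {d m : ℕ} {N : Type*} [TopologicalSpace N] [ChartedSpace (EuclideanSpace ℝ (Fin d)) N]
  [IsManifold (𝓡 d) ∞ N]

theorem IsNondegenerate.inChart {Ω : DiffForm d N (m + 1)} (hΩ : IsNondegenerate Ω) {x₀ p : N}
    (hp : p ∈ (extChartAt (𝓡 d) x₀).source) (v : EuclideanSpace ℝ (Fin d))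
    (hv : ∀ w : Fin m → EuclideanSpace ℝ (Fin d),
      Ω.inChart x₀ (extChartAt (𝓡 d) x₀ p) (Fin.cons v w) = 0) : v = 0 := by
  have h1 : ∀ w : Fin m → EuclideanSpace ℝ (Fin d),
      Ω.val p (Fin.cons (chartDSymm x₀ (extChartAt (𝓡 d) x₀ p) v) w) = 0 := by
    intro w
    have h2 := hv (fun i => chartD d x₀ p (w i))
    rw [diffForm_inChart_eq_val, (extChartAt (𝓡 d) x₀).left_inv hp,
      ContinuousAlternatingMap.compContinuousLinearMap_apply] at h2
    rw [← h2]
    congr 1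
    funext i
    refine Fin.cases rfl (fun i => ?_) i
    exact (congrArg (fun A => A (w i)) (chartDSymm_comp_chartD' hp)).symm
  have h3 : chartDSymm x₀ (extChartAt (𝓡 d) x₀ p) v = 0 := hΩ p _ h1
  have h4 := congrArg (fun A => A v) (chartD_comp_chartDSymm' hp)
  simp only [ContinuousLinearMap.comp_apply, h3, map_zero] at h4
  exact h4.symm

/-- The kernel of a nondegenerate form is locally free of finite rank. -/
theorem IsNondegenerate.kermLocallyFinitelyGenerated {Ω : DiffForm d N (m + 1)}
    (hs : Ω.IsSmooth) (hΩ : IsNondegenerate Ω) : KermLocallyFinitelyGenerated Ω := by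
  intro q
  have hq := mem_extChartAt_source (I := 𝓡 d) q
  obtain ⟨O, hO, hqO, r, z, c, hz, hz0, hc⟩ := exists_contraction_kernel_frame (hΩ.inChart hq)
  have hsmooth : ∀ p ∈ (extChartAt (𝓡 d) q).source,
      ContDiffAt ℝ ∞ (Ω.inChart q) (extChartAt (𝓡 d) q p) := fun p hp =>
    (hs q).contDiffAt (extChartAt_target_mem_nhds' ((extChartAt (𝓡 d) q).map_source hp))
  have hcont : ContinuousOn (fun p => Ω.inChart q (extChartAt (𝓡 d) q p))
      (extChartAt (𝓡 d) q).source := fun p hp =>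
    ((hsmooth p hp).continuousAt.comp (continuousAt_extChartAt' hp)).continuousWithinAt
  -- The frame depends on a point only through the value of the form; `U` is the part of the chart
  -- domain where that value stays in the set `O` on which the frame is defined.
  let U : Set N := (extChartAt (𝓡 d) q).source ∩
    (fun p => Ω.inChart q (extChartAt (𝓡 d) q p)) ⁻¹' O
  have hU : IsOpen U := hcont.isOpen_inter_preimage (isOpen_extChartAt_source q) hO
  let Z : Fin r → MultivectorField d N m := fun i p =>
    (Multivector.map (chartDSymm q (extChartAt (𝓡 d) q p))
      (z i (Ω.inChart q (extChartAt (𝓡 d) q p))) : Multivector (EuclideanSpace ℝ (Fin d)) m)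
  have hZv : ∀ i p, (Z i).val p = Multivector.map (chartDSymm q (extChartAt (𝓡 d) q p))
      (z i (Ω.inChart q (extChartAt (𝓡 d) q p))) := fun i p => rfl
  have hZc : ∀ i, ∀ p ∈ (extChartAt (𝓡 d) q).source, (Z i).inChart q (extChartAt (𝓡 d) q p) =
      z i (Ω.inChart q (extChartAt (𝓡 d) q p)) := by
    intro i p hp
    rw [inChart_extChartAt _ hp, hZv, Multivector.map_map, chartD_comp_chartDSymm' hp,
      Multivector.map_id]
  refine ⟨U, hU, ⟨hq, hqO⟩, r, Z, fun i => mem_kerm_iff.2 ⟨?_, ?_⟩, fun X hX => ?_⟩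
  · refine isSmoothOn_of_exists_chart fun p hp => ⟨q, hp.1, ?_⟩
    have h1 : ContDiffAt ℝ ∞ (fun y => z i (Ω.inChart q y)) (extChartAt (𝓡 d) q p) :=
      ((hz i).contDiffAt (hO.mem_nhds hp.2)).comp _ (hsmooth p hp.1)
    refine h1.congr_of_eventuallyEq ?_
    filter_upwards [extChartAt_target_mem_nhds' ((extChartAt (𝓡 d) q).map_source hp.1)] with y hy
    have := hZc i _ ((extChartAt (𝓡 d) q).map_target hy)
    rwa [(extChartAt (𝓡 d) q).right_inv hy] at this
  · intro p hp
    rw [← contraction_inChart_eq_zero_iff (Z i) Ω hp.1, hZc i p hp.1]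
    exact hz0 i _ hp.2
  · refine ⟨fun i p => c i (X.inChart q (extChartAt (𝓡 d) q p)), fun i p hp => ?_, fun p hp => ?_⟩
    · have h1 := contDiffAt_linearMap_comp (W := Multivector (EuclideanSpace ℝ (Fin d)) m) (c i)
        (hX.1.contDiffAt hU hp.1 hp)
      have h2 : ContMDiffAt (𝓡 d) 𝓘(ℝ, EuclideanSpace ℝ (Fin d)) ∞ (extChartAt (𝓡 d) q) p :=
        contMDiffAt_extChartAt' (by rw [← extChartAt_source (𝓡 d)]; exact hp.1)
      exact ((contMDiffAt_iff_contDiffAt.2 h1).comp p h2).contMDiffWithinAt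
    · have h1 := hc _ hp.2 _ ((contraction_inChart_eq_zero_iff X Ω hp.1).2
        ((mem_kerm_iff.1 hX).2 p hp))
      have h2 := val_eq_map_inChart X hp.1
      have h3 := congrArg
        (Multivector.mapₗ (chartDSymm q (extChartAt (𝓡 d) q p)) (m := m)) h1
      rw [map_sum] at h3
      simp only [map_smul, Multivector.mapₗ_apply] at h3
      exact h2.trans h3

end Nondegenerate

/-! ### Existence of local flows by diffeomorphisms -/

section ExistsLocalFlow

open Set Topology

/-- Multiplication by a bump function gives compact support, hence a global Lipschitz constant, as
`exists_smooth_flow` requires. -/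
theorem exists_lipschitz_cutoff {E : Type*} [NormedAddCommGroup E] [InnerProductSpace ℝ E]
    [FiniteDimensional ℝ E] {V : E → E} {O : Set E} (hO : IsOpen O) (hV : ContDiffOn ℝ ∞ V O)
    {y₀ : E} (hy₀ : y₀ ∈ O) :
    ∃ V' : E → E, ContDiff ℝ ∞ V' ∧ (∃ K, LipschitzWith K V') ∧
      ∃ ρ > 0, Metric.ball y₀ ρ ⊆ O ∧ EqOn V' V (Metric.ball y₀ ρ) := by
  obtain ⟨ε, hε, hεO⟩ := Metric.isOpen_iff.1 hO y₀ hy₀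
  let f : ContDiffBump y₀ := ⟨ε / 4, ε / 2, by positivity, by linarith⟩
  have hfO : tsupport f ⊆ O := by
    rw [f.tsupport_eq]
    exact (Metric.closedBall_subset_ball (by simp only [f]; linarith)).trans hεO
  have hc : ContDiff ℝ ∞ (fun y => f y • V y) := by
    refine contDiff_iff_contDiffAt.2 fun y => ?_
    by_cases hy : y ∈ tsupport f
    · exact f.contDiffAt.smul (hV.contDiffAt (hO.mem_nhds (hfO hy)))
    · refine (contDiffAt_const (c := (0 : E))).congr_of_eventuallyEq ?_
      filter_upwards [(isClosed_tsupport f).isOpen_compl.mem_nhds hy] with s hs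
      rw [image_eq_zero_of_notMem_tsupport hs, zero_smul]
  refine ⟨_, hc, ?_, ε / 4, by positivity,
    (Metric.ball_subset_ball (by linarith)).trans hεO, fun y hy => ?_⟩
  · exact ContDiff.lipschitzWith_of_hasCompactSupport f.hasCompactSupport.smul_right hc (by simp)
  · change f y • V y = V y
    rw [f.one_of_mem_closedBall (Metric.ball_subset_closedBall hy), one_smul]

/-- A smooth vector field on an open set generates a local flow by diffeomorphisms. -/
theorem exists_flow_openPartialHomeomorph {E : Type*} [NormedAddCommGroup E]
    [InnerProductSpace ℝ E] [FiniteDimensional ℝ E] {V : E → E} {O : Set E} (hO : IsOpen O)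
    (hV : ContDiffOn ℝ ∞ V O) {y₀ : E} (hy₀ : y₀ ∈ O) :
    ∃ T > 0, ∃ B : Set E, IsOpen B ∧ y₀ ∈ B ∧ B ⊆ O ∧ ∃ G : ℝ → OpenPartialHomeomorph E E,
      (∀ t ∈ Ioo (-T) T, (G t).source = B ∧ (G t).target ⊆ O ∧ ContDiffOn ℝ ∞ (G t) (G t).source ∧
        ContDiffOn ℝ ∞ (G t).symm (G t).target) ∧
      ContDiffOn ℝ ∞ (fun z : ℝ × E => G z.1 z.2) (Ioo (-T) T ×ˢ B) ∧
      (∀ y ∈ B, G 0 y = y) ∧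
      ∀ y ∈ B, ∀ t ∈ Ioo (-T) T, HasDerivAt (fun s => G s y) (V (G t y)) t := by
  obtain ⟨V', hV', ⟨K, hK⟩, ρ, hρ, hρO, hVV'⟩ := exists_lipschitz_cutoff hO hV hy₀
  obtain ⟨T₀, hT₀, r, hr, Φ, hΦ, hΦ0, hΦd⟩ := exists_smooth_flow hV' hK y₀
  -- On `W` the flow `Φ` is defined and the cut-off field is still `V`. The smaller ball `B` and
  -- time `T` below are chosen so that `Φ t` maps `B` into `W`, where `Φ (-t)` can be applied again.
  let W := Metric.ball y₀ (min ρ r)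
  have hW : IsOpen W := Metric.isOpen_ball
  have hy₀W : y₀ ∈ W := Metric.mem_ball_self (lt_min hρ hr)
  have hWr : W ⊆ Metric.ball y₀ r := Metric.ball_subset_ball (min_le_right _ _)
  have hWρ : W ⊆ Metric.ball y₀ ρ := Metric.ball_subset_ball (min_le_left _ _)
  have hDom : IsOpen (Ioo (-T₀) T₀ ×ˢ Metric.ball y₀ r) := isOpen_Ioo.prod Metric.isOpen_ball
  have h0T₀ : (0 : ℝ) ∈ Ioo (-T₀) T₀ := ⟨by linarith, hT₀⟩
  have hc : ContinuousAt (fun z : ℝ × E => Φ z.1 z.2) (0, y₀) :=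
    (hΦ.contDiffAt (hDom.mem_nhds ⟨h0T₀, Metric.mem_ball_self hr⟩)).continuousAt
  have hn : (fun z : ℝ × E => Φ z.1 z.2) ⁻¹' W ∈ 𝓝 ((0 : ℝ), y₀) :=
    hc.preimage_mem_nhds (by
      change W ∈ 𝓝 (Φ 0 y₀)
      rw [hΦ0 y₀ (Metric.mem_ball_self hr)]
      exact hW.mem_nhds hy₀W)
  rw [nhds_prod_eq, (Metric.nhds_basis_ball.prod Metric.nhds_basis_ball).mem_iff] at hn
  obtain ⟨⟨T₁, r₁⟩, ⟨hT₁, hr₁⟩, hTr⟩ := hn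
  simp only at hT₁ hr₁ hTr
  let T := min T₀ T₁
  let B := Metric.ball y₀ (min r₁ (min ρ r))
  have hBW : B ⊆ W := Metric.ball_subset_ball (min_le_right _ _)
  have hT : 0 < T := lt_min hT₀ hT₁
  have hTT₀ : ∀ t ∈ Ioo (-T) T, t ∈ Ioo (-T₀) T₀ := fun t ht =>
    ⟨by linarith [ht.1, min_le_left T₀ T₁], ht.2.trans_le (min_le_left _ _)⟩
  have hmaps : ∀ t ∈ Ioo (-T) T, ∀ y ∈ B, Φ t y ∈ W := by
    intro t ht y hy
    refine hTr (a := (t, y)) ⟨?_, Metric.ball_subset_ball (min_le_left _ _) hy⟩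
    rw [mem_ball_zero_iff, Real.norm_eq_abs, abs_lt]
    exact ⟨by linarith [ht.1, min_le_right T₀ T₁], ht.2.trans_le (min_le_right _ _)⟩
  have hneg : ∀ t ∈ Ioo (-T) T, -t ∈ Ioo (-T) T := fun t ht =>
    ⟨by linarith [ht.2], by linarith [ht.1]⟩
  have hsm : ∀ t ∈ Ioo (-T) T, ContDiffOn ℝ ∞ (Φ t) W := by
    intro t ht
    have h1 : ContDiffOn ℝ ∞ (fun y : E => (t, y)) W := (contDiff_prodMk_right t).contDiffOn
    exact hΦ.comp h1 fun y hy => ⟨hTT₀ t ht, hWr hy⟩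
  have hex : ∀ t ∈ Ioo (-T) T, ∃ G : OpenPartialHomeomorph E E, ⇑G = Φ t ∧ G.source = B ∧
      G.target ⊆ O ∧ ContDiffOn ℝ ∞ G G.source ∧ ContDiffOn ℝ ∞ G.symm G.target := by
    intro t ht
    have htn := hneg t ht
    have hinv : ∀ y ∈ B, Φ (-t) (Φ t y) = y := fun y hy =>
      flow_neg_flow hK hΦ0 hΦd (hWr (hBW hy)) (hTT₀ t ht) (hWr (hmaps t ht y hy))
    let G : OpenPartialHomeomorph E E :=
      { toFun := Φ t
        invFun := Φ (-t)
        source := B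
        -- This is the image of `B` under `Φ t`, written as a preimage so that its openness follows
        -- from continuity of `Φ (-t)`.
        target := W ∩ Φ (-t) ⁻¹' B
        map_source' := fun y hy => ⟨hmaps t ht y hy, by
          change Φ (-t) (Φ t y) ∈ B
          rwa [hinv y hy]⟩
        map_target' := fun z hz => hz.2
        left_inv' := hinv
        right_inv' := fun z hz => by
          have := flow_neg_flow hK hΦ0 hΦd (hWr hz.1) (hTT₀ _ htn) (hWr (hBW hz.2))
          rwa [neg_neg] at this
        open_source := Metric.isOpen_ball
        open_target := (hsm _ htn).continuousOn.isOpen_inter_preimage hW Metric.isOpen_ball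
        continuousOn_toFun := ((hsm t ht).mono hBW).continuousOn
        continuousOn_invFun := ((hsm _ htn).mono inter_subset_left).continuousOn }
    exact ⟨G, rfl, rfl, fun z hz => hρO (hWρ hz.1), (hsm t ht).mono hBW,
      (hsm _ htn).mono inter_subset_left⟩
  have : Nonempty (OpenPartialHomeomorph E E) := ⟨OpenPartialHomeomorph.refl E⟩
  choose! G hGΦ hGs hGt hGc hGc' using hex
  refine ⟨T, hT, B, Metric.isOpen_ball, Metric.mem_ball_self (by positivity),
    fun y hy => hρO (hWρ (hBW hy)), G,
    fun t ht => ⟨hGs t ht, hGt t ht, hGc t ht, hGc' t ht⟩, ?_, fun y hy => ?_, fun y hy t ht => ?_⟩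
  · refine (hΦ.mono (prod_mono hTT₀ (hBW.trans hWr))).congr fun z hz => ?_
    rw [hGΦ _ hz.1]
  · rw [hGΦ 0 ⟨by linarith, hT⟩, hΦ0 y (hWr (hBW hy))]
  · rw [hGΦ t ht, ← hVV' (hWρ (hmaps t ht y hy))]
    refine (hΦd y (hWr (hBW hy)) t (hTT₀ t ht)).congr_of_eventuallyEq ?_
    filter_upwards [isOpen_Ioo.mem_nhds ht] with s hs
    rw [hGΦ s hs]

variable {d m : ℕ} {N : Type*} [TopologicalSpace N] [ChartedSpace (EuclideanSpace ℝ (Fin d)) N]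
  [IsManifold (𝓡 d) ∞ N]

/-- Conjugation of a local homeomorphism of the model space by a chart. -/
def conjChart (p₀ : N) (G : OpenPartialHomeomorph (EuclideanSpace ℝ (Fin d))
    (EuclideanSpace ℝ (Fin d))) : OpenPartialHomeomorph N N :=
  ((chartAt (EuclideanSpace ℝ (Fin d)) p₀).trans G).trans (chartAt (EuclideanSpace ℝ (Fin d)) p₀).symm

omit [IsManifold (𝓡 d) ∞ N] in
theorem conjChart_apply (p₀ : N) (G : OpenPartialHomeomorph (EuclideanSpace ℝ (Fin d))
    (EuclideanSpace ℝ (Fin d))) (p : N) :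
    conjChart p₀ G p = (extChartAt (𝓡 d) p₀).symm (G (extChartAt (𝓡 d) p₀ p)) := rfl

omit [IsManifold (𝓡 d) ∞ N] in
theorem conjChart_symm (p₀ : N) (G : OpenPartialHomeomorph (EuclideanSpace ℝ (Fin d))
    (EuclideanSpace ℝ (Fin d))) : (conjChart p₀ G).symm = conjChart p₀ G.symm := by
  unfold conjChart
  rw [OpenPartialHomeomorph.trans_symm_eq_symm_trans_symm,
    OpenPartialHomeomorph.trans_symm_eq_symm_trans_symm, OpenPartialHomeomorph.symm_symm,
    OpenPartialHomeomorph.trans_assoc]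

omit [IsManifold (𝓡 d) ∞ N] in
theorem mem_conjChart_source {p₀ p : N} {G : OpenPartialHomeomorph (EuclideanSpace ℝ (Fin d))
    (EuclideanSpace ℝ (Fin d))} : p ∈ (conjChart p₀ G).source ↔
      p ∈ (extChartAt (𝓡 d) p₀).source ∧ extChartAt (𝓡 d) p₀ p ∈ G.source ∧
        G (extChartAt (𝓡 d) p₀ p) ∈ (extChartAt (𝓡 d) p₀).target := by
  simp [conjChart, and_assoc]

theorem contMDiffOn_conjChart {p₀ : N} {G : OpenPartialHomeomorph (EuclideanSpace ℝ (Fin d))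
    (EuclideanSpace ℝ (Fin d))} (hG : ContDiffOn ℝ ∞ G G.source) :
    ContMDiffOn (𝓡 d) (𝓡 d) ∞ (conjChart p₀ G) (conjChart p₀ G).source := by
  have h1 : ContMDiffOn (𝓡 d) (𝓡 d) ∞ (extChartAt (𝓡 d) p₀) (conjChart p₀ G).source :=
    contMDiffOn_chart.mono fun p hp => by
      have := (mem_conjChart_source.1 hp).1
      rwa [extChartAt_source] at this
  have h2 : ContMDiffOn (𝓡 d) (𝓡 d) ∞ (fun p => G (extChartAt (𝓡 d) p₀ p))
      (conjChart p₀ G).source :=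
    (contMDiffOn_iff_contDiffOn.2 hG).comp h1 fun p hp => (mem_conjChart_source.1 hp).2.1
  exact (contMDiffOn_extChartAt_symm p₀).comp h2 fun p hp => (mem_conjChart_source.1 hp).2.2

theorem isLocalDiffeo_conjChart {p₀ : N} {G : OpenPartialHomeomorph (EuclideanSpace ℝ (Fin d))
    (EuclideanSpace ℝ (Fin d))} (hG : ContDiffOn ℝ ∞ G G.source)
    (hG' : ContDiffOn ℝ ∞ G.symm G.target) : IsLocalDiffeo d (conjChart p₀ G) := by
  refine ⟨contMDiffOn_conjChart hG, ?_⟩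
  rw [← OpenPartialHomeomorph.symm_source, conjChart_symm]
  exact contMDiffOn_conjChart hG'

/-- Every point lies in the domain of a local flow. -/
theorem exists_localFlow [IsManifold (𝓡 d) 1 N] {Y : VField d N} (hY : Y.IsSmooth) (p₀ : N) :
    ∃ φ : LocalFlow Y, p₀ ∈ φ.dom := by
  have hV : ContDiffOn ℝ ∞ (Y.inChart p₀) (extChartAt (𝓡 d) p₀).target := fun y hy => by
    have := hY.contDiffAt_inChart ((extChartAt (𝓡 d) p₀).map_target hy)
    rw [(extChartAt (𝓡 d) p₀).right_inv hy] at this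
    exact this.contDiffWithinAt
  obtain ⟨T, hT, B, hB, hpB, hBt, G, hG, hGs, hG0, hGd⟩ :=
    exists_flow_openPartialHomeomorph (isOpen_extChartAt_target p₀) hV (mem_extChartAt_target p₀)
  have hmaps : ∀ t ∈ Ioo (-T) T, ∀ y ∈ B, G t y ∈ (extChartAt (𝓡 d) p₀).target := by
    intro t ht y hy
    obtain ⟨h1, h2, -, -⟩ := hG t ht
    exact h2 ((G t).map_source (by rwa [h1]))
  let U : Set N := (extChartAt (𝓡 d) p₀).source ∩ extChartAt (𝓡 d) p₀ ⁻¹' B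
  have hU : IsOpen U := isOpen_extChartAt_preimage' p₀ hB
  refine ⟨{ dom := U
            isOpen_dom := hU
            a := -T
            b := T
            a_neg := neg_lt_zero.2 hT
            b_pos := hT
            F := fun t => conjChart p₀ (G t)
            source_eq := ?_
            isLocalDiffeo := fun t ht => isLocalDiffeo_conjChart (hG t ht).2.2.1 (hG t ht).2.2.2
            smooth := ?_
            map_zero := ?_
            integralCurve := ?_ }, mem_extChartAt_source p₀, hpB⟩
  · intro t ht
    ext p
    rw [mem_conjChart_source, (hG t ht).1]
    exact ⟨fun h => ⟨h.1, h.2.1⟩, fun h => ⟨h.1, h.2, hmaps t ht _ h.2⟩⟩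
  · have h1 : ContMDiffOn (𝓘(ℝ, ℝ).prod (𝓡 d)) 𝓘(ℝ, EuclideanSpace ℝ (Fin d)) ∞
        (fun z : ℝ × N => extChartAt (𝓡 d) p₀ z.2) (Ioo (-T) T ×ˢ U) := by
      refine (contMDiffOn_extChartAt (n := ∞) (x := p₀)).comp contMDiff_snd.contMDiffOn
        fun z hz => ?_
      have := hz.2.1
      rwa [extChartAt_source] at this
    have h2 : ContMDiffOn (𝓘(ℝ, ℝ).prod (𝓡 d)) 𝓘(ℝ, ℝ × EuclideanSpace ℝ (Fin d)) ∞
        (fun z : ℝ × N => (z.1, extChartAt (𝓡 d) p₀ z.2)) (Ioo (-T) T ×ˢ U) :=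
      fun z hz => (contMDiff_fst.contMDiffOn z hz).prodMk_space (h1 z hz)
    have h3 : ContMDiffOn (𝓘(ℝ, ℝ).prod (𝓡 d)) 𝓘(ℝ, EuclideanSpace ℝ (Fin d)) ∞
        (fun z : ℝ × N => G z.1 (extChartAt (𝓡 d) p₀ z.2)) (Ioo (-T) T ×ˢ U) :=
      (contMDiffOn_iff_contDiffOn.2 hGs).comp h2 fun z hz => ⟨hz.1, hz.2.2⟩
    exact (contMDiffOn_extChartAt_symm p₀).comp h3 fun z hz => hmaps _ hz.1 _ hz.2.2
  · intro p hp
    rw [conjChart_apply, hG0 _ hp.2, (extChartAt (𝓡 d) p₀).left_inv hp.1]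
  · intro p hp t ht
    refine HasMFDerivAt.hasMFDerivWithinAt ?_
    have hy := hmaps t ht _ hp.2
    have h1 := hasMFDerivAt_chart_symm hy
    have h2 := (hasMFDerivAt_iff_hasFDerivAt).2 (hGd _ hp.2 t ht).hasFDerivAt
    have h3 := h1.comp (f := fun s => G s (extChartAt (𝓡 d) p₀ p)) t h2
    have h4 := congrArg (fun A => A (Y.val (conjChart p₀ (G t) p))) (chartDSymm_comp_chartD hy)
    have h5 : (chartDSymm p₀ (G t (extChartAt (𝓡 d) p₀ p))).comp (ContinuousLinearMap.toSpanSingleton ℝ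
        (Y.inChart p₀ (G t (extChartAt (𝓡 d) p₀ p)))) =
        (1 : ℝ →L[ℝ] ℝ).smulRight (Y.val (conjChart p₀ (G t) p)) := by
      refine ContinuousLinearMap.ext_ring ?_
      simpa [vfield_inChart_eq_val] using! h4
    exact HasMFDerivAt.congr_mfderiv h3 h5

end ExistsLocalFlow

/-! ### Differentiating a flow; the bracket with a symmetry preserves the kernel -/

section FlowInCharts

open Set Topology

/-- The variational equation of a flow. -/
theorem hasDerivAt_fderiv_flow {E F : Type*} [NormedAddCommGroup E] [NormedSpace ℝ E]
    [NormedAddCommGroup F] [NormedSpace ℝ F] {g : ℝ → E → F} {V : F → F} {t : ℝ} {y : E}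
    (hg : ContDiffAt ℝ 2 (fun z : ℝ × E => g z.1 z.2) (t, y))
    (hV : DifferentiableAt ℝ V (g t y))
    (hgV : ∀ᶠ x in 𝓝 y, HasDerivAt (fun s => g s x) (V (g t x)) t) :
    HasDerivAt (fun s => fderiv ℝ (g s) y) ((fderiv ℝ V (g t y)).comp (fderiv ℝ (g t) y)) t := by
  let f : ℝ × E → F := fun z => g z.1 z.2
  have hf : ContDiffAt ℝ 2 f (t, y) := hg
  have hdiff : ∀ᶠ z in 𝓝 (t, y), DifferentiableAt ℝ f z := by
    filter_upwards [hf.eventually (by simp)] with z hz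
    exact hz.differentiableAt (by simp)
  have hpart : ∀ z : ℝ × E, DifferentiableAt ℝ f z →
      HasFDerivAt (g z.1) ((fderiv ℝ f z).comp (ContinuousLinearMap.inr ℝ ℝ E)) z.2 := by
    intro z hz
    exact HasFDerivAt.comp (f := fun x : E => (z.1, x)) z.2 hz.hasFDerivAt
      (hasFDerivAt_prodMk_right z.1 z.2)
  have htime : ∀ z : ℝ × E, DifferentiableAt ℝ f z →
      HasDerivAt (fun s => g s z.2) (fderiv ℝ f z (1, 0)) z.1 := by
    intro z hz
    have := HasFDerivAt.comp (f := fun s : ℝ => (s, z.2)) z.1 hz.hasFDerivAt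
      (hasFDerivAt_prodMk_left z.1 z.2)
    simpa using! this.hasDerivAt
  have hD : DifferentiableAt ℝ (fderiv ℝ f) (t, y) :=
    (hf.fderiv_right (m := 1) (by norm_num)).differentiableAt (by simp)
  have hct : Filter.Tendsto (fun s : ℝ => (s, y)) (𝓝 t) (𝓝 (t, y)) :=
    (Continuous.prodMk_left y).tendsto t
  have hcy : Filter.Tendsto (fun x : E => (t, x)) (𝓝 y) (𝓝 (t, y)) :=
    (Continuous.prodMk_right t).tendsto y
  have h1 : HasDerivAt (fun s => (fderiv ℝ f (s, y)).comp (ContinuousLinearMap.inr ℝ ℝ E))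
      ((fderiv ℝ (fderiv ℝ f) (t, y) (1, 0)).comp (ContinuousLinearMap.inr ℝ ℝ E)) t := by
    have h2 : HasDerivAt (fun s : ℝ => (s, y)) ((1 : ℝ), (0 : E)) t :=
      (hasDerivAt_id t).prodMk (hasDerivAt_const t y)
    have h3 := fderiv_comp_hasDerivAt (f := fderiv ℝ f) (c := fun s : ℝ => (s, y)) hD h2
    simpa using h3.clm_comp (hasDerivAt_const t (ContinuousLinearMap.inr ℝ ℝ E))
  -- Time and space derivatives commute, so the time derivative of Dg_t is the space derivative of
  -- the velocity V ∘ g_t.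
  have h2 : (fderiv ℝ (fderiv ℝ f) (t, y) (1, 0)).comp (ContinuousLinearMap.inr ℝ ℝ E) =
      (fderiv ℝ V (g t y)).comp (fderiv ℝ (g t) y) := by
    have hs : IsSymmSndFDerivAt ℝ f (t, y) := hf.isSymmSndFDerivAt (by simp)
    have h3 : HasFDerivAt (fun x => fderiv ℝ f (t, x) (1, 0))
        ((ContinuousLinearMap.apply ℝ F ((1 : ℝ), (0 : E))).comp
          ((fderiv ℝ (fderiv ℝ f) (t, y)).comp (ContinuousLinearMap.inr ℝ ℝ E))) y :=
      (ContinuousLinearMap.apply ℝ F ((1 : ℝ), (0 : E))).hasFDerivAt.comp y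
        (HasFDerivAt.comp (f := fun x : E => (t, x)) y hD.hasFDerivAt
          (hasFDerivAt_prodMk_right t y))
    have h4 : HasFDerivAt (fun x => V (g t x)) ((fderiv ℝ V (g t y)).comp (fderiv ℝ (g t) y)) y :=
      hV.hasFDerivAt.comp y (hpart (t, y) hdiff.self_of_nhds).differentiableAt.hasFDerivAt
    have h5 : (fun x => V (g t x)) =ᶠ[𝓝 y] fun x => fderiv ℝ f (t, x) (1, 0) := by
      filter_upwards [hgV, hcy.eventually hdiff] with x hx hx'
      exact hx.unique (htime (t, x) hx')
    rw [← (h3.congr_of_eventuallyEq h5).unique h4]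
    ext v
    exact hs (1, 0) (0, v)
  rw [← h2]
  refine h1.congr_of_eventuallyEq ?_
  filter_upwards [hct.eventually hdiff] with s hs
  exact (hpart (s, y) hs).fderiv

variable {d m : ℕ} {N : Type*} [TopologicalSpace N] [ChartedSpace (EuclideanSpace ℝ (Fin d)) N]
  [IsManifold (𝓡 d) ∞ N]

variable {Y : VField d N} (φ : LocalFlow Y)

omit [IsManifold (𝓡 d) ∞ N] in
theorem LocalFlow.mem_source {t : ℝ} (ht : t ∈ Ioo φ.a φ.b) {p : N} (hp : p ∈ φ.dom) :
    p ∈ (φ.F t).source := by rwa [φ.source_eq t ht]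

omit [IsManifold (𝓡 d) ∞ N] in
theorem LocalFlow.zero_mem : (0 : ℝ) ∈ Ioo φ.a φ.b := ⟨φ.a_neg, φ.b_pos⟩

omit [IsManifold (𝓡 d) ∞ N] in
theorem LocalFlow.contMDiffAt_uncurry {t : ℝ} (ht : t ∈ Ioo φ.a φ.b) {p : N} (hp : p ∈ φ.dom) :
    ContMDiffAt (𝓘(ℝ, ℝ).prod (𝓡 d)) (𝓡 d) ∞ (fun z : ℝ × N => φ.F z.1 z.2) (t, p) :=
  φ.smooth.contMDiffAt ((isOpen_Ioo.prod φ.isOpen_dom).mem_nhds ⟨ht, hp⟩)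

omit [IsManifold (𝓡 d) ∞ N] in
theorem LocalFlow.continuousAt_time {t : ℝ} (ht : t ∈ Ioo φ.a φ.b) {p : N} (hp : p ∈ φ.dom) :
    ContinuousAt (fun s => φ.F s p) t :=
  ContinuousAt.comp (g := fun z : ℝ × N => φ.F z.1 z.2) (f := fun s : ℝ => (s, p))
    (φ.contMDiffAt_uncurry ht hp).continuousAt (Continuous.prodMk_left p).continuousAt

theorem LocalFlow.contDiffAt_mapInChart {t : ℝ} (ht : t ∈ Ioo φ.a φ.b) {x₀ x₁ p : N}
    (hp : p ∈ φ.dom) (hp₁ : p ∈ (extChartAt (𝓡 d) x₁).source)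
    (hp₀ : φ.F t p ∈ (extChartAt (𝓡 d) x₀).source) :
    ContDiffAt ℝ ∞ (fun z : ℝ × EuclideanSpace ℝ (Fin d) => mapInChart d x₀ x₁ (φ.F z.1) z.2)
      (t, extChartAt (𝓡 d) x₁ p) := by
  have hl := (extChartAt (𝓡 d) x₁).left_inv hp₁
  have h1 : ContMDiffAt 𝓘(ℝ, EuclideanSpace ℝ (Fin d)) (𝓡 d) ∞ (extChartAt (𝓡 d) x₁).symm
      (extChartAt (𝓡 d) x₁ p) :=
    (contMDiffOn_extChartAt_symm x₁).contMDiffAt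
      (extChartAt_target_mem_nhds' ((extChartAt (𝓡 d) x₁).map_source hp₁))
  have hfst : ContMDiffAt 𝓘(ℝ, ℝ × EuclideanSpace ℝ (Fin d)) 𝓘(ℝ, ℝ) ∞
      (fun z : ℝ × EuclideanSpace ℝ (Fin d) => z.1) (t, extChartAt (𝓡 d) x₁ p) :=
    contDiff_fst.contMDiff.contMDiffAt
  have hsnd : ContMDiffAt 𝓘(ℝ, ℝ × EuclideanSpace ℝ (Fin d)) 𝓘(ℝ, EuclideanSpace ℝ (Fin d)) ∞
      (fun z : ℝ × EuclideanSpace ℝ (Fin d) => z.2) (t, extChartAt (𝓡 d) x₁ p) :=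
    contDiff_snd.contMDiff.contMDiffAt
  have h2 := hfst.prodMk (ContMDiffAt.comp (f := fun z : ℝ × EuclideanSpace ℝ (Fin d) => z.2)
    (t, extChartAt (𝓡 d) x₁ p) h1 hsnd)
  have h3 := φ.contMDiffAt_uncurry ht hp
  rw [← hl] at h3
  have h4 := h3.comp (f := fun z : ℝ × EuclideanSpace ℝ (Fin d) =>
    (z.1, ((extChartAt (𝓡 d) x₁).symm ∘ fun z : ℝ × EuclideanSpace ℝ (Fin d) => z.2) z)) _ h2
  have h5 : ContMDiffAt (𝓡 d) 𝓘(ℝ, EuclideanSpace ℝ (Fin d)) ∞ (extChartAt (𝓡 d) x₀)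
      (φ.F t ((extChartAt (𝓡 d) x₁).symm (extChartAt (𝓡 d) x₁ p))) := by
    rw [hl]
    exact contMDiffAt_extChartAt' (by rwa [← extChartAt_source (𝓡 d)])
  have h6 := h5.comp (f := fun z : ℝ × EuclideanSpace ℝ (Fin d) =>
    φ.F z.1 ((extChartAt (𝓡 d) x₁).symm z.2)) (t, extChartAt (𝓡 d) x₁ p) h4
  exact contMDiffAt_iff_contDiffAt.1 h6

theorem LocalFlow.hasDerivAt_chart {t : ℝ} (ht : t ∈ Ioo φ.a φ.b) {x₀ p : N}
    (hp : p ∈ φ.dom) (hp₀ : φ.F t p ∈ (extChartAt (𝓡 d) x₀).source) :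
    HasDerivAt (fun s => extChartAt (𝓡 d) x₀ (φ.F s p))
      (Y.inChart x₀ (extChartAt (𝓡 d) x₀ (φ.F t p))) t := by
  have h1 : HasMFDerivAt 𝓘(ℝ, ℝ) (𝓡 d) (fun s => φ.F s p) t
      (ContinuousLinearMap.toSpanSingleton ℝ (Y.val (φ.F t p)) :
        ℝ →L[ℝ] EuclideanSpace ℝ (Fin d)) := by
    refine ((φ.integralCurve p hp t ht).hasMFDerivAt (isOpen_Ioo.mem_nhds ht)).congr_mfderiv ?_
    refine ContinuousLinearMap.ext fun s => ?_
    change s • Y.val (φ.F t p) = s • Y.val (φ.F t p)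
    rfl
  have h2 := (hasMFDerivAt_chart hp₀).comp (f := fun s => φ.F s p) t h1
  have h3 : HasFDerivAt (fun s => extChartAt (𝓡 d) x₀ (φ.F s p))
      ((chartD d x₀ (φ.F t p)).comp (ContinuousLinearMap.toSpanSingleton ℝ (Y.val (φ.F t p)))) t :=
    hasMFDerivAt_iff_hasFDerivAt.1 h2
  rw [vfield_inChart_extChartAt Y hp₀]
  simpa using h3.hasDerivAt

theorem LocalFlow.hasDerivAt_fderiv [IsManifold (𝓡 d) 1 N] (hY : Y.IsSmooth) {t : ℝ}
    (ht : t ∈ Ioo φ.a φ.b) {x₀ x₁ p : N}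
    (hp : p ∈ φ.dom) (hp₁ : p ∈ (extChartAt (𝓡 d) x₁).source)
    (hp₀ : φ.F t p ∈ (extChartAt (𝓡 d) x₀).source) :
    HasDerivAt (fun s => fderiv ℝ (mapInChart d x₀ x₁ (φ.F s)) (extChartAt (𝓡 d) x₁ p))
      ((fderiv ℝ (Y.inChart x₀) (extChartAt (𝓡 d) x₀ (φ.F t p))).comp
        (fderiv ℝ (mapInChart d x₀ x₁ (φ.F t)) (extChartAt (𝓡 d) x₁ p))) t := by
  have hl := (extChartAt (𝓡 d) x₁).left_inv hp₁
  have hv : mapInChart d x₀ x₁ (φ.F t) (extChartAt (𝓡 d) x₁ p) =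
      extChartAt (𝓡 d) x₀ (φ.F t p) := by
    unfold mapInChart; rw [hl]
  have h := hasDerivAt_fderiv_flow (g := fun s => mapInChart d x₀ x₁ (φ.F s))
    (V := Y.inChart x₀) (t := t) (y := extChartAt (𝓡 d) x₁ p)
    ((φ.contDiffAt_mapInChart ht hp hp₁ hp₀).of_le (WithTop.coe_le_coe.2 le_top))
    (by rw [hv]; exact (hY.contDiffAt_inChart hp₀).differentiableAt (by simp)) ?_
  · rwa [hv] at h
  · have hcs : ContinuousAt (extChartAt (𝓡 d) x₁).symm (extChartAt (𝓡 d) x₁ p) :=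
      continuousAt_extChartAt_symm' hp₁
    have e1 : ∀ᶠ y in 𝓝 (extChartAt (𝓡 d) x₁ p), (extChartAt (𝓡 d) x₁).symm y ∈ φ.dom :=
      hcs.eventually_mem (by rw [hl]; exact φ.isOpen_dom.mem_nhds hp)
    have e2 : ∀ᶠ y in 𝓝 (extChartAt (𝓡 d) x₁ p),
        φ.F t ((extChartAt (𝓡 d) x₁).symm y) ∈ (extChartAt (𝓡 d) x₀).source := by
      have : ContinuousAt (fun y => φ.F t ((extChartAt (𝓡 d) x₁).symm y))
          (extChartAt (𝓡 d) x₁ p) :=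
        ContinuousAt.comp (by rw [hl]; exact (φ.F t).continuousAt (φ.mem_source ht hp)) hcs
      refine this.eventually_mem ?_
      rw [hl]
      exact (isOpen_extChartAt_source x₀).mem_nhds hp₀
    filter_upwards [e1, e2] with y h1 h2
    exact φ.hasDerivAt_chart ht h1 h2

theorem LocalFlow.fderiv_mapInChart {t : ℝ} (ht : t ∈ Ioo φ.a φ.b) {x₀ x₁ p : N}
    (hp : p ∈ φ.dom) (hp₁ : p ∈ (extChartAt (𝓡 d) x₁).source)
    (hp₀ : φ.F t p ∈ (extChartAt (𝓡 d) x₀).source) :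
    fderiv ℝ (mapInChart d x₀ x₁ (φ.F t)) (extChartAt (𝓡 d) x₁ p) =
      (chartD d x₀ (φ.F t p)).comp ((mapD d (φ.F t) p).comp
        (chartDSymm x₁ (extChartAt (𝓡 d) x₁ p))) :=
  (hasFDerivAt_mapInChart (Φ := φ.F t) hp₁ hp₀
    (((φ.isLocalDiffeo t ht).contMDiffAt (φ.mem_source ht hp)).mdifferentiableAt (by simp))).fderiv

omit [IsManifold (𝓡 d) ∞ N] in
theorem LocalFlow.mapD_zero {p : N} (hp : p ∈ φ.dom) :
    mapD d (φ.F 0) p = ContinuousLinearMap.id ℝ _ := by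
  have h : φ.F 0 =ᶠ[𝓝 p] id := by
    filter_upwards [φ.isOpen_dom.mem_nhds hp] with q hq
    exact φ.map_zero q hq
  have h1 : HasMFDerivAt (𝓡 d) (𝓡 d) (φ.F 0) p (ContinuousLinearMap.id ℝ _) :=
    (hasMFDerivAt_id p).congr_of_eventuallyEq h
  exact h1.mfderiv

/-- `β` stands for the contribution of the derivative of Ω along the flow, common to the two
differentiated identities. -/
theorem sub_eq_zero_of_contraction {X X' : Multivector (EuclideanSpace ℝ (Fin d)) m}
    {Ω : EuclideanSpace ℝ (Fin d) [⋀^Fin (m + 1)]→L[ℝ] ℝ} {β : EuclideanSpace ℝ (Fin d) →L[ℝ] ℝ}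
    (h : β + contraction X Ω = 0) (h' : β + contraction X' Ω = 0) :
    contraction (X - X') Ω = 0 := by
  have h1 : contraction X Ω = contraction X' Ω := add_left_cancel (h.trans h'.symm)
  have h2 : contraction (X - X' + X') Ω = contraction (X - X') Ω + contraction X' Ω :=
    contraction_add_left _ _ _
  have h3 : X - X' + X' = X := sub_add_cancel X X'
  rw [h3, h1] at h2
  exact right_eq_add.1 h2

/-- The bracket with an infinitesimal symmetry preserves `kerᵐ Ω`. -/
theorem IsInfinitesimalSymmetry.schoutenBracket_mem_kerm [IsManifold (𝓡 d) 1 N]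
    {Ω : DiffForm d N (m + 1)} (hΩ : Ω.IsSmooth) (hY : Y.IsSmooth)
    (hsymm : IsInfinitesimalSymmetry Ω Y) {X : MultivectorField d N m} (hX : X ∈ kerm Ω univ) :
    schoutenBracket Y X ∈ kerm Ω univ := by
  refine mem_kerm_iff.2 ⟨isSmoothOn_schoutenBracket hY isOpen_univ hX.1, fun p _ => ?_⟩
  obtain ⟨φ, hp⟩ := exists_localFlow hY p
  have hpp := mem_extChartAt_source (I := 𝓡 d) p
  have h0 := φ.zero_mem
  have hF0 : φ.F 0 p = p := φ.map_zero p hp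
  have hpp' : φ.F 0 p ∈ (extChartAt (𝓡 d) p).source := by rwa [hF0]
  rw [← contraction_inChart_eq_zero_iff _ Ω hpp,
    schoutenBracket_inChart hY isOpen_univ hX.1 hpp (mem_univ p)]
  have hc := φ.hasDerivAt_chart h0 hp hpp'
  have hA := φ.hasDerivAt_fderiv hY h0 hp hpp hpp'
  have hA0 : fderiv ℝ (mapInChart d p p (φ.F 0)) (extChartAt (𝓡 d) p p) =
      ContinuousLinearMap.id ℝ _ := by
    rw [φ.fderiv_mapInChart h0 hp hpp hpp', φ.mapD_zero hp, ContinuousLinearMap.id_comp, hF0]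
    exact chartD_comp_chartDSymm' hpp
  -- The first curve over F_t p: the fixed value of `X` at `p`, pushed forward by F_t. The second,
  -- `hX'` below, is `X` itself along the integral curve. The difference of their velocities, second
  -- minus first, is the bracket.
  have hw := HasDerivAt.multivectorMap_comp_left hA
    (hasDerivAt_const (0 : ℝ) (X.inChart p (extChartAt (𝓡 d) p p)))
  rw [hA0, Multivector.map_id, Multivector.map_id, zero_add, hF0] at hw
  have hΩd : DifferentiableAt ℝ (Ω.inChart p) (extChartAt (𝓡 d) p (φ.F 0 p)) := by
    rw [hF0]
    exact ((hΩ p).contDiffAt (extChartAt_target_mem_nhds p)).differentiableAt (by simp)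
  have hXd : DifferentiableAt ℝ (X.inChart p) (extChartAt (𝓡 d) p (φ.F 0 p)) := by
    rw [hF0]
    exact (hX.1.contDiffAt isOpen_univ hpp (mem_univ p)).differentiableAt (by simp)
  have hΩ' := fderiv_comp_hasDerivAt
    (F := EuclideanSpace ℝ (Fin d) [⋀^Fin (m + 1)]→L[ℝ] ℝ) hΩd hc
  have hX' := fderiv_comp_hasDerivAt
    (F := Multivector (EuclideanSpace ℝ (Fin d)) m) hXd hc
  have hnear : ∀ᶠ t in 𝓝 (0 : ℝ), t ∈ Ioo φ.a φ.b ∧ φ.F t p ∈ (extChartAt (𝓡 d) p).source :=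
    Filter.Eventually.and (isOpen_Ioo.mem_nhds h0)
      ((φ.continuousAt_time h0 hp).eventually_mem
        ((isOpen_extChartAt_source p).mem_nhds hpp'))
  have hz1 := hasDerivAt_contraction hw hΩ'
  have hz2 := hasDerivAt_contraction hX' hΩ'
  have e1 : (fun _ : ℝ => (0 : EuclideanSpace ℝ (Fin d) →L[ℝ] ℝ)) =ᶠ[𝓝 0] fun t => contraction
      (Multivector.map (fderiv ℝ (mapInChart d p p (φ.F t)) (extChartAt (𝓡 d) p p))
        (X.inChart p (extChartAt (𝓡 d) p p))) (Ω.inChart p (extChartAt (𝓡 d) p (φ.F t p))) := by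
    filter_upwards [hnear] with t ht
    have hps := φ.mem_source ht.1 hp
    rw [← pushforward_inChart_eq_map (φ.isLocalDiffeo t ht.1) X hps hpp ht.2, eq_comm,
      contraction_inChart_eq_zero_iff _ Ω ht.2]
    exact (mem_kerm_iff.1 ((hsymm φ t ht.1).2 X (kerm_mono (subset_univ _) hX))).2 _
      ((φ.F t).map_source hps)
  have e2 : (fun _ : ℝ => (0 : EuclideanSpace ℝ (Fin d) →L[ℝ] ℝ)) =ᶠ[𝓝 0] fun t => contraction
      (X.inChart p (extChartAt (𝓡 d) p (φ.F t p)))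
      (Ω.inChart p (extChartAt (𝓡 d) p (φ.F t p))) := by
    filter_upwards [hnear] with t ht
    rw [eq_comm, contraction_inChart_eq_zero_iff _ Ω ht.2]
    exact (mem_kerm_iff.1 hX).2 _ (mem_univ _)
  have d1 := (hz1.congr_of_eventuallyEq e1).unique (hasDerivAt_const (0 : ℝ) _)
  have d2 := (hz2.congr_of_eventuallyEq e2).unique (hasDerivAt_const (0 : ℝ) _)
  simp only [hA0, Multivector.map_id, hF0] at d1 d2
  exact sub_eq_zero_of_contraction d2 d1

end FlowInCharts

/-! ### Linear differential equations along the flow; the flow preserves the kernel -/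

section Preservation

open Set Topology

/-- A solution of a linear differential equation with bounded coefficients that vanishes at one
point vanishes identically. -/
theorem linear_ode_eq_zero {r : ℕ} {c : ℝ → Fin r → ℝ} {M : ℝ → Fin r → Fin r → ℝ} {C l h : ℝ}
    (hM : ∀ t ∈ Ioo l h, ∀ i j, |M t i j| ≤ C)
    (hc : ∀ t ∈ Ioo l h, ∀ i, HasDerivAt (fun s => c s i) (∑ j, M t i j * c t j) t)
    {t₁ : ℝ} (ht₁ : t₁ ∈ Ioo l h) (h0 : c t₁ = 0) {t : ℝ} (ht : t ∈ Ioo l h) : c t = 0 := by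
  let v : ℝ → (Fin r → ℝ) → Fin r → ℝ := fun t x i => ∑ j, M t i j * x j
  have hlip : ∀ t ∈ Ioo l h, LipschitzOnWith (Real.toNNReal (r * |C|)) (v t) univ := by
    intro t ht
    refine LipschitzWith.lipschitzOnWith (LipschitzWith.of_dist_le_mul fun x y => ?_)
    rw [Real.coe_toNNReal _ (by positivity)]
    refine (dist_pi_le_iff (by positivity)).2 fun i => ?_
    rw [Real.dist_eq, ← Finset.sum_sub_distrib]
    calc |∑ j, (M t i j * x j - M t i j * y j)| ≤ ∑ j : Fin r, |C| * dist x y := by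
          refine (Finset.abs_sum_le_sum_abs _ _).trans (Finset.sum_le_sum fun j _ => ?_)
          rw [← mul_sub, abs_mul]
          refine mul_le_mul ((hM t ht i j).trans (le_abs_self C)) ?_ (abs_nonneg _) (abs_nonneg _)
          rw [← Real.dist_eq]
          exact dist_le_pi_dist x y j
      _ = r * |C| * dist x y := by simp; ring
  exact ODE_solution_unique_of_mem_Ioo (v := v) (s := fun _ => univ) (f := c)
    (g := fun _ => 0) hlip ht₁
    (fun s hs => ⟨hasDerivAt_pi.2 (hc s hs), mem_univ _⟩)
    (fun s _ => ⟨by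
      have : v s 0 = 0 := by funext i; simp [v]
      simpa [this] using hasDerivAt_const s (0 : Fin r → ℝ), mem_univ _⟩) h0 ht

/-- The span of a solution of a linear system of differential equations is constant. -/
theorem span_range_eq_of_linear_ode {W : Type*} [NormedAddCommGroup W] [NormedSpace ℝ W]
    [FiniteDimensional ℝ W] {r : ℕ} {u u' : ℝ → Fin r → W} {M : ℝ → Fin r → Fin r → ℝ} {C l h : ℝ}
    (hM : ∀ t ∈ Ioo l h, ∀ i j, |M t i j| ≤ C)
    (hu : ∀ t ∈ Ioo l h, ∀ i, HasDerivAt (fun s => u s i) (u' t i) t)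
    (hu' : ∀ t ∈ Ioo l h, ∀ i, u' t i = ∑ j, M t i j • u t j)
    {t t₁ : ℝ} (ht : t ∈ Ioo l h) (ht₁ : t₁ ∈ Ioo l h) :
    Submodule.span ℝ (range (u t)) = Submodule.span ℝ (range (u t₁)) := by
  have key : ∀ s ∈ Ioo l h, ∀ s₁ ∈ Ioo l h,
      Submodule.span ℝ (range (u s)) ≤ Submodule.span ℝ (range (u s₁)) := by
    intro s hs s₁ hs₁
    rw [Submodule.span_le]
    rintro _ ⟨i, rfl⟩
    by_contra hi
    -- A functional separating `u s i` from the span at `s₁`: its values on the `u j` solve a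
    -- homogeneous linear system and vanish at `s₁`, hence also at `s`. This works without linear
    -- independence of the `u j`.
    obtain ⟨ℓ, hℓ, hker⟩ := Submodule.exists_le_ker_of_notMem hi
    refine hℓ ?_
    have hc : ∀ t ∈ Ioo l h, ∀ i,
        HasDerivAt (fun s => ℓ (u s i)) (∑ j, M t i j * ℓ (u t j)) t := by
      intro t ht i
      have := (LinearMap.toContinuousLinearMap ℓ).hasFDerivAt.comp_hasDerivAt t (hu t ht i)
      rw [hu' t ht i] at this
      simpa using! this
    have h0 : (fun j => ℓ (u s₁ j)) = 0 := by
      funext j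
      exact hker (Submodule.subset_span (mem_range_self j))
    exact congrFun (linear_ode_eq_zero (c := fun s j => ℓ (u s j)) hM hc hs₁ h0 hs) i
  exact le_antisymm (key t ht t₁ ht₁) (key t₁ ht₁ t ht)

/-- The derivative of the inverse of a solution of a linear matrix differential equation. -/
theorem hasDerivAt_inverse_of_linear {E : Type*} [NormedAddCommGroup E] [NormedSpace ℝ E]
    [CompleteSpace E] {A : ℝ → E →L[ℝ] E} {D : E →L[ℝ] E} {t : ℝ}
    (hA : HasDerivAt A (D.comp (A t)) t) (hu : IsUnit (A t)) :
    HasDerivAt (fun s => Ring.inverse (A s)) ((Ring.inverse (A t)).comp (-D)) t := by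
  obtain ⟨x, hx⟩ := hu
  have h1 : HasFDerivAt Ring.inverse
      (-ContinuousLinearMap.mulLeftRight ℝ (E →L[ℝ] E) ↑x⁻¹ ↑x⁻¹) (A t) := by
    rw [← hx]; exact hasFDerivAt_ringInverse x
  have h2 := h1.comp_hasDerivAt t hA
  have h3 : (-ContinuousLinearMap.mulLeftRight ℝ (E →L[ℝ] E) ↑x⁻¹ ↑x⁻¹) (D.comp (A t)) =
      (Ring.inverse (A t)).comp (-D) := by
    rw [← hx, Ring.inverse_unit]
    have h4 : D.comp (x : E →L[ℝ] E) = D * x := rfl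
    have h5 : (↑x⁻¹ : E →L[ℝ] E).comp (-D) = -(↑x⁻¹ * D) := ContinuousLinearMap.comp_neg _ _
    rw [neg_apply, ContinuousLinearMap.mulLeftRight_apply, h4, h5, mul_assoc,
      mul_assoc, Units.mul_inv, mul_one]
  rw [h3] at h2
  exact h2

variable {d m : ℕ} {N : Type*} [TopologicalSpace N] [ChartedSpace (EuclideanSpace ℝ (Fin d)) N]

/-- The values at `q` of the elements of `kerᵐ Ω` span this subspace. -/
def kermAt (Ω : DiffForm d N (m + 1)) (q : N) :
    Submodule ℝ (Multivector (EuclideanSpace ℝ (Fin d)) m) :=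
  Submodule.span ℝ ((fun X : MultivectorField d N m => X.val q) '' kerm Ω univ)

/-- Only this inclusion is available. For x dx∧dy on the plane every kernel vector field is zero,
while all vectors are annihilated on x = 0. So the transport argument follows `kermAt`, not the
pointwise kernel. -/
theorem contraction_eq_zero_of_mem_kermAt {Ω : DiffForm d N (m + 1)} {q : N}
    {v : Multivector (EuclideanSpace ℝ (Fin d)) m} (hv : v ∈ kermAt Ω q) :
    contraction v (Ω.val q) = 0 := by
  induction hv using Submodule.span_induction with
  | mem x hx =>
    obtain ⟨X, hX, rfl⟩ := hx
    exact (mem_kerm_iff.1 hX).2 q (mem_univ q)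
  | zero =>
    have := contraction_smul_left 0 (0 : Multivector (EuclideanSpace ℝ (Fin d)) m) (Ω.val q)
    rwa [zero_smul, zero_smul] at this
  | add x y _ _ hx hy => rw [contraction_add_left, hx, hy, add_zero]
  | smul c x _ hx => rw [contraction_smul_left, hx, smul_zero]

variable [IsManifold (𝓡 d) ∞ N]

theorem val_mem_kermAt [T2Space N] {Ω : DiffForm d N (m + 1)} {U : Set N} (hU : IsOpen U)
    {X : MultivectorField d N m} (hX : X ∈ kerm Ω U) {q : N} (hq : q ∈ U) :
    X.val q ∈ kermAt Ω q := by
  obtain ⟨X', hX', h⟩ := exists_mem_kerm_univ_eventuallyEq hU hX hq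
  exact Submodule.subset_span ⟨X', hX', h.self_of_nhds⟩

theorem kermAt_eq_span [T2Space N] {Ω : DiffForm d N (m + 1)} {U : Set N} (hU : IsOpen U) {r : ℕ}
    {Z : Fin r → MultivectorField d N m} (hZ : ∀ i, Z i ∈ kerm Ω U)
    (hgen : ∀ X ∈ kerm Ω U, ∃ f : Fin r → N → ℝ,
        (∀ i, ContMDiffOn (𝓡 d) 𝓘(ℝ, ℝ) ∞ (f i) U) ∧ ∀ q ∈ U, X q = ∑ i, f i q • Z i q)
    {q : N} (hq : q ∈ U) : kermAt Ω q = Submodule.span ℝ (range fun i => (Z i).val q) := by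
  refine le_antisymm (Submodule.span_le.2 ?_) (Submodule.span_le.2 ?_)
  · rintro _ ⟨X, hX, rfl⟩
    obtain ⟨f, -, hf⟩ := hgen X (kerm_mono (subset_univ _) hX)
    have h1 : X.val q = ∑ i, f i q • (Z i).val q := hf q hq
    change X.val q ∈ _
    rw [h1]
    exact Submodule.sum_mem _ fun i _ => Submodule.smul_mem _ _
      (Submodule.subset_span (mem_range_self i))
  · rintro _ ⟨i, rfl⟩
    exact val_mem_kermAt hU (hZ i) hq

omit [IsManifold (𝓡 d) ∞ N] in
theorem IsLocalDiffeo.mapD_symm_comp {Φ : OpenPartialHomeomorph N N} (hΦ : IsLocalDiffeo d Φ)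
    {p : N} (hp : p ∈ Φ.source) :
    (mapD d Φ.symm (Φ p)).comp (mapD d Φ p) = ContinuousLinearMap.id ℝ _ :=
  OpenPartialHomeomorph.MDifferentiable.symm_comp_deriv
    (he := ⟨hΦ.1.mdifferentiableOn (by simp), hΦ.2.mdifferentiableOn (by simp)⟩) hp

omit [IsManifold (𝓡 d) ∞ N] in
theorem IsLocalDiffeo.mapD_comp_symm {Φ : OpenPartialHomeomorph N N} (hΦ : IsLocalDiffeo d Φ)
    {p : N} (hp : p ∈ Φ.source) :
    (mapD d Φ p).comp (mapD d Φ.symm (Φ p)) = ContinuousLinearMap.id ℝ _ := by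
  have h := hΦ.symm.mapD_symm_comp (Φ.map_source hp)
  rwa [OpenPartialHomeomorph.symm_symm, Φ.left_inv hp] at h

variable {Y : VField d N} (φ : LocalFlow Y)

theorem LocalFlow.isUnit_fderiv {t : ℝ}
    (ht : t ∈ Ioo φ.a φ.b) {x₀ x₁ p : N}
    (hp : p ∈ φ.dom) (hp₁ : p ∈ (extChartAt (𝓡 d) x₁).source)
    (hp₀ : φ.F t p ∈ (extChartAt (𝓡 d) x₀).source) :
    IsUnit (fderiv ℝ (mapInChart d x₀ x₁ (φ.F t)) (extChartAt (𝓡 d) x₁ p)) := by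
  have hps := φ.mem_source ht hp
  have hΦ := φ.isLocalDiffeo t ht
  have u1 : IsUnit (chartD d x₀ (φ.F t p)) :=
    ⟨⟨_, _, chartD_comp_chartDSymm' hp₀, chartDSymm_comp_chartD' hp₀⟩, rfl⟩
  have u2 : IsUnit (mapD d (φ.F t) p) := ⟨⟨_, _, hΦ.mapD_comp_symm hps, hΦ.mapD_symm_comp hps⟩, rfl⟩
  have u3 : IsUnit (chartDSymm x₁ (extChartAt (𝓡 d) x₁ p)) :=
    ⟨⟨_, _, chartDSymm_comp_chartD' hp₁, chartD_comp_chartDSymm' hp₁⟩, rfl⟩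
  rw [φ.fderiv_mapInChart ht hp hp₁ hp₀]
  exact u1.mul (u2.mul u3)

/-- The left inverse of `B` makes Λᵐ B injective, so membership in a span can be tested after
applying it. -/
theorem comap_map_eq_comap_span {E F G : Type*} [NormedAddCommGroup E] [NormedSpace ℝ E]
    [NormedAddCommGroup F] [NormedSpace ℝ F] [NormedAddCommGroup G] [NormedSpace ℝ G] {r : ℕ}
    {T : E →L[ℝ] F} {B : F →L[ℝ] G} {B' : G →L[ℝ] F} (hB : B'.comp B = ContinuousLinearMap.id ℝ F)
    {P : E →L[ℝ] G} (hP : B.comp T = P) (z : Fin r → Multivector F m) :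
    (Submodule.span ℝ (range z)).comap (Multivector.mapₗ T) =
      (Submodule.span ℝ (range fun i => Multivector.map B (z i))).comap (Multivector.mapₗ P) := by
  have h1 : (range fun i => Multivector.map B (z i)) = Multivector.mapₗ (m := m) B '' range z := by
    rw [← range_comp]; rfl
  have hinj : Function.Injective (Multivector.mapₗ (m := m) B) := by
    refine Function.LeftInverse.injective (g := Multivector.mapₗ (m := m) B') fun X => ?_
    rw [Multivector.mapₗ_apply, Multivector.mapₗ_apply, Multivector.map_map, hB,
      Multivector.map_id]
  ext X
  rw [h1, Submodule.span_image, Submodule.mem_comap, Submodule.mem_comap, ← hP,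
    Multivector.mapₗ_apply, Multivector.mapₗ_apply, ← Multivector.map_map,
    ← Multivector.mapₗ_apply (A := B)]
  exact (Function.Injective.mem_set_image hinj).symm

/-- The shape in which the bracket arises from `HasDerivAt.multivectorMap_comp_right` with D = -DY.
-/
theorem schoutenBracketChart_eq_add {E : Type*} [NormedAddCommGroup E] [NormedSpace ℝ E]
    (Y : E → E) (X : E → Multivector E m) (y : E) : schoutenBracketChart Y X y =
      fderiv ℝ X y (Y y) + Multivector.derivation (-fderiv ℝ Y y) (X y) := by
  rw [Multivector.derivation_neg]
  refine ContinuousAlternatingMap.ext fun α => ?_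
  exact sub_eq_add_neg (fderiv ℝ X y (Y y) α) (Multivector.derivation (fderiv ℝ Y y) (X y) α)

/-- The multivector field `Z` at `F t p`, pulled back along the flow and expressed in the chart
at `p`. -/
def LocalFlow.pullback (x₀ p : N) (Z : MultivectorField d N m) (t : ℝ) :
    Multivector (EuclideanSpace ℝ (Fin d)) m :=
  Multivector.map
    (Ring.inverse (fderiv ℝ (mapInChart d x₀ p (φ.F t)) (extChartAt (𝓡 d) p p)))
    (Z.inChart x₀ (extChartAt (𝓡 d) x₀ (φ.F t p)))

/-- The Lie derivative formula d/dt F_t^*Z = F_t^*[Y, Z], at every time. With A the chart expression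
of the derivative of F_t, the variational equation A' = DY·A gives (A⁻¹)' = -A⁻¹·DY, and the product
rule assembles DZ·Y - DY·Z under A⁻¹. -/
theorem LocalFlow.hasDerivAt_pullback [IsManifold (𝓡 d) 1 N] (hY : Y.IsSmooth)
    {Z : MultivectorField d N m} {U : Set N} (hU : IsOpen U) (hZ : Z.IsSmoothOn U) {x₀ p : N}
    (hp : p ∈ φ.dom) {t : ℝ} (ht : t ∈ Ioo φ.a φ.b) (htU : φ.F t p ∈ U)
    (htq : φ.F t p ∈ (extChartAt (𝓡 d) x₀).source) :
    HasDerivAt (φ.pullback x₀ p Z) (φ.pullback x₀ p (schoutenBracket Y Z) t) t := by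
  have hpp : p ∈ (extChartAt (𝓡 d) p).source := mem_extChartAt_source p
  have hR := hasDerivAt_inverse_of_linear (φ.hasDerivAt_fderiv hY ht hp hpp htq)
    (φ.isUnit_fderiv ht hp hpp htq)
  have hz := fderiv_comp_hasDerivAt (F := Multivector (EuclideanSpace ℝ (Fin d)) m)
    ((hZ.contDiffAt hU htq htU).differentiableAt (by simp)) (φ.hasDerivAt_chart ht hp htq)
  have h1 := HasDerivAt.multivectorMap_comp_right hR hz
  rw [← schoutenBracketChart_eq_add, ← schoutenBracket_inChart hY hU hZ htq htU] at h1
  exact h1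

omit [IsManifold (𝓡 d) ∞ N] in
theorem LocalFlow.pullback_eq_sum {r : ℕ} {Z : Fin r → MultivectorField d N m}
    {X : MultivectorField d N m} {x₀ p : N} {t : ℝ} {c : Fin r → ℝ}
    (htq : φ.F t p ∈ (extChartAt (𝓡 d) x₀).source)
    (h : X.val (φ.F t p) = ∑ j, c j • (Z j).val (φ.F t p)) :
    φ.pullback x₀ p X t = ∑ j, c j • φ.pullback x₀ p (Z j) t := by
  unfold LocalFlow.pullback
  simp only [inChart_extChartAt _ htq, Multivector.map_map, h]
  simp only [← Multivector.mapₗ_apply, map_sum, map_smul]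

/-- On the right, t enters only through the span: the map `chartD d p p` is fixed. So a constant
span of pull-backs makes the left side constant, whatever chart at the moving point was used. -/
theorem LocalFlow.comap_span_eq {r : ℕ} (Z : Fin r → MultivectorField d N m) {x₀ p : N}
    (hp : p ∈ φ.dom) {t : ℝ} (ht : t ∈ Ioo φ.a φ.b)
    (htq : φ.F t p ∈ (extChartAt (𝓡 d) x₀).source) :
    (Submodule.span ℝ (range fun i => (Z i).val (φ.F t p))).comap
        (Multivector.mapₗ (mapD d (φ.F t) p)) =
      (Submodule.span ℝ (range fun i => φ.pullback x₀ p (Z i) t)).comap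
        (Multivector.mapₗ (chartD d p p)) := by
  have hpp : p ∈ (extChartAt (𝓡 d) p).source := mem_extChartAt_source p
  have hunit := φ.isUnit_fderiv ht hp hpp htq
  have hA := φ.fderiv_mapInChart ht hp hpp htq
  unfold LocalFlow.pullback
  generalize fderiv ℝ (mapInChart d x₀ p (φ.F t)) (extChartAt (𝓡 d) p p) = A at hunit hA ⊢
  have hAA : A.comp (Ring.inverse A) = ContinuousLinearMap.id ℝ _ :=
    Ring.mul_inverse_cancel _ hunit
  have hAA' : (Ring.inverse A).comp A = ContinuousLinearMap.id ℝ _ :=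
    Ring.inverse_mul_cancel _ hunit
  have hAP : A.comp (chartD d p p) = (chartD d x₀ (φ.F t p)).comp (mapD d (φ.F t) p) := by
    rw [hA, ContinuousLinearMap.comp_assoc, ContinuousLinearMap.comp_assoc,
      chartDSymm_comp_chartD' hpp, ContinuousLinearMap.comp_id]
  simp only [inChart_extChartAt _ htq, Multivector.map_map]
  refine comap_map_eq_comap_span (m := m)
    (B' := (chartDSymm x₀ (extChartAt (𝓡 d) x₀ (φ.F t p))).comp A) ?_ ?_
    (fun i => (Z i).val (φ.F t p))
  · rw [ContinuousLinearMap.comp_assoc, ← ContinuousLinearMap.comp_assoc A, hAA,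
      ContinuousLinearMap.id_comp, chartDSymm_comp_chartD' htq]
  · rw [ContinuousLinearMap.comp_assoc, ← hAP, ← ContinuousLinearMap.comp_assoc, hAA',
      ContinuousLinearMap.id_comp]

/-- The kernel bundle, pulled back along the flow, is locally constant. -/
theorem LocalFlow.eventually_comap_kermAt_eq [T2Space N] [IsManifold (𝓡 d) 1 N] (hY : Y.IsSmooth)
    {Ω : DiffForm d N (m + 1)} (hfg : KermLocallyFinitelyGenerated Ω)
    (hbr : ∀ X ∈ kerm Ω univ, schoutenBracket Y X ∈ kerm Ω univ) {p : N} (hp : p ∈ φ.dom) {t₀ : ℝ}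
    (ht₀ : t₀ ∈ Ioo φ.a φ.b) : ∀ᶠ t in 𝓝 t₀,
      (kermAt Ω (φ.F t p)).comap (Multivector.mapₗ (mapD d (φ.F t) p)) =
        (kermAt Ω (φ.F t₀ p)).comap (Multivector.mapₗ (mapD d (φ.F t₀) p)) := by
  let q : N := φ.F t₀ p
  obtain ⟨U, hU, hqU, r, Z, hZ, hgen⟩ := hfg q
  -- The brackets of `Y` with the generators are again kernel fields on `U`; their coefficients `f i
  -- j` form the matrix of the linear system.
  have hex := fun i => hgen _ (schoutenBracket_mem_kerm hY hbr hU (hZ i))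
  choose f hfs hf using hex
  have hqq : q ∈ (extChartAt (𝓡 d) q).source := mem_extChartAt_source q
  have hFc := φ.continuousAt_time ht₀ hp
  -- One bound for all coefficients near `t₀`: each is within 1 of its value at `q` by continuity,
  -- and the sum dominates every entry.
  let C : ℝ := ∑ i, ∑ j, (|f i j q| + 1)
  have hbound : ∀ᶠ t in 𝓝 t₀, ∀ i j, |f i j (φ.F t p)| ≤ C := by
    refine Filter.eventually_all.2 fun i => Filter.eventually_all.2 fun j => ?_
    have h1 : ContinuousAt (f i j) q := ((hfs i j).continuousOn).continuousAt (hU.mem_nhds hqU)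
    have h2 : ContinuousAt (fun t => |f i j (φ.F t p)|) t₀ :=
      (ContinuousAt.comp (f := fun s => φ.F s p) h1 hFc).abs
    have h3 : |f i j q| + 1 ≤ C :=
      (Finset.single_le_sum (f := fun j => |f i j q| + 1) (fun j _ => by positivity)
        (Finset.mem_univ j)).trans
        (Finset.single_le_sum (f := fun i => ∑ j, (|f i j q| + 1))
          (fun i _ => Finset.sum_nonneg fun j _ => by positivity) (Finset.mem_univ i))
    filter_upwards [h2.eventually_lt_const (lt_add_one |f i j q|)] with t ht
    exact ht.le.trans h3
  have hall : {t | t ∈ Ioo φ.a φ.b ∧ φ.F t p ∈ U ∧ φ.F t p ∈ (extChartAt (𝓡 d) q).source ∧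
      ∀ i j, |f i j (φ.F t p)| ≤ C} ∈ 𝓝 t₀ :=
    Filter.Eventually.and (isOpen_Ioo.mem_nhds ht₀)
      ((hFc.eventually_mem (hU.mem_nhds hqU)).and
        ((hFc.eventually_mem ((isOpen_extChartAt_source q).mem_nhds hqq)).and hbound))
  obtain ⟨l, h, hlh, hsub⟩ := mem_nhds_iff_exists_Ioo_subset.1 hall
  have hu : ∀ t ∈ Ioo l h, ∀ i, HasDerivAt (fun s => φ.pullback q p (Z i) s)
      (φ.pullback q p (schoutenBracket Y (Z i)) t) t := by
    intro t ht i
    obtain ⟨htab, htU, htq, -⟩ := hsub ht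
    exact φ.hasDerivAt_pullback hY hU (hZ i).1 hp htab htU htq
  have hu' : ∀ t ∈ Ioo l h, ∀ i, φ.pullback q p (schoutenBracket Y (Z i)) t =
      ∑ j, f i j (φ.F t p) • φ.pullback q p (Z j) t := by
    intro t ht i
    obtain ⟨htab, htU, htq, -⟩ := hsub ht
    exact φ.pullback_eq_sum (X := schoutenBracket Y (Z i)) htq (hf i _ htU)
  have hcomap : ∀ t ∈ Ioo l h,
      (kermAt Ω (φ.F t p)).comap (Multivector.mapₗ (mapD d (φ.F t) p)) =
        (Submodule.span ℝ (range fun i => φ.pullback q p (Z i) t)).comap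
          (Multivector.mapₗ (chartD d p p)) := by
    intro t ht
    obtain ⟨htab, htU, htq, -⟩ := hsub ht
    rw [kermAt_eq_span hU hZ hgen htU, φ.comap_span_eq Z hp htab htq]
  have hspan : ∀ t ∈ Ioo l h, Submodule.span ℝ (range fun i => φ.pullback q p (Z i) t) =
      Submodule.span ℝ (range fun i => φ.pullback q p (Z i) t₀) := fun t ht =>
    span_range_eq_of_linear_ode (W := Multivector (EuclideanSpace ℝ (Fin d)) m)
      (u := fun t i => φ.pullback q p (Z i) t)
      (u' := fun t i => φ.pullback q p (schoutenBracket Y (Z i)) t) (M := fun t i j => f i j (φ.F t p)) (C := C)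
      (fun t ht => (hsub ht).2.2.2) hu hu' ht hlh
  filter_upwards [isOpen_Ioo.mem_nhds hlh] with t ht
  exact (hcomap t ht).trans ((congrArg (Submodule.comap (Multivector.mapₗ (chartD d p p)))
    (hspan t ht)).trans (hcomap t₀ hlh).symm)

/-- If the bracket with `Y` preserves a locally finitely generated `kerᵐ Ω`, so do the local flows
of `Y`. -/
theorem isInfinitesimalSymmetry_of_schoutenBracket_mem_kerm [T2Space N] [IsManifold (𝓡 d) 1 N]
    (hY : Y.IsSmooth) {Ω : DiffForm d N (m + 1)} (hfg : KermLocallyFinitelyGenerated Ω)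
    (hbr : ∀ X ∈ kerm Ω univ, schoutenBracket Y X ∈ kerm Ω univ) :
    IsInfinitesimalSymmetry Ω Y := by
  intro φ t ht
  refine ⟨φ.isLocalDiffeo t ht, fun X hX => mem_kerm_iff.2
    ⟨isSmoothOn_pushforward (φ.isLocalDiffeo t ht) hX.1, fun q hq => ?_⟩⟩
  let p := (φ.F t).symm q
  have hps : p ∈ (φ.F t).source := (φ.F t).map_target hq
  have hp : p ∈ φ.dom := by rwa [φ.source_eq t ht] at hps
  have hFp : φ.F t p = q := (φ.F t).right_inv hq
  -- The subspace of m-vectors at `p` that the time s map carries into the values of kernel fields.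
  -- It is locally constant in s, so connectedness of the time interval reduces time t to time 0,
  -- where the map is the identity near `p`.
  let L : ℝ → Submodule ℝ (Multivector (EuclideanSpace ℝ (Fin d)) m) := fun s =>
    (kermAt Ω (φ.F s p)).comap (Multivector.mapₗ (mapD d (φ.F s) p))
  have hconst : L t = L 0 := by
    have : PreconnectedSpace (Ioo φ.a φ.b) := Subtype.preconnectedSpace isPreconnected_Ioo
    have hloc : IsLocallyConstant fun s : Ioo φ.a φ.b => L s :=
      (IsLocallyConstant.iff_eventually_eq _).2 fun s =>
        continuousAt_subtype_val.eventually (φ.eventually_comap_kermAt_eq hY hfg hbr hp s.2)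
    exact hloc.apply_eq_of_preconnectedSpace ⟨t, ht⟩ ⟨0, φ.zero_mem⟩
  have h0 : X.val p ∈ L 0 := by
    change Multivector.map (mapD d (φ.F 0) p) (X.val p) ∈ kermAt Ω (φ.F 0 p)
    rw [φ.mapD_zero hp, Multivector.map_id, φ.map_zero p hp]
    exact val_mem_kermAt (φ.F t).open_source hX hps
  rw [← hconst] at h0
  have h1 : Multivector.map (mapD d (φ.F t) p) (X.val p) ∈ kermAt Ω (φ.F t p) := h0
  rw [← pushforward_apply (φ.F t) X hps, hFp] at h1
  exact contraction_eq_zero_of_mem_kermAt h1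

end Preservation

end Multisymplectic

end

/-! ### The two implications combined -/

open Multisymplectic in
theorem mainTheorem5 {m n : ℕ} (hm : 1 ≤ m) {B P N : Type*}
    [TopologicalSpace B] [T2Space B] [SecondCountableTopology B]
    [ChartedSpace (EuclideanSpace ℝ (Fin m)) B] [IsManifold (𝓡 m) ∞ B]
    [TopologicalSpace P] [ChartedSpace (EuclideanSpace ℝ (Fin n)) P] [IsManifold (𝓡 n) ∞ P]
    [TopologicalSpace N] [T2Space N] [SecondCountableTopology N]
    [ChartedSpace (EuclideanSpace ℝ (Fin (m + n))) N] [IsManifold (𝓡 (m + n)) ∞ N]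
    (S : PremultisymplecticSystem m n B P N)
    (hfg : ¬ IsNondegenerate S.Ω → KermLocallyFinitelyGenerated S.Ω)
    (Y : VField (m + n) N) (hY : Y.IsSmooth) :
    IsInfinitesimalSymmetry S.Ω Y ↔
      ∀ X ∈ kerm S.Ω Set.univ, schoutenBracket Y X ∈ kerm S.Ω Set.univ := by
  refine ⟨fun h X hX => h.schoutenBracket_mem_kerm S.smooth_Ω hY hX, fun h => ?_⟩
  refine isInfinitesimalSymmetry_of_schoutenBracket_mem_kerm hY ?_ h
  -- Finite generation is assumed only in the premultisymplectic case; in the multisymplectic case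
  -- the kernel frame supplies it.
  by_cases hΩ : IsNondegenerate S.Ω
  · exact hΩ.kermLocallyFinitelyGenerated S.smooth_Ω
  · exact hfg hΩ
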